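/- **Conventions.** All manifolds are real, smooth, Hausdorff and finite-dimensional; Lie groups are moreover second countable. A Hamiltonian $G$-space $(X,\omega_X,\Phi)$ is a symplectic manifold with a smooth action of $G$ preserving $\omega_X$ and a smooth moment map $\Phi:X\to\mathfrak g^*$, equivariant for the coadjoint action, with $\omega_X(\xi_X,\cdot)=-d\langle\Phi,\xi\rangle$ for $\xi\in\mathfrak g$. Manifolds carry the manifold diffeology (plots are smooth maps). For a diffeological space $Z$ with an action of $G$ and an equivariant moment map $\mu:Z\to\mathfrak g^*$, the reduction $Z/\!\!/G:=\mu^{-1}(0)/G$ carries the quotient diffeology of the subset diffeology of $\mu^{-1}(0)\subset Z$. A *reduced form* of a (diffeological) $2$-form $\omega$ on $Z$ is a diffeological $2$-form $\beta$ on $Z/\!\!/G$ with $\pi^*\beta=j^*\omega$, where $j:\mu^{-1}(0)\hookrightarrow Z$ is the inclusion and $\pi:\mu^{-1}(0)\to Z/\!\!/G$ the projection. Put $\mathrm{Hom}_G(Z_1,Z_2):=(Z_1^-\times Z_2)/\!\!/G$ (diagonal action, moment map $\mu_2-\mu_1$, form $\omega_2-\omega_1$). Let $H\subset G$ be Lie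 groups (i.e. $H$ is a Lie group with an injective smooth homomorphism to $G$; for example a closed subgroup), $(X,\omega_X,\Phi)$ a Hamiltonian $G$-space and $(Y,\omega_Y,\Psi)$ a Hamiltonian $H$-space. Let $\mathrm{Res}_H^GX$ be $X$ with the restricted action and moment map $\Phi(\cdot)|_{\mathfrak h}$. Let $\mathrm{Ind}_H^GY:=(T^*G\times Y)/\!\!/H$ for the action $h(p,y)=(ph^{-1},h(y))$, the moment map $\psi(p,y)=\Psi(y)-(q^{-1}p)|_{\mathfrak h}$ for $p\in T_q^*G$, and the form $d\varpi+\omega_Y$, where $\varpi$ is the canonical $1$-form of $T^*G$; $G$ acts on it by $g[p,y]=[gp,y]$ with moment map $[p,y]\mapsto pq^{-1}$. **Theorem (Symplectic Frobenius Reciprocity).** The rule $$[x,[p,y]]\longmapsto [q^{-1}(x),y]\qquad(p\in T^*_qG)$$ is a well-defined bijection $$t:\mathrm{Hom}_G(X,\mathrm{Ind}_H^GY)\to\mathrm{Hom}_H(\mathrm{Res}_H^GX,Y),$$ and $t$ is a diffeological diffeomorphism: $t$ and $t^{-1}$ are smooth. Moreover, the possibly singular reductions $\mathrm{Ind}_H^GY$,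 $\mathrm{Hom}_G(X,\mathrm{Ind}_H^GY)$ and $\mathrm{Hom}_H(\mathrm{Res}_H^GX,Y)$ each carry exactly one reduced diffeological $2$-form (the form of $X^-\times\mathrm{Ind}_H^GY$ being built with the reduced form of $\mathrm{Ind}_H^GY$), and $t^*$ of the reduced form of $\mathrm{Hom}_H(\mathrm{Res}_H^GX,Y)$ is the reduced form of $\mathrm{Hom}_G(X,\mathrm{Ind}_H^GY)$. -/

import Mathlib

open Diffeology Bundle
open scoped Manifold ContDiff Topology

noncomputable section

namespace FrobRec

/-- The Euclidean space `ℝⁿ`, on which plots are defined. -/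
abbrev Euc (n : ℕ) : Type := EuclideanSpace ℝ (Fin n)

theorem exists_smooth_into {n : ℕ} {u : Set (Euc n)} (hu : IsOpen u) {x : Euc n} (hx : x ∈ u) :
    ∃ f : Euc n → Euc n, (∀ y, f y ∈ u) ∧ ContDiff ℝ ∞ f ∧ f =ᶠ[𝓝 x] id := by
  obtain ⟨ε, hε, hb⟩ := Metric.isOpen_iff.mp hu x hx
  let χ : ContDiffBump x := ⟨ε / 2, ε, by positivity, by linarith⟩
  refine ⟨fun y ↦ x + χ y • (y - x), fun y ↦ hb ?_, ?_, ?_⟩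
  · rw [Metric.mem_ball, dist_eq_norm, add_sub_cancel_left, norm_smul, Real.norm_of_nonneg χ.nonneg]
    by_cases hy : dist y x < ε
    · rw [dist_eq_norm] at hy
      exact (mul_le_of_le_one_left (norm_nonneg _) χ.le_one).trans_lt hy
    · rw [χ.zero_of_le_dist (not_lt.mp hy), zero_mul]; exact hε
  · exact contDiff_const.add (χ.contDiff.smul (contDiff_id.sub contDiff_const))
  · filter_upwards [χ.eventuallyEq_one] with y hy
    simp [hy]

/-- The pullback diffeology: `p` is a plot if and only if `f ∘ p` is a plot. Following Mathlib, a
diffeology is recorded by its plots defined on whole Euclidean spaces. -/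
@[reducible]
def pullbackDiffeology {A B : Type*} [DiffeologicalSpace B] (f : A → B) : DiffeologicalSpace A where
  plots n := {p | IsPlot (f ∘ p)}
  constant_plots x := isPlot_const (x := f x)
  plot_reparam {_ _ p _} hp hf := isPlot_reparam (p := f ∘ p) hp hf
  locality h := DiffeologicalSpace.locality h

/-- The pushforward diffeology along a surjection: the plots are the maps that lift locally
along `f` to plots. -/
@[reducible]
def pushforwardDiffeology {A B : Type*} [DiffeologicalSpace A] (f : A → B)
    (hf : Function.Surjective f) : DiffeologicalSpace B where
  plots n := {p | ∀ x, ∃ q : Euc n → A, IsPlot q ∧ p =ᶠ[𝓝 x] f ∘ q}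
  constant_plots b x := by
    obtain ⟨a, rfl⟩ := hf b
    exact ⟨fun _ ↦ a, isPlot_const, Filter.EventuallyEq.rfl⟩
  plot_reparam {n m p g} hp hg x := by
    obtain ⟨q, hq, h⟩ := hp (g x)
    exact ⟨q ∘ g, isPlot_reparam hq hg, hg.continuous.continuousAt.eventually h⟩
  locality {n p} hp x := by
    obtain ⟨u, hu, hxu, h⟩ := hp x
    obtain ⟨g, hgu, hg, hgx⟩ := exists_smooth_into hu hxu
    obtain ⟨q, hq, h'⟩ := h hgu hg x
    refine ⟨q, hq, ?_⟩
    filter_upwards [h', hgx] with y hy hy'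
    simpa [hy'] using hy

/-- The subset diffeology. -/
instance subtypeDiffeology {A : Type*} [DiffeologicalSpace A] (P : A → Prop) :
    DiffeologicalSpace {a // P a} := pullbackDiffeology Subtype.val

/-- The quotient diffeology. -/
instance quotientDiffeology {A : Type*} [DiffeologicalSpace A] (s : Setoid A) :
    DiffeologicalSpace (Quotient s) := pushforwardDiffeology (Quotient.mk s) Quotient.mk_surjective

/-- The product diffeology: the coarsest one for which both projections are smooth. -/
instance prodDiffeology {A B : Type*} [DiffeologicalSpace A] [DiffeologicalSpace B] :
    DiffeologicalSpace (A × B) := pullbackDiffeology Prod.fst ⊓ pullbackDiffeology Prod.snd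

theorem isPlot_prod_iff {A B : Type*} [DiffeologicalSpace A] [DiffeologicalSpace B] {n : ℕ}
    {p : Euc n → A × B} : IsPlot p ↔ IsPlot (Prod.fst ∘ p) ∧ IsPlot (Prod.snd ∘ p) :=
  DiffeologicalSpace.isPlot_inf_iff

theorem dSmooth_fst {A B : Type*} [DiffeologicalSpace A] [DiffeologicalSpace B] :
    DSmooth (Prod.fst : A × B → A) := fun _ _ hp ↦ (isPlot_prod_iff.mp hp).1

theorem dSmooth_snd {A B : Type*} [DiffeologicalSpace A] [DiffeologicalSpace B] :
    DSmooth (Prod.snd : A × B → B) := fun _ _ hp ↦ (isPlot_prod_iff.mp hp).2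

theorem dSmooth_subtype_val {A : Type*} [DiffeologicalSpace A] (P : A → Prop) :
    DSmooth (Subtype.val : {a // P a} → A) := fun _ _ hp ↦ hp

/-- The manifold diffeology: the plots are the smooth maps `ℝⁿ → M`. -/
@[reducible]
def manifoldDiffeology {E K : Type*} [NormedAddCommGroup E] [NormedSpace ℝ E] [TopologicalSpace K]
    (I : ModelWithCorners ℝ E K) (M : Type*) [TopologicalSpace M] [ChartedSpace K M] :
    DiffeologicalSpace M where
  plots n := {p | ContMDiff (𝓡 n) I ∞ p}
  constant_plots _ := contMDiff_const
  plot_reparam hp hf := hp.comp hf.contMDiff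
  locality {n p} hp x := by
    obtain ⟨u, hu, hxu, h⟩ := hp x
    obtain ⟨g, hgu, hg, hgx⟩ := exists_smooth_into hu hxu
    refine (h hgu hg x).congr_of_eventuallyEq ?_
    filter_upwards [hgx] with y hy
    simp [hy]

/-- A differential `k`-form on a diffeological space: a smooth `k`-form on `ℝⁿ` for every plot
`ℝⁿ → A`, compatible with smooth reparametrizations. -/
@[ext]
structure DForm (A : Type*) [DiffeologicalSpace A] (k : ℕ) where
  toFun : ∀ {n : ℕ} (p : Euc n → A), IsPlot p → Euc n → Euc n [⋀^Fin k]→L[ℝ] ℝ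
  smooth : ∀ {n : ℕ} (p : Euc n → A) (hp : IsPlot p), ContDiff ℝ ∞ (toFun p hp)
  compat : ∀ {n m : ℕ} (p : Euc m → A) (hp : IsPlot p) (f : Euc n → Euc m) (hf : ContDiff ℝ ∞ f)
    (u : Euc n), toFun (p ∘ f) (isPlot_reparam hp hf) u =
      (toFun p hp (f u)).compContinuousLinearMap (fderiv ℝ f u)

namespace DForm

variable {A B : Type*} [DiffeologicalSpace A] [DiffeologicalSpace B] {k : ℕ}

/-- The pullback `(f^* α)(p) = α(f ∘ p)` of a form along a smooth map. -/
def pullback (f : A → B) (hf : DSmooth f) (α : DForm B k) : DForm A k where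
  toFun p hp := α.toFun (f ∘ p) (hf _ p hp)
  smooth _ _ := α.smooth _ _
  compat p hp g hg u := α.compat (f ∘ p) (hf _ p hp) g hg u

/-- The difference of two forms. -/
def sub (α β : DForm A k) : DForm A k where
  toFun p hp u := α.toFun p hp u - β.toFun p hp u
  smooth p hp := (α.smooth p hp).sub (β.smooth p hp)
  compat p hp g hg u := by
    rw [α.compat p hp g hg, β.compat p hp g hg]
    ext v
    simp

/-- The sum of two forms. -/
def add (α β : DForm A k) : DForm A k where
  toFun p hp u := α.toFun p hp u + β.toFun p hp u
  smooth p hp := (α.smooth p hp).add (β.smooth p hp)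
  compat p hp g hg u := by
    rw [α.compat p hp g hg, β.compat p hp g hg]
    ext v
    simp

/-- The exterior derivative `(dα)(p) = d(α(p))`. -/
def d (α : DForm A k) : DForm A (k + 1) where
  toFun p hp := extDeriv (α.toFun p hp)
  smooth p hp := by
    have h : ContDiff ℝ ∞ (fderiv ℝ (α.toFun p hp)) := (α.smooth p hp).fderiv_right (by simp)
    exact (ContinuousAlternatingMap.alternatizeUncurryFinCLM ℝ _ ℝ).contDiff.comp h
  compat {n m} p hp g hg u := by
    have h : α.toFun (p ∘ g) (isPlot_reparam hp hg) =
        fun x ↦ (α.toFun p hp (g x)).compContinuousLinearMap (fderiv ℝ g x) :=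
      funext fun x ↦ α.compat p hp g hg x
    rw [h]
    exact extDeriv_pullback ((α.smooth p hp).differentiable (by simp) _) hg.contDiffAt
      (r := ∞) (by simpa using ENat.LEInfty.out)

end DForm

theorem contDiff_alternating {E F : Type*} [NormedAddCommGroup E] [NormedSpace ℝ E]
    [NormedAddCommGroup F] [NormedSpace ℝ F] [FiniteDimensional ℝ F] {k : ℕ}
    {α : E → F [⋀^Fin k]→L[ℝ] ℝ} {s : E} (h : ∀ v, ContDiffAt ℝ ∞ (fun x ↦ α x v) s) :
    ContDiffAt ℝ ∞ α s := by
  let b := Module.finBasis ℝ F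
  let L : (F [⋀^Fin k]→L[ℝ] ℝ) →ₗ[ℝ] ((Fin k → Fin (Module.finrank ℝ F)) → ℝ) :=
    { toFun := fun a i ↦ a (fun j ↦ b (i j))
      map_add' := fun _ _ ↦ rfl
      map_smul' := fun _ _ ↦ rfl }
  have hL : Function.Injective L := by
    intro a a' haa
    apply ContinuousAlternatingMap.toAlternatingMap_injective
    exact Module.Basis.ext_alternating b fun v _ ↦ congrFun haa v
  obtain ⟨R, hR⟩ := L.exists_leftInverse_of_injective (LinearMap.ker_eq_bot.mpr hL)
  have : α = fun x ↦ LinearMap.toContinuousLinearMap R (L (α x)) := by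
    funext x
    exact (LinearMap.congr_fun hR (α x)).symm
  rw [this]
  exact (LinearMap.toContinuousLinearMap R).contDiff.contDiffAt.comp s
    (contDiffAt_pi.mpr fun i ↦ h _)

theorem contDiffAt_alternating_apply {E F : Type*} [NormedAddCommGroup E] [NormedSpace ℝ E]
    [NormedAddCommGroup F] [NormedSpace ℝ F] [FiniteDimensional ℝ F] {s : E} : ∀ {k : ℕ}
    {α : E → F [⋀^Fin k]→L[ℝ] ℝ} {v : Fin k → E → F}, ContDiffAt ℝ ∞ α s →
    (∀ i, ContDiffAt ℝ ∞ (v i) s) → ContDiffAt ℝ ∞ (fun x ↦ α x (fun i ↦ v i x)) s := by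
  intro k
  induction k with
  | zero =>
    intro α v hα _
    have : (fun x ↦ α x (fun i ↦ v i x)) = fun x ↦ α x (fun _ ↦ 0) := by
      funext x
      congr 1
      exact Subsingleton.elim _ _
    rw [this]
    exact (ContinuousAlternatingMap.apply ℝ F ℝ (fun _ : Fin 0 ↦ (0 : F))).contDiff.contDiffAt.comp s hα
  | succ k ih =>
    intro α v hα hv
    have h1 : ContDiffAt ℝ ∞ (fun x ↦ (α x).curryLeft (v 0 x)) s := by
      refine contDiff_alternating fun w ↦ ?_
      let b := Module.finBasis ℝ F
      have key : (fun x ↦ (α x).curryLeft (v 0 x) w) = fun x ↦ ∑ j,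
          (LinearMap.toContinuousLinearMap (b.coord j)) (v 0 x) •
            α x (Matrix.vecCons (b j) w) := by
        funext x
        have h0 : (α x).curryLeft (v 0 x) w =
            (α x).curryLeft (∑ j, b.repr (v 0 x) j • b j) w := by rw [b.sum_repr]
        rw [h0, map_sum, ContinuousAlternatingMap.sum_apply]
        refine Finset.sum_congr rfl fun j _ ↦ ?_
        rw [map_smul]
        rfl
      rw [key]
      refine ContDiffAt.sum fun j _ ↦ ContDiffAt.fun_smul ?_ ?_
      · exact (ContinuousLinearMap.contDiff _).contDiffAt.comp s (hv 0)
      · exact (ContinuousAlternatingMap.apply ℝ F ℝ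
          (Matrix.vecCons (b j) w)).contDiff.contDiffAt.comp s hα
    have h2 := ih h1 (fun i ↦ hv i.succ)
    convert h2 using 2 with x
    rw [ContinuousAlternatingMap.curryLeft_apply_apply]
    congr 1
    funext i
    refine Fin.cases rfl (fun j ↦ rfl) i

section ManifoldForm

variable {E : Type*} [NormedAddCommGroup E] [NormedSpace ℝ E] [FiniteDimensional ℝ E] {M : Type*} [TopologicalSpace M]
  [ChartedSpace E M] {k : ℕ}

/-- The expression of the `k`-form `σ` in the preferred chart at `x₀`. -/
def coordinateForm (σ : ∀ x : M, TangentSpace 𝓘(ℝ, E) x [⋀^Fin k]→L[ℝ] ℝ) (x₀ : M) (e : E) :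
    E [⋀^Fin k]→L[ℝ] ℝ :=
  (σ ((chartAt E x₀).symm e)).compContinuousLinearMap
    (mfderiv 𝓘(ℝ, E) 𝓘(ℝ, E) (chartAt E x₀).symm e)

/-- The form is smooth, i.e. its expression in every preferred chart is smooth. -/
def IsSmoothForm (σ : ∀ x : M, TangentSpace 𝓘(ℝ, E) x [⋀^Fin k]→L[ℝ] ℝ) : Prop :=
  ∀ x₀ : M, ContDiffOn ℝ ∞ (coordinateForm σ x₀) (chartAt E x₀).target

/-- The form is closed, i.e. its expression in every preferred chart is closed. -/
def IsClosedForm (σ : ∀ x : M, TangentSpace 𝓘(ℝ, E) x [⋀^Fin k]→L[ℝ] ℝ) : Prop :=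
  ∀ x₀ : M, ∀ e ∈ (chartAt E x₀).target, extDeriv (coordinateForm σ x₀) e = 0

/-- A smooth form `σ` on a manifold, as a form on the diffeological space: `p ↦ p^* σ`. -/
def manifoldForm [IsManifold 𝓘(ℝ, E) ∞ M]
    (σ : ∀ x : M, TangentSpace 𝓘(ℝ, E) x [⋀^Fin k]→L[ℝ] ℝ) (hσ : IsSmoothForm σ) :
    @DForm M (manifoldDiffeology 𝓘(ℝ, E) M) k :=
  letI := manifoldDiffeology 𝓘(ℝ, E) M
  { toFun := fun {n} p _ u ↦ ((σ (p u)).compContinuousLinearMap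
        (mfderiv (𝓡 n) 𝓘(ℝ, E) p u) : Euc n [⋀^Fin k]→L[ℝ] ℝ)
    smooth := fun {n} p hp ↦ by
      have hp' : ContMDiff (𝓡 n) 𝓘(ℝ, E) ∞ p := hp
      refine contDiff_iff_contDiffAt.mpr fun u₀ ↦ ?_
      let φ := chartAt E (p u₀)
      have hsrc : ∀ᶠ u in 𝓝 u₀, p u ∈ φ.source :=
        hp'.continuous.continuousAt.eventually
          (φ.open_source.mem_nhds (mem_chart_source E (p u₀)))
      have hφp : ∀ u, p u ∈ φ.source → ContDiffAt ℝ ∞ (φ ∘ p) u := fun u hu ↦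
        (((contMDiffOn_chart (I := 𝓘(ℝ, E)) (n := ∞) (x := p u₀)).contMDiffAt
          (φ.open_source.mem_nhds hu)).comp u (hp' u)).contDiffAt
      have hval : (fun u ↦ ((σ (p u)).compContinuousLinearMap
          (mfderiv (𝓡 n) 𝓘(ℝ, E) p u) : Euc n [⋀^Fin k]→L[ℝ] ℝ)) =ᶠ[𝓝 u₀]
          fun u ↦ (coordinateForm σ (p u₀) ((φ ∘ p) u)).compContinuousLinearMap
            (fderiv ℝ (φ ∘ p) u) := by
        filter_upwards [hsrc.eventually_nhds] with u hu
        have hu' := hu.self_of_nhds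
        have hpl : p =ᶠ[𝓝 u] φ.symm ∘ (φ ∘ p) := by
          filter_upwards [hu] with w hw
          exact (φ.left_inv hw).symm
        have hsymm : MDifferentiableAt 𝓘(ℝ, E) 𝓘(ℝ, E) φ.symm ((φ ∘ p) u) :=
          ((contMDiffOn_chart_symm (I := 𝓘(ℝ, E)) (n := ∞) (x := p u₀)).contMDiffAt
            (φ.open_target.mem_nhds (φ.map_source hu'))).mdifferentiableAt (by simp)
        have h1 : mfderiv (𝓡 n) 𝓘(ℝ, E) p u = (mfderiv 𝓘(ℝ, E) 𝓘(ℝ, E) φ.symm ((φ ∘ p) u)).comp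
            (fderiv ℝ (φ ∘ p) u) := by
          rw [hpl.mfderiv_eq, mfderiv_comp u hsymm
            ((hφp u hu').contMDiffAt.mdifferentiableAt (by simp)), mfderiv_eq_fderiv]
          rfl
        have h2 : φ.symm ((φ ∘ p) u) = p u := φ.left_inv hu'
        ext v
        simp only [ContinuousAlternatingMap.compContinuousLinearMap_apply, h1, coordinateForm]
        rw [h2]
        rfl
      refine ContDiffAt.congr_of_eventuallyEq ?_ hval
      have hu₀ : p u₀ ∈ φ.source := mem_chart_source E (p u₀)
      refine contDiff_alternating fun v ↦ ?_
      refine contDiffAt_alternating_apply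
        (α := fun u ↦ coordinateForm σ (p u₀) ((φ ∘ p) u))
        (v := fun i u ↦ fderiv ℝ (φ ∘ p) u (v i)) ?_ fun i ↦ ?_
      · exact ContDiffAt.comp u₀ (((hσ (p u₀)).contDiffAt
          (φ.open_target.mem_nhds (φ.map_source hu₀)))) (hφp u₀ hu₀)
      · exact ((hφp u₀ hu₀).fderiv_right (m := ∞) (by simp)).clm_apply contDiffAt_const
    compat := fun {n m} p hp f hf u ↦ by
      have hp' : ContMDiff (𝓡 m) 𝓘(ℝ, E) ∞ p := hp
      have h : mfderiv (𝓡 n) 𝓘(ℝ, E) (p ∘ f) u =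
          (mfderiv (𝓡 m) 𝓘(ℝ, E) p (f u)).comp (mfderiv (𝓡 n) (𝓡 m) f u) :=
        mfderiv_comp u (hp'.mdifferentiable (by simp) _) (hf.contMDiff.mdifferentiable (by simp) _)
      rw [mfderiv_eq_fderiv] at h
      ext v
      simp only [ContinuousAlternatingMap.compContinuousLinearMap_apply, h]
      rfl }

end ManifoldForm

section LieGroup

variable (E : Type*) [NormedAddCommGroup E] [NormedSpace ℝ E] (G : Type*) [TopologicalSpace G]
  [ChartedSpace E G] [Group G]

/-- The Lie algebra of `G`, i.e. the tangent space at `1`. -/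
abbrev LieAlg : Type _ := GroupLieAlgebra 𝓘(ℝ, E) G

/-- The dual of the Lie algebra. -/
abbrev LieDual : Type _ := LieAlg E G →L[ℝ] ℝ

variable {G}

/-- The adjoint action: the derivative at `1` of the conjugation by `g`. -/
def adjointAction (g : G) : LieAlg E G →L[ℝ] LieAlg E G :=
  (mfderiv 𝓘(ℝ, E) 𝓘(ℝ, E) (fun a : G ↦ g * a * g⁻¹) 1 : E →L[ℝ] E)

end LieGroup

universe u v

set_option linter.checkUnivs false in
/-- A Hamiltonian `G`-space: a (Hausdorff, finite-dimensional, real, smooth) manifold `carrier` with a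
smooth action of `G` by symplectomorphisms of a symplectic form `form`, and with a moment map
`moment` that is equivariant for the coadjoint action. The sign convention is
`form (ξ_X, ·) = -d ⟨moment, ξ⟩`, where `ξ_X(x)` is the derivative at `1` of `g ↦ g x`
in the direction `ξ`. -/
structure HamiltonianSpace (E : Type*) [NormedAddCommGroup E] [NormedSpace ℝ E]
    (G : Type*) [TopologicalSpace G] [ChartedSpace E G] [Group G] where
  carrier : Type u
  model : Type v
  [normedAddCommGroup : NormedAddCommGroup model]
  [normedSpace : NormedSpace ℝ model]
  [finiteDimensional : FiniteDimensional ℝ model]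
  [topologicalSpace : TopologicalSpace carrier]
  [t2Space : T2Space carrier]
  [chartedSpace : ChartedSpace model carrier]
  [isManifold : IsManifold 𝓘(ℝ, model) ∞ carrier]
  act : G →* Equiv.Perm carrier
  contMDiff_act : ContMDiff (𝓘(ℝ, E).prod 𝓘(ℝ, model)) 𝓘(ℝ, model) ∞
    (fun z : G × carrier ↦ act z.1 z.2)
  form : ∀ x : carrier, TangentSpace 𝓘(ℝ, model) x [⋀^Fin 2]→L[ℝ] ℝ
  isSmooth_form : IsSmoothForm form
  isClosed_form : IsClosedForm form
  nondegenerate : ∀ (x : carrier) (a : TangentSpace 𝓘(ℝ, model) x),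
    (∀ b : TangentSpace 𝓘(ℝ, model) x, form x ![a, b] = 0) → a = 0
  form_act : ∀ (g : G) (x : carrier) (a b : TangentSpace 𝓘(ℝ, model) x),
    form (act g x) ![mfderiv 𝓘(ℝ, model) 𝓘(ℝ, model) (act g) x a,
      mfderiv 𝓘(ℝ, model) 𝓘(ℝ, model) (act g) x b] = form x ![a, b]
  moment : carrier → LieDual E G
  contMDiff_moment : ∀ ξ : LieAlg E G, ContMDiff 𝓘(ℝ, model) 𝓘(ℝ, ℝ) ∞ (fun x ↦ moment x ξ)
  moment_act : ∀ (g : G) (x : carrier) (ξ : LieAlg E G),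
    moment (act g x) (adjointAction E g ξ) = moment x ξ
  form_fundamental : ∀ (ξ : LieAlg E G) (x : carrier) (a : TangentSpace 𝓘(ℝ, model) x),
    form x ![(mfderiv 𝓘(ℝ, E) 𝓘(ℝ, model) (fun g : G ↦ act g x) 1 ξ : model), a] =
      -(mfderiv 𝓘(ℝ, model) 𝓘(ℝ, ℝ) (fun z ↦ moment z ξ) x a : ℝ)

namespace HamiltonianSpace

attribute [instance] normedAddCommGroup normedSpace finiteDimensional topologicalSpace t2Space
  chartedSpace isManifold

variable {E : Type*} [NormedAddCommGroup E] [NormedSpace ℝ E]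
    {G : Type*} [TopologicalSpace G] [ChartedSpace E G] [Group G]

/-- A Hamiltonian space carries its manifold diffeology. -/
instance (X : HamiltonianSpace E G) : DiffeologicalSpace X.carrier :=
  manifoldDiffeology 𝓘(ℝ, X.model) X.carrier

/-- The symplectic form as a diffeological form. -/
def dForm (X : HamiltonianSpace E G) : DForm X.carrier 2 := manifoldForm X.form X.isSmooth_form

end HamiltonianSpace

section Cotangent

variable (E : Type*) [NormedAddCommGroup E] [NormedSpace ℝ E] (G : Type*) [TopologicalSpace G]
  [ChartedSpace E G] [IsManifold 𝓘(ℝ, E) ∞ G]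

/-- The cotangent bundle `T^*G`; an element `p` has the base point `p.1` and the covector `p.2`. -/
abbrev CotangentBundle : Type _ :=
  TotalSpace (E →L[ℝ] ℝ) (fun q : G ↦ TangentSpace 𝓘(ℝ, E) q →L[ℝ] ℝ)

/-- The cotangent bundle carries the diffeology of Mathlib's manifold structure on the bundle. -/
instance : DiffeologicalSpace (CotangentBundle E G) :=
  manifoldDiffeology (𝓘(ℝ, E).prod 𝓘(ℝ, E →L[ℝ] ℝ)) (CotangentBundle E G)

variable [FiniteDimensional ℝ E]

/-- The canonical `1`-form `δp ↦ ⟨p, δq⟩` of the cotangent bundle. -/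
def liouvilleForm : DForm (CotangentBundle E G) 1 where
  toFun {n} p _ u := ContinuousAlternatingMap.ofSubsingleton ℝ (Euc n) ℝ (0 : Fin 1)
    ((p u).2.comp (mfderiv (𝓡 n) 𝓘(ℝ, E) (fun w ↦ (p w).1) u))
  smooth {n} p hp := by
    have hp' : ContMDiff (𝓡 n) (𝓘(ℝ, E).prod 𝓘(ℝ, E →L[ℝ] ℝ)) ∞ p := hp
    have hq : ContMDiff (𝓡 n) 𝓘(ℝ, E) ∞ (fun w ↦ (p w).1) :=
      (contMDiff_proj (fun q : G ↦ TangentSpace 𝓘(ℝ, E) q →L[ℝ] ℝ)).comp hp'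
    refine contDiff_iff_contDiffAt.mpr fun u ↦ contDiff_alternating fun v ↦ ?_
    have hs : ContMDiff (𝓡 n) (𝓘(ℝ, E).prod 𝓘(ℝ, E)) ∞ (fun w : Euc n ↦
        (TotalSpace.mk' E (p w).1 (mfderiv (𝓡 n) 𝓘(ℝ, E) (fun w ↦ (p w).1) w (v 0)) :
          TangentBundle 𝓘(ℝ, E) G)) := by
      have h1 := hq.contMDiff_tangentMap (m := ∞) (by simp)
      have h2 : ContMDiff (𝓡 n) ((𝓡 n).tangent) ∞
          (fun w : Euc n ↦ (⟨w, v 0⟩ : TangentBundle (𝓡 n) (Euc n))) := by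
        exact contMDiff_vectorSpace_iff_contDiff (V := fun _ : Euc n ↦ (v 0 : Euc n)) |>.mpr
          contDiff_const
      exact h1.comp h2
    have h3 := (hp' u).clm_bundle_apply (F₂ := ℝ) (E₂ := Bundle.Trivial G ℝ) (hs u)
    simp only [contMDiffAt_totalSpace] at h3
    exact h3.2.contDiffAt
  compat {n m} p hp f hf u := by
    have hp' : ContMDiff (𝓡 m) (𝓘(ℝ, E).prod 𝓘(ℝ, E →L[ℝ] ℝ)) ∞ p := hp
    have hq : ContMDiff (𝓡 m) 𝓘(ℝ, E) ∞ (fun w ↦ (p w).1) :=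
      (contMDiff_proj (fun q : G ↦ TangentSpace 𝓘(ℝ, E) q →L[ℝ] ℝ)).comp hp'
    have h : mfderiv (𝓡 n) 𝓘(ℝ, E) ((fun w ↦ (p w).1) ∘ f) u =
        (mfderiv (𝓡 m) 𝓘(ℝ, E) (fun w ↦ (p w).1) (f u)).comp (mfderiv (𝓡 n) (𝓡 m) f u) :=
      mfderiv_comp u (hq.mdifferentiable (by simp) _) (hf.contMDiff.mdifferentiable (by simp) _)
    rw [mfderiv_eq_fderiv] at h
    ext v
    exact congrArg (p (f u)).2 (congrArg (fun L ↦ L (v 0)) h)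

end Cotangent


section Action

/-- The permutation action defined by a map `G → Z → Z` satisfying the axioms of an action. -/
def actionOf {G Z : Type*} [Group G] (f : G → Z → Z) (h₁ : ∀ z, f 1 z = z)
    (h₂ : ∀ g g' z, f (g * g') z = f g (f g' z)) : G →* Equiv.Perm Z :=
  @MulAction.toPermHom G Z _ { smul := f, one_smul := h₁, mul_smul := h₂ }

/-- The diagonal action on a product. -/
def diagonalAction {G A B : Type*} [Group G] (ρ : G →* Equiv.Perm A) (τ : G →* Equiv.Perm B) :
    G →* Equiv.Perm (A × B) :=
  actionOf (fun g z ↦ (ρ g z.1, τ g z.2)) (by simp) (by simp)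

end Action

section ChainRule

variable {E₁ E₂ E₃ : Type*} [NormedAddCommGroup E₁] [NormedSpace ℝ E₁] [NormedAddCommGroup E₂]
  [NormedSpace ℝ E₂] [NormedAddCommGroup E₃] [NormedSpace ℝ E₃] {M₁ M₂ M₃ : Type*}
  [TopologicalSpace M₁] [ChartedSpace E₁ M₁] [TopologicalSpace M₂] [ChartedSpace E₂ M₂]
  [TopologicalSpace M₃] [ChartedSpace E₃ M₃]

theorem mfderiv_congr_fun {f f' : M₁ → M₂} (h : f = f') (a : M₁) :
    (mfderiv 𝓘(ℝ, E₁) 𝓘(ℝ, E₂) f a : E₁ →L[ℝ] E₂) = mfderiv 𝓘(ℝ, E₁) 𝓘(ℝ, E₂) f' a := by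
  subst h; rfl

theorem mfderiv_chain {f : M₂ → M₃} {g : M₁ → M₂} {k : M₁ → M₃} (hk : k = f ∘ g) {a : M₁} {b : M₂}
    (hb : g a = b) (hf : MDifferentiable 𝓘(ℝ, E₂) 𝓘(ℝ, E₃) f)
    (hg : MDifferentiable 𝓘(ℝ, E₁) 𝓘(ℝ, E₂) g) (v : E₁) :
    (mfderiv 𝓘(ℝ, E₂) 𝓘(ℝ, E₃) f b : E₂ →L[ℝ] E₃)
      ((mfderiv 𝓘(ℝ, E₁) 𝓘(ℝ, E₂) g a : E₁ →L[ℝ] E₂) v) =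
    (mfderiv 𝓘(ℝ, E₁) 𝓘(ℝ, E₃) k a : E₁ →L[ℝ] E₃) v := by
  subst hk hb
  exact (congrArg (fun L : E₁ →L[ℝ] E₃ ↦ L v) (mfderiv_comp a (hf _) (hg a))).symm

end ChainRule

section Cotangent

variable {E : Type*} [NormedAddCommGroup E] [NormedSpace ℝ E] {G : Type*} [TopologicalSpace G]
  [ChartedSpace E G]

/-- The covector of `p`, on the model space of the tangent space. -/
def CotangentBundle.covector (p : CotangentBundle E G) : E →L[ℝ] ℝ := p.2

theorem CotangentBundle.ext' {p p' : CotangentBundle E G} (h : p.1 = p'.1)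
    (h' : ∀ v : E, p.covector v = p'.covector v) : p = p' := by
  obtain ⟨q, α⟩ := p
  obtain ⟨q', α'⟩ := p'
  obtain rfl : q = q' := h
  congr 1
  exact ContinuousLinearMap.ext h'

end Cotangent

section Translation

variable {E : Type*} [NormedAddCommGroup E] [NormedSpace ℝ E] {G : Type*} [TopologicalSpace G]
  [ChartedSpace E G] [Group G]

variable (E) in
/-- The derivative at `a` of the left translation by `g`. -/
def leftDeriv (g a : G) : E →L[ℝ] E := mfderiv 𝓘(ℝ, E) 𝓘(ℝ, E) (fun b : G ↦ g * b) a

variable (E) in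
/-- The derivative at `a` of the right translation by `k`. -/
def rightDeriv (k a : G) : E →L[ℝ] E := mfderiv 𝓘(ℝ, E) 𝓘(ℝ, E) (fun b : G ↦ b * k) a

theorem leftDeriv_one (a : G) : leftDeriv E 1 a = ContinuousLinearMap.id ℝ E := by
  have h : (fun b : G ↦ 1 * b) = id := by funext b; simp
  exact (mfderiv_congr_fun h a).trans mfderiv_id

theorem rightDeriv_one (a : G) : rightDeriv E 1 a = ContinuousLinearMap.id ℝ E := by
  have h : (fun b : G ↦ b * 1) = id := by funext b; simp
  exact (mfderiv_congr_fun h a).trans mfderiv_id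

variable [LieGroup 𝓘(ℝ, E) ∞ G]

theorem mdifferentiable_left (g : G) :
    MDifferentiable 𝓘(ℝ, E) 𝓘(ℝ, E) (fun b : G ↦ g * b) :=
  (contMDiff_mul_left (I := 𝓘(ℝ, E)) (n := ∞)).mdifferentiable (by simp)

theorem mdifferentiable_right (g : G) :
    MDifferentiable 𝓘(ℝ, E) 𝓘(ℝ, E) (fun b : G ↦ b * g) :=
  (contMDiff_mul_right (I := 𝓘(ℝ, E)) (n := ∞)).mdifferentiable (by simp)

theorem leftDeriv_leftDeriv (g h a : G) (v : E) :
    leftDeriv E g (h * a) (leftDeriv E h a v) = leftDeriv E (g * h) a v :=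
  mfderiv_chain (by funext b; simp [mul_assoc]) rfl (mdifferentiable_left g)
    (mdifferentiable_left h) v

theorem rightDeriv_rightDeriv (k l a : G) (v : E) :
    rightDeriv E k (a * l) (rightDeriv E l a v) = rightDeriv E (l * k) a v :=
  mfderiv_chain (by funext b; simp [mul_assoc]) rfl (mdifferentiable_right k)
    (mdifferentiable_right l) v

theorem leftDeriv_rightDeriv (g k a : G) (v : E) :
    leftDeriv E g (a * k) (rightDeriv E k a v) = rightDeriv E k (g * a) (leftDeriv E g a v) :=
  (mfderiv_chain (k := fun b : G ↦ g * b * k) (by funext b; simp [mul_assoc]) rfl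
    (mdifferentiable_left g) (mdifferentiable_right k) v).trans
  (mfderiv_chain (k := fun b : G ↦ g * b * k) (by funext b; simp [mul_assoc]) rfl
    (mdifferentiable_right k) (mdifferentiable_left g) v).symm

variable (E G) in
/-- The action `(g, p) ↦ gp` of `G` on `T^*G`, with `⟨gp, v⟩ = ⟨p, g⁻¹v⟩`. -/
def leftAction : G →* Equiv.Perm (CotangentBundle E G) :=
  actionOf (fun g p ↦ ⟨g * p.1, p.covector.comp (leftDeriv E g⁻¹ (g * p.1))⟩)
    (fun p ↦ CotangentBundle.ext' (one_mul _) fun v ↦ by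
      show p.covector (leftDeriv E 1⁻¹ (1 * p.1) v) = p.covector v
      rw [inv_one, leftDeriv_one]
      rfl)
    (fun g g' p ↦ CotangentBundle.ext' (mul_assoc _ _ _) fun v ↦ by
      have h := leftDeriv_leftDeriv g'⁻¹ g⁻¹ (g * (g' * p.1)) v
      rw [inv_mul_cancel_left] at h
      show p.covector (leftDeriv E (g * g')⁻¹ (g * g' * p.1) v) = p.covector
        (leftDeriv E g'⁻¹ (g' * p.1) (leftDeriv E g⁻¹ (g * (g' * p.1)) v))
      rw [h, mul_inv_rev, mul_assoc])

variable (E G) in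
/-- The action `(k, p) ↦ pk⁻¹` of `G` on `T^*G`, with `⟨pk⁻¹, v⟩ = ⟨p, vk⟩`. -/
def rightAction : G →* Equiv.Perm (CotangentBundle E G) :=
  actionOf (fun k p ↦ ⟨p.1 * k⁻¹, p.covector.comp (rightDeriv E k (p.1 * k⁻¹))⟩)
    (fun p ↦ CotangentBundle.ext' (by simp) fun v ↦ by
      show p.covector (rightDeriv E 1 (p.1 * 1⁻¹) v) = p.covector v
      rw [rightDeriv_one]
      rfl)
    (fun k k' p ↦ CotangentBundle.ext' (by simp [mul_assoc]) fun v ↦ by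
      have h := rightDeriv_rightDeriv k' k (p.1 * k'⁻¹ * k⁻¹) v
      rw [inv_mul_cancel_right] at h
      show p.covector (rightDeriv E (k * k') (p.1 * (k * k')⁻¹) v) = p.covector
        (rightDeriv E k' (p.1 * k'⁻¹) (rightDeriv E k (p.1 * k'⁻¹ * k⁻¹) v))
      rw [h, mul_inv_rev, mul_assoc])

/-- The element `pq⁻¹ : ξ ↦ ⟨p, ξq⟩` of the dual of the Lie algebra, for `p ∈ T^*_q G`. -/
def leftMomentum (p : CotangentBundle E G) : LieDual E G := p.covector.comp (rightDeriv E p.1 1)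

/-- The element `q⁻¹p : ξ ↦ ⟨p, qξ⟩` of the dual of the Lie algebra, for `p ∈ T^*_q G`. -/
def bodyMomentum (p : CotangentBundle E G) : LieDual E G := p.covector.comp (leftDeriv E p.1 1)

theorem bodyMomentum_leftAction (g : G) (p : CotangentBundle E G) :
    bodyMomentum (leftAction E G g p) = bodyMomentum p := by
  refine ContinuousLinearMap.ext fun v ↦ ?_
  have h := leftDeriv_leftDeriv (E := E) g⁻¹ (g * p.1) 1 v
  rw [mul_one, inv_mul_cancel_left] at h
  exact congrArg p.covector h

theorem leftMomentum_rightAction (k : G) (p : CotangentBundle E G) :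
    leftMomentum (rightAction E G k p) = leftMomentum p := by
  refine ContinuousLinearMap.ext fun v ↦ ?_
  have h := rightDeriv_rightDeriv (E := E) k (p.1 * k⁻¹) 1 v
  rw [one_mul, inv_mul_cancel_right] at h
  exact congrArg p.covector h

theorem leftAction_rightAction (g k : G) (p : CotangentBundle E G) :
    rightAction E G k (leftAction E G g p) = leftAction E G g (rightAction E G k p) := by
  refine CotangentBundle.ext' (mul_assoc _ _ _) fun v ↦ ?_
  have h := leftDeriv_rightDeriv (E := E) g⁻¹ k (g * p.1 * k⁻¹) v
  rw [inv_mul_cancel_right] at h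
  have h' : g⁻¹ * (g * p.1 * k⁻¹) = p.1 * k⁻¹ := by simp [mul_assoc]
  rw [h'] at h
  refine (congrArg p.covector h).trans ?_
  show p.covector _ = p.covector (rightDeriv E k (p.1 * k⁻¹) (leftDeriv E g⁻¹ (g * (p.1 * k⁻¹)) v))
  rw [mul_assoc]

end Translation

section Restriction

variable {E : Type*} [NormedAddCommGroup E] [NormedSpace ℝ E] {G : Type*} [TopologicalSpace G]
  [ChartedSpace E G] [Group G]
  {E' : Type*} [NormedAddCommGroup E'] [NormedSpace ℝ E'] {H : Type*} [TopologicalSpace H]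
  [ChartedSpace E' H] [Group H]

variable (E E') in
/-- The map of Lie algebras induced by `ι : H → G`; precomposition with it restricts
functionals from the Lie algebra of `G` to the one of `H`. -/
def lieDeriv (ι : H →* G) : LieAlg E' H →L[ℝ] LieAlg E G :=
  (mfderiv 𝓘(ℝ, E') 𝓘(ℝ, E) ι 1 : E' →L[ℝ] E)

variable [LieGroup 𝓘(ℝ, E) ∞ G] [LieGroup 𝓘(ℝ, E') ∞ H]

theorem mdifferentiable_conj (g : G) :
    MDifferentiable 𝓘(ℝ, E) 𝓘(ℝ, E) (fun b : G ↦ g * b * g⁻¹) :=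
  (mdifferentiable_right g⁻¹).comp (mdifferentiable_left g)

theorem lieDeriv_adjointAction (ι : H →* G) (hι : ContMDiff 𝓘(ℝ, E') 𝓘(ℝ, E) ∞ ι) (h : H)
    (ξ : LieAlg E' H) : lieDeriv E E' ι (adjointAction E' h ξ) =
      adjointAction E (ι h) (lieDeriv E E' ι ξ) := by
  have hd : MDifferentiable 𝓘(ℝ, E') 𝓘(ℝ, E) ι := hι.mdifferentiable (by simp)
  exact (mfderiv_chain (k := fun b : H ↦ ι (h * b * h⁻¹)) (b := (1 : H)) rfl (by simp) hd
    (mdifferentiable_conj h) ξ).trans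
    (mfderiv_chain (k := fun b : H ↦ ι (h * b * h⁻¹)) (by funext b; simp) (map_one ι)
      (mdifferentiable_conj (ι h)) hd ξ).symm

/-- The restriction `Res_H^G X`: the action and the moment map are restricted along `ι : H → G`. -/
def HamiltonianSpace.restrict (ι : H →* G) (hι : ContMDiff 𝓘(ℝ, E') 𝓘(ℝ, E) ∞ ι)
    (X : HamiltonianSpace.{u, v} E G) : HamiltonianSpace.{u, v} E' H where
  carrier := X.carrier
  model := X.model
  act := X.act.comp ι
  contMDiff_act := X.contMDiff_act.comp ((hι.comp contMDiff_fst).prodMk contMDiff_snd)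
  form := X.form
  isSmooth_form := X.isSmooth_form
  isClosed_form := X.isClosed_form
  nondegenerate := X.nondegenerate
  form_act h := X.form_act (ι h)
  moment x := (X.moment x).comp (lieDeriv E E' ι)
  contMDiff_moment ξ := X.contMDiff_moment (lieDeriv E E' ι ξ)
  moment_act h x ξ := by
    have := X.moment_act (ι h) x (lieDeriv E E' ι ξ)
    rw [← lieDeriv_adjointAction ι hι] at this
    exact this
  form_fundamental ξ x a := by
    have hd : MDifferentiable 𝓘(ℝ, E') 𝓘(ℝ, E) ι := hι.mdifferentiable (by simp)
    have ho : MDifferentiable 𝓘(ℝ, E) 𝓘(ℝ, X.model) (fun g : G ↦ X.act g x) :=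
      (X.contMDiff_act.comp (contMDiff_id.prodMk contMDiff_const)).mdifferentiable (by simp)
    have h := mfderiv_chain (k := fun b : H ↦ X.act (ι b) x) rfl (map_one ι) ho hd ξ
    exact (congrArg (fun b : X.model ↦ X.form x ![b, a]) h.symm).trans
      (X.form_fundamental (lieDeriv E E' ι ξ) x a)

end Restriction

section Reduction

variable {G Z V : Type*} [Group G] [Zero V]

/-- Two points of the zero level `μ⁻¹(0)` are equivalent if they lie in the same orbit. -/
def levelSetoid (ρ : G →* Equiv.Perm Z) (μ : Z → V) : Setoid {z : Z // μ z = 0} where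
  r a b := ∃ g : G, ρ g a.1 = b.1
  iseqv :=
    { refl := fun a ↦ ⟨1, by simp⟩
      symm := fun {a b} ⟨g, h⟩ ↦ ⟨g⁻¹, by rw [← h, ← Equiv.Perm.mul_apply, ← map_mul]; simp⟩
      trans := fun {a b c} ⟨g, h⟩ ⟨g', h'⟩ ↦ ⟨g' * g, by rw [map_mul, Equiv.Perm.mul_apply, h, h']⟩ }

/-- The reduction `μ⁻¹(0) / G` of a `G`-space with moment map `μ`, with the quotient diffeology
of the subset diffeology. -/
def Reduction (ρ : G →* Equiv.Perm Z) (μ : Z → V) : Type _ := Quotient (levelSetoid ρ μ)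

namespace Reduction

variable (ρ : G →* Equiv.Perm Z) (μ : Z → V)

/-- The projection `μ⁻¹(0) → μ⁻¹(0) / G`. -/
def mk (z : {z : Z // μ z = 0}) : Reduction ρ μ := Quotient.mk (levelSetoid ρ μ) z

variable [DiffeologicalSpace Z]

/-- The quotient diffeology of the subset diffeology. -/
instance : DiffeologicalSpace (Reduction ρ μ) := quotientDiffeology (levelSetoid ρ μ)

theorem dSmooth_mk : DSmooth (mk ρ μ) := fun _ p hp _ ↦ ⟨p, hp, Filter.EventuallyEq.rfl⟩

/-- `β` is the reduced form of `σ`: the pullback of `β` to `μ⁻¹(0)` is the restriction of `σ`. -/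
def IsReducedForm {k : ℕ} (σ : DForm Z k) (β : DForm (Reduction ρ μ) k) : Prop :=
  β.pullback (mk ρ μ) (dSmooth_mk ρ μ) = σ.pullback Subtype.val (dSmooth_subtype_val _)

end Reduction

variable [Sub V] {A B : Type*}

/-- The intertwiner space `Hom_G(A, B) = (A⁻ × B) // G`, where `A⁻` has the opposite moment map. -/
abbrev Intertwiners (ρ : G →* Equiv.Perm A) (μ : A → V) (τ : G →* Equiv.Perm B) (ν : B → V) :
    Type _ :=
  Reduction (diagonalAction ρ τ) (fun z : A × B ↦ ν z.2 - μ z.1)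

/-- The form of `A⁻ × B`, i.e. the difference of the form of `B` and the form of `A`. -/
def oppositeSumForm [DiffeologicalSpace A] [DiffeologicalSpace B] {k : ℕ} (α : DForm A k)
    (β : DForm B k) : DForm (A × B) k :=
  (β.pullback Prod.snd dSmooth_snd).sub (α.pullback Prod.fst dSmooth_fst)

end Reduction

section Induction

variable {E : Type*} [NormedAddCommGroup E] [NormedSpace ℝ E] [FiniteDimensional ℝ E]
  {G : Type*} [TopologicalSpace G] [ChartedSpace E G] [Group G] [LieGroup 𝓘(ℝ, E) ∞ G]
  {E' : Type*} [NormedAddCommGroup E'] [NormedSpace ℝ E']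
  {H : Type*} [TopologicalSpace H] [ChartedSpace E' H] [Group H]
  (ι : H →* G) (Y : HamiltonianSpace E' H)

variable (E) in
/-- The action `h(p, y) = (ph⁻¹, h(y))` of `H` on `T^*G × Y`. -/
def inductionAction : H →* Equiv.Perm (CotangentBundle E G × Y.carrier) :=
  diagonalAction ((rightAction E G).comp ι) Y.act

variable (E) in
/-- The moment map `(p, y) ↦ Ψ(y) - (q⁻¹p)|_𝔥` of the action of `H` on `T^*G × Y`. -/
def inductionMoment (z : CotangentBundle E G × Y.carrier) : LieDual E' H :=
  Y.moment z.2 - (bodyMomentum z.1).comp (lieDeriv E E' ι)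

variable (E G) in
/-- The symplectic form of `T^*G × Y`: the derivative of the canonical `1`-form plus the form
of `Y`. -/
def inductionForm : DForm (CotangentBundle E G × Y.carrier) 2 :=
  ((liouvilleForm E G).d.pullback Prod.fst dSmooth_fst).add (Y.dForm.pullback Prod.snd dSmooth_snd)

variable (E) in
/-- The induced space `Ind_H^G Y = (T^*G × Y) // H`. -/
abbrev Induced : Type _ := Reduction (inductionAction E ι Y) (inductionMoment E ι Y)

variable (E) in
/-- The residual action `g[p, y] = [gp, y]` of `G` on `Ind_H^G Y`. -/
def inducedAction : G →* Equiv.Perm (Induced E ι Y) :=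
  actionOf
    (fun g ↦ Quotient.map
      (fun z ↦ ⟨(leftAction E G g z.1.1, z.1.2), by
        have h := z.2
        simp only [inductionMoment] at h ⊢
        rwa [bodyMomentum_leftAction]⟩)
      (by
        rintro ⟨⟨p, y⟩, hz⟩ ⟨⟨p', y'⟩, hz'⟩ ⟨h, hh⟩
        obtain ⟨h₁, h₂⟩ := Prod.ext_iff.mp hh
        refine ⟨h, Prod.ext ?_ h₂⟩
        exact (leftAction_rightAction g (ι h) p).trans (congrArg (leftAction E G g) h₁)))
    (by
      rintro ⟨z⟩
      refine congrArg (Quotient.mk _) (Subtype.ext (Prod.ext ?_ rfl))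
      simp)
    (by
      rintro g g' ⟨z⟩
      refine congrArg (Quotient.mk _) (Subtype.ext (Prod.ext ?_ rfl))
      simp)

variable (E) in
/-- The residual moment map `[p, y] ↦ pq⁻¹` on `Ind_H^G Y`. -/
def inducedMoment : Induced E ι Y → LieDual E G :=
  Quotient.lift (fun z ↦ leftMomentum z.1.1) (by
    rintro ⟨⟨p, y⟩, hz⟩ ⟨⟨p', y'⟩, hz'⟩ ⟨h, hh⟩
    obtain ⟨h₁, -⟩ := Prod.ext_iff.mp hh
    exact (leftMomentum_rightAction (ι h) p).symm.trans (congrArg leftMomentum h₁))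

/-- `σ` is the reduced form of `Ind_H^G Y`. -/
def IsInducedForm (σ : DForm (Induced E ι Y) 2) : Prop :=
  Reduction.IsReducedForm _ _ (inductionForm E G Y) σ

end Induction

section Hom

variable {E : Type*} [NormedAddCommGroup E] [NormedSpace ℝ E] [FiniteDimensional ℝ E]
  {G : Type*} [TopologicalSpace G] [ChartedSpace E G] [Group G] [LieGroup 𝓘(ℝ, E) ∞ G]
  {E' : Type*} [NormedAddCommGroup E'] [NormedSpace ℝ E']
  {H : Type*} [TopologicalSpace H] [ChartedSpace E' H] [Group H] [LieGroup 𝓘(ℝ, E') ∞ H]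
  (ι : H →* G) (hι : ContMDiff 𝓘(ℝ, E') 𝓘(ℝ, E) ∞ ι)
  (X : HamiltonianSpace E G) (Y : HamiltonianSpace E' H)

/-- The intertwiner space `Hom_G(X, Ind_H^G Y)`. -/
abbrev HomInduced : Type _ :=
  Intertwiners X.act X.moment (inducedAction E ι Y) (inducedMoment E ι Y)

/-- `α` is the reduced form of `Hom_G(X, Ind_H^G Y)`, when `Ind_H^G Y` carries the form `σ`. -/
def IsHomInducedForm (σ : DForm (Induced E ι Y) 2) (α : DForm (HomInduced ι X Y) 2) : Prop :=
  Reduction.IsReducedForm _ _ (oppositeSumForm X.dForm σ) α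

/-- The intertwiner space `Hom_H(Res_H^G X, Y)`. -/
abbrev HomRestricted : Type _ :=
  Intertwiners (X.restrict ι hι).act (X.restrict ι hι).moment Y.act Y.moment

/-- `β` is the reduced form of `Hom_H(Res_H^G X, Y)`. -/
def IsHomRestrictedForm (β : DForm (HomRestricted ι hι X Y) 2) : Prop :=
  Reduction.IsReducedForm _ _ (oppositeSumForm (X.restrict ι hι).dForm Y.dForm) β

end Hom

end FrobRec
end

open FrobRec

open Diffeology Bundle
open scoped Manifold ContDiff Topology

noncomputable section

/-! Both intertwiner spaces are quotients of one space, the set `BiLevel` of triples (x, p, y)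
satisfying both moment conditions. The maps (x, p, y) ↦ [x, [p, y]] and (x, p, y) ↦ [q⁻¹(x), y] have
the same fibres (`BiLevel.mk_toLevel_eq_iff`), because a covector is determined by its base point
and its momentum pq⁻¹ = Φ(x). Both lift plots locally: the first because quotient maps do, the
second because (x, y) ↦ (x, Φ(x) ∈ T₁*G, y) is a smooth section. Hence the two quotient diffeologies
correspond and t is a diffeomorphism.

Reduced forms are unique because a form is determined by its pullback along a map that lifts plots.
Existence is harder: the actions need be neither free nor proper, so two plots P, Q of the zero
level with the same projection satisfy Q(u) = g(u)P(u) with g possibly discontinuous. The remedy is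
`DForm.toFun_eq_of_orbit`. A Baire argument gives a dense set of u₀ near which g(u) can be chosen
close to g(u₀). Since orbit maps have constant rank, the derivatives of P and g(u₀)⁻¹Q at u₀ then
differ by vectors tangent to the orbit, so g(u₀)⁻¹Q has the first derivative of γP for some smooth
γ. A form sees only first derivatives, so smooth γ suffice. For these the form changes by d⟨Φ(x),
γ⁻¹dγ⟩ (`HamiltonianSpace.dForm_act`, `d_liouvilleForm_rightAction`), and the changes cancel on the
zero level.

As Ind_H^G Y need not be a manifold, the reduced form of Hom_G(X, Ind_H^G Y) is obtained as t*β
instead. The check takes place on triples: acting by γ = q⁻¹ on x and p changes ω_X and dϖ by the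
same term and moves p into a fixed fibre, where dϖ vanishes. Hence dϖ = ω_X(x) − ω_X(q⁻¹x)
(`d_liouvilleForm_eq_sub`). -/

namespace FrobRec

/-! ### Descent of differential forms along maps that lift plots -/

section Descent

variable {A B : Type*} [DiffeologicalSpace A] [DiffeologicalSpace B] {k : ℕ}

/-- The value of a form at a point depends only on the germ of the plot. -/
theorem DForm.toFun_congr (α : DForm A k) {n : ℕ} {p q : Euc n → A} (hp : IsPlot p) (hq : IsPlot q)
    {u : Euc n} (h : p =ᶠ[𝓝 u] q) : α.toFun p hp u = α.toFun q hq u := by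
  -- Plots live on all of ℝⁿ, so the germ is isolated by a reparametrization with values in `s` that
  -- is the identity near `u`.
  obtain ⟨s, hs, hso, hus⟩ := mem_nhds_iff.mp h
  obtain ⟨f, hfs, hf, hfu⟩ := exists_smooth_into hso hus
  have hpq : p ∘ f = q ∘ f := funext fun y ↦ hs (hfs y)
  have key : ∀ (r : Euc n → A) (hr : IsPlot r),
      α.toFun (r ∘ f) (isPlot_reparam hr hf) u = α.toFun r hr u := by
    intro r hr
    rw [α.compat r hr f hf u, hfu.fderiv_eq, hfu.self_of_nhds, fderiv_id]
    ext v
    rfl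
  rw [← key p hp, ← key q hq]
  congr 2

/-- Equal plots give equal values. -/
theorem DForm.toFun_eq (α : DForm A k) {n : ℕ} {p q : Euc n → A} (hp : IsPlot p)
    (h : p = q) (u : Euc n) : α.toFun p hp u = α.toFun q (h ▸ hp) u := by
  subst h; rfl

/-- Every plot of `B` lifts locally along `f`. -/
def LiftsPlots (f : A → B) : Prop :=
  ∀ ⦃n : ℕ⦄ (p : Euc n → B), IsPlot p → ∀ x, ∃ q : Euc n → A, IsPlot q ∧ p =ᶠ[𝓝 x] f ∘ q

/-- A form depends only on germs of plots, and every germ of a plot of `B` comes from one of `A`.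
All uniqueness statements rest on this. -/
theorem LiftsPlots.pullback_injective {f : A → B} (hl : LiftsPlots f) (hf : DSmooth f)
    {α β : DForm B k} (h : α.pullback f hf = β.pullback f hf) : α = β := by
  apply DForm.ext
  funext n p hp u
  obtain ⟨q, hq, hpq⟩ := hl p hp u
  rw [α.toFun_congr hp (hf _ q hq) hpq, β.toFun_congr hp (hf _ q hq) hpq]
  exact congrArg (fun γ : DForm A k ↦ γ.toFun q hq u) h

/-- The form on `B` is read off from local lifts. Cut-off reparametrizations extend the hypothesis
to lifts whose projections agree only near a point, so the value does not depend on the lift; it is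
smooth because near `u₀` a single lift serves all points. -/
theorem LiftsPlots.existsUnique_descent {f : A → B} (hl : LiftsPlots f) (hf : DSmooth f)
    (τ : DForm A k) (h : ∀ ⦃n : ℕ⦄ (P Q : Euc n → A) (hP : IsPlot P) (hQ : IsPlot Q),
      f ∘ P = f ∘ Q → τ.toFun P hP = τ.toFun Q hQ) :
    ∃! β : DForm B k, β.pullback f hf = τ := by
  have hloc : ∀ ⦃n : ℕ⦄ (P Q : Euc n → A) (hP : IsPlot P) (hQ : IsPlot Q) (u : Euc n),
      f ∘ P =ᶠ[𝓝 u] f ∘ Q → τ.toFun P hP u = τ.toFun Q hQ u := by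
    intro n P Q hP hQ u hPQ
    obtain ⟨s, hs, hso, hus⟩ := mem_nhds_iff.mp hPQ
    obtain ⟨g, hgs, hg, hgu⟩ := exists_smooth_into hso hus
    have h1 := h (P ∘ g) (Q ∘ g) (isPlot_reparam hP hg) (isPlot_reparam hQ hg)
      (funext fun y ↦ hs (hgs y))
    have h2 : ∀ r : Euc n → A, r ∘ g =ᶠ[𝓝 u] r := fun r ↦ by
      filter_upwards [hgu] with y hy
      simp [hy]
    rw [← τ.toFun_congr (isPlot_reparam hP hg) hP (h2 P), h1,
      τ.toFun_congr (isPlot_reparam hQ hg) hQ (h2 Q)]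
  choose lift lift_plot lift_eq using hl
  have hval : ∀ ⦃n : ℕ⦄ (p : Euc n → B) (hp : IsPlot p) (Q : Euc n → A) (hQ : IsPlot Q) (u : Euc n),
      p =ᶠ[𝓝 u] f ∘ Q → τ.toFun (lift p hp u) (lift_plot p hp u) u = τ.toFun Q hQ u :=
    fun n p hp Q hQ u hpQ ↦ hloc _ _ _ _ u ((lift_eq p hp u).symm.trans hpQ)
  let β : DForm B k :=
    { toFun := fun p hp u ↦ τ.toFun (lift p hp u) (lift_plot p hp u) u
      smooth := fun p hp ↦ contDiff_iff_contDiffAt.mpr fun u₀ ↦ by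
        refine (τ.smooth _ (lift_plot p hp u₀)).contDiffAt.congr_of_eventuallyEq ?_
        filter_upwards [(lift_eq p hp u₀).eventually_nhds] with u hu
        exact hval p hp _ _ u hu
      compat := fun p hp g hg u ↦ by
        rw [hval (p ∘ g) _ (lift p hp (g u) ∘ g) (isPlot_reparam (lift_plot p hp (g u)) hg) u
          (hg.continuous.continuousAt.eventually (lift_eq p hp (g u)))]
        exact τ.compat _ _ g hg u }
  refine ⟨β, ?_, fun β' hβ' ↦ ?_⟩
  · apply DForm.ext
    funext n p hp u
    exact hval (f ∘ p) (hf _ p hp) p hp u Filter.EventuallyEq.rfl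
  · apply LiftsPlots.pullback_injective (fun n p hp x ↦ ⟨lift p hp x, lift_plot p hp x, lift_eq p hp x⟩) hf
    rw [hβ']
    apply DForm.ext
    funext n p hp u
    exact (hval (f ∘ p) (hf _ p hp) p hp u Filter.EventuallyEq.rfl).symm

end Descent

namespace Reduction

variable {G Z V : Type*} [Group G] [Zero V] [DiffeologicalSpace Z] (ρ : G →* Equiv.Perm Z)
  (μ : Z → V)

theorem liftsPlots_mk : LiftsPlots (mk ρ μ) := fun _ _ hp ↦ hp

/-- A form that takes the same values on plots of the zero level with the same projection has
exactly one reduced form. -/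
theorem existsUnique_isReducedForm {k : ℕ} (σ : DForm Z k)
    (h : ∀ ⦃n : ℕ⦄ (P Q : Euc n → Z) (hP : IsPlot P) (hQ : IsPlot Q), (∀ u, μ (P u) = 0) →
      (∀ u, μ (Q u) = 0) → (∀ u, ∃ g, ρ g (P u) = Q u) → σ.toFun P hP = σ.toFun Q hQ) :
    ∃! β : DForm (Reduction ρ μ) k, IsReducedForm ρ μ σ β :=
  (liftsPlots_mk ρ μ).existsUnique_descent (dSmooth_mk ρ μ) _ fun _ P Q hP hQ hPQ ↦
    h _ _ (dSmooth_subtype_val _ _ _ hP) (dSmooth_subtype_val _ _ _ hQ) (fun u ↦ (P u).2)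
      (fun u ↦ (Q u).2) fun u ↦ Quotient.exact (congrFun hPQ u)

end Reduction

/-! ### Maps of constant rank -/

section ConstantRank

variable {E F : Type*} [NormedAddCommGroup E] [NormedSpace ℝ E] [FiniteDimensional ℝ E]
  [NormedAddCommGroup F] [NormedSpace ℝ F]

/-- A linear projection onto the range of `T`, followed by a right inverse of `T` on its range. Then
T ∘ S is a projection onto the range, and id − T ∘ S detects what is transverse to it. -/
theorem exists_generalized_inverse [FiniteDimensional ℝ F] (T : E →L[ℝ] F) : ∃ S : F →L[ℝ] E, ∀ x, T (S (T x)) = T x := by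
  obtain ⟨g, hg⟩ := T.toLinearMap.rangeRestrict.exists_rightInverse_of_surjective
    T.toLinearMap.range_rangeRestrict
  obtain ⟨P, hP⟩ := T.toLinearMap.range.subtype.exists_leftInverse_of_injective
    (Submodule.ker_subtype _)
  refine ⟨LinearMap.toContinuousLinearMap (g ∘ₗ P), fun x ↦ ?_⟩
  have h1 : P (T x) = ⟨T x, x, rfl⟩ := LinearMap.congr_fun hP ⟨T x, x, rfl⟩
  have h2 := congrArg Subtype.val (LinearMap.congr_fun hg ⟨T x, x, rfl⟩)
  simpa [h1] using h2

open Asymptotics in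
/-- If the derivative of `f` has constant rank near `s₀`, then the image of `f` is tangent at `f s₀`
to the range of the derivative. -/
theorem sub_isLittleO_of_constant_rank {f : E → F} {s₀ : E} (hf : ContDiffAt ℝ 1 f s₀)
    {T : E →L[ℝ] F} (hT : T = fderiv ℝ f s₀) {S : F →L[ℝ] E} (hS : ∀ x, T (S (T x)) = T x)
    (hrank : ∀ᶠ s in 𝓝 s₀, ∀ x, T (S (fderiv ℝ f s x)) = 0 → fderiv ℝ f s x = 0) :
    (fun s ↦ f s - f s₀ - T (S (f s - f s₀))) =o[𝓝 s₀] fun s ↦ f s - f s₀ := by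
  -- `κ` projects onto the kernel of `T`. The map `Θ` straightens `f`: its derivative at `s₀` is ST
  -- + κ = id, and TΘ = TSf, so that g = f ∘ Θ⁻¹ satisfies TSg = T.
  let κ : E →L[ℝ] E := ContinuousLinearMap.id ℝ E - S ∘L T
  have hTκ : ∀ x, T (κ x) = 0 := fun x ↦ by simp [κ, hS]
  let Θ : E → E := fun s ↦ S (f s) + κ s
  have hΘ : ContDiffAt ℝ 1 Θ s₀ :=
    (S.contDiff.contDiffAt.comp s₀ hf).add κ.contDiff.contDiffAt
  have hfd : HasFDerivAt f T s₀ := hT ▸ (hf.differentiableAt (by simp)).hasFDerivAt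
  have hΘd : HasFDerivAt Θ ((ContinuousLinearEquiv.refl ℝ E : E ≃L[ℝ] E) : E →L[ℝ] E) s₀ := by
    have h : HasFDerivAt Θ (S ∘L T + κ) s₀ := (S.hasFDerivAt.comp s₀ hfd).add κ.hasFDerivAt
    convert h using 1
    ext x
    simp [κ]
  have hstrict := hΘ.hasStrictFDerivAt' hΘd (by simp)
  let Ψ := hΘ.localInverse hΘd (by simp)
  have hΨ : ContDiffAt ℝ 1 Ψ (Θ s₀) := hΘ.to_localInverse hΘd (by simp)
  have hright : ∀ᶠ y in 𝓝 (Θ s₀), Θ (Ψ y) = y := hstrict.eventually_right_inverse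
  have hleft : ∀ᶠ s in 𝓝 s₀, Ψ (Θ s) = s := hstrict.eventually_left_inverse
  have hΨ₀ : Ψ (Θ s₀) = s₀ := hleft.self_of_nhds
  have hΨc : Filter.Tendsto Ψ (𝓝 (Θ s₀)) (𝓝 s₀) := by
    simpa only [ContinuousAt, hΨ₀] using hΨ.continuousAt
  let g : E → F := f ∘ Ψ
  have hΨd : HasFDerivAt Ψ (ContinuousLinearMap.id ℝ E) (Θ s₀) := by
    exact hstrict.to_localInverse.hasFDerivAt
  have hgd : HasFDerivAt g T (Θ s₀) := by
    have h := HasFDerivAt.comp (Θ s₀) (hΨ₀.symm ▸ hfd : HasFDerivAt f T (Ψ (Θ s₀))) hΨd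
    simpa using h
  -- `g` is constant along the kernel of `T`
  have hev : ∀ᶠ y in 𝓝 (Θ s₀), DifferentiableAt ℝ g y ∧ ∀ x, T x = 0 → fderiv ℝ g y x = 0 := by
    filter_upwards [hright.eventually_nhds, hΨ.eventually (by simp), hΨc.eventually hrank,
      hΨc.eventually (hf.eventually (by simp))] with y h1 h2 h3 h4
    have hdf := h4.differentiableAt (by simp)
    have hdΨ := h2.differentiableAt (by simp)
    have hcomp : fderiv ℝ g y = (fderiv ℝ f (Ψ y)).comp (fderiv ℝ Ψ y) := fderiv_comp y hdf hdΨ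
    refine ⟨hdf.comp y hdΨ, fun x hx ↦ ?_⟩
    rw [hcomp]
    refine h3 _ ?_
    -- Differentiating TSg = T gives TS(Dg(y)x) = Tx = 0 for `x` in the kernel, and the rank
    -- hypothesis then yields Dg(y)x = 0.
    have hpi : (fun y ↦ T (S (g y))) =ᶠ[𝓝 y] T := by
      filter_upwards [h1] with z hz
      have := congrArg T hz
      simpa [Θ, hTκ, g] using this
    have hD : HasFDerivAt (fun y ↦ T (S (g y))) (T ∘L S ∘L fderiv ℝ g y) y :=
      T.hasFDerivAt.comp y (S.hasFDerivAt.comp y (hdf.comp y hdΨ).hasFDerivAt)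
    have hE := hD.unique (T.hasFDerivAt.congr_of_eventuallyEq hpi)
    have := congrArg (fun L : E →L[ℝ] F ↦ L x) hE
    simpa [hcomp, hx] using this
  obtain ⟨ε, hε, hball⟩ := Metric.eventually_nhds_iff_ball.mp hev
  have hconst : ∀ y ∈ Metric.ball (Θ s₀) ε, ∀ y' ∈ Metric.ball (Θ s₀) ε, T (y' - y) = 0 →
      g y = g y' := by
    intro y hy y' hy' hT0
    let c : ℝ → E := fun t ↦ AffineMap.lineMap y y' t
    have hc : ∀ t ∈ Set.Icc (0 : ℝ) 1, c t ∈ Metric.ball (Θ s₀) ε := fun t ht ↦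
      (convex_ball _ _).segment_subset hy hy' (segment_eq_image_lineMap ℝ y y' ▸ ⟨t, ht, rfl⟩)
    have hd : ∀ t ∈ Set.Icc (0 : ℝ) 1, HasDerivAt (g ∘ c) 0 t := by
      intro t ht
      obtain ⟨h1, h2⟩ := hball _ (hc t ht)
      have h3 : HasDerivAt c (y' - y) t := AffineMap.hasDerivAt_lineMap
      have h4 := h1.hasFDerivAt.comp_hasDerivAt t h3
      rwa [h2 _ hT0] at h4
    have := constant_of_derivWithin_zero (f := g ∘ c) (a := 0) (b := 1)
      (fun t ht ↦ (hd t ht).differentiableAt.differentiableWithinAt)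
      (fun t ht ↦ (hd t ⟨ht.1, ht.2.le⟩).hasDerivWithinAt.derivWithin
        (uniqueDiffOn_Icc (by norm_num) _ ⟨ht.1, ht.2.le⟩)) 1 (by simp)
    simpa [c] using this.symm
  let σ : F →L[ℝ] E := S ∘L T ∘L S
  have hσ : Filter.Tendsto (fun s ↦ Θ s₀ + σ (f s - f s₀)) (𝓝 s₀) (𝓝 (Θ s₀)) := by
    have h : ContinuousAt (fun s ↦ Θ s₀ + σ (f s - f s₀)) s₀ :=
      continuousAt_const.add (σ.continuous.continuousAt.comp (hf.continuousAt.sub continuousAt_const))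
    simpa [ContinuousAt] using h
  -- The two arguments Θ(s) and Θ(s₀) + σ(f(s) − f(s₀)) differ by a kernel vector of `T`. The
  -- parameter of `g` is now controlled by f(s) − f(s₀), so the error is small relative to this and
  -- not merely to s − s₀.
  have hfac : ∀ᶠ s in 𝓝 s₀, f s = g (Θ s₀ + σ (f s - f s₀)) := by
    filter_upwards [hleft, hσ (Metric.ball_mem_nhds _ hε),
      hΘ.continuousAt (Metric.ball_mem_nhds _ hε)] with s h1 h2 h3
    have h4 : f s = g (Θ s) := by simp [g, h1]
    rw [h4]
    refine (hconst _ h3 _ (by simpa [h4] using h2) ?_)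
    have h5 : g (Θ s) = f s := h4.symm
    simp only [h5, Θ, σ, map_sub, map_add, hTκ, ContinuousLinearMap.comp_apply, hS]
    abel
  have ho := (hgd.isLittleO.comp_tendsto hσ).trans_isBigO (k := fun s ↦ f s - f s₀) (by
    simpa [Function.comp_def] using σ.isBigO_comp (fun s ↦ f s - f s₀) (𝓝 s₀))
  refine ho.congr' ?_ Filter.EventuallyEq.rfl
  filter_upwards [hfac] with s hs
  simp only [Function.comp_apply, ← hs]
  simp [g, hΨ₀, σ, hS]

end ConstantRank

/-! ### Derivatives of maps related by a local action -/

section OrbitTangency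

variable {E F V : Type*} [NormedAddCommGroup E] [NormedSpace ℝ E]
  [NormedAddCommGroup F] [NormedSpace ℝ F]
  [NormedAddCommGroup V] [NormedSpace ℝ V]

theorem continuousAt_fderiv_partial {a : E → F → F} {s₀ : E} {z₀ : F}
    (ha : ContDiffAt ℝ ∞ (Function.uncurry a) (s₀, z₀)) :
    ContinuousAt (fun s ↦ fderiv ℝ (a s) z₀) s₀ :=
  (ContDiffAt.fderiv (m := 0) (g := fun _ ↦ z₀) ha contDiffAt_const (by simp)).continuousAt

open Asymptotics in
/-- Let `q u` belong to the image of `p u` under arbitrarily small elements of a local action `a`.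
Then the derivatives of `p` and `q` differ by vectors tangent to the orbit. -/
theorem exists_fderiv_sub_eq [FiniteDimensional ℝ E] [FiniteDimensional ℝ F] {a : E → F → F} {s₀ : E} {z₀ : F}
    (ha : ContDiffAt ℝ ∞ (Function.uncurry a) (s₀, z₀)) (h₀ : ∀ᶠ y in 𝓝 z₀, a s₀ y = y)
    (hrank : ∀ᶠ s in 𝓝 s₀, ∃ M : E →L[ℝ] E, fderiv ℝ (fun s ↦ a s z₀) s =
      fderiv ℝ (a s) z₀ ∘L fderiv ℝ (fun s ↦ a s z₀) s₀ ∘L M)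
    {p q : V → F} {p' q' : V →L[ℝ] F} {u₀ : V} (hp : HasFDerivAt p p' u₀) (hq : HasFDerivAt q q' u₀)
    (hp₀ : p u₀ = z₀) (hq₀ : q u₀ = z₀)
    (hsel : ∀ W ∈ 𝓝 s₀, ∀ᶠ u in 𝓝 u₀, ∃ s ∈ W, q u = a s (p u)) :
    ∃ ℓ : V →L[ℝ] E, q' = p' + fderiv ℝ (fun s ↦ a s z₀) s₀ ∘L ℓ := by
  set T := fderiv ℝ (fun s ↦ a s z₀) s₀ with hT
  obtain ⟨S, hS⟩ := exists_generalized_inverse T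
  have hf : ContDiffAt ℝ ∞ (fun s ↦ a s z₀) s₀ :=
    ha.comp s₀ (contDiffAt_id.prodMk contDiffAt_const)
  have hfs₀ : a s₀ z₀ = z₀ := h₀.self_of_nhds
  have hid : fderiv ℝ (a s₀) z₀ = ContinuousLinearMap.id ℝ F := by
    rw [Filter.EventuallyEq.fderiv_eq (f := id) h₀, fderiv_id]
  -- The rank condition: D(a s) is close to the identity, so if TS kills D(a s)(TMx), then TMx =
  -- φ(s)(TMx) with ‖φ(s)‖ < 1, which forces TMx = 0.
  have hlo := sub_isLittleO_of_constant_rank (hf.of_le (by simp)) hT hS (by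
    let φ : E → F →L[ℝ] F := fun s ↦ (T ∘L S) ∘L (ContinuousLinearMap.id ℝ F - fderiv ℝ (a s) z₀)
    have hφ : ContinuousAt φ s₀ :=
      continuousAt_const.clm_comp (continuousAt_const.sub (continuousAt_fderiv_partial ha))
    have hφ₀ : ∀ᶠ s in 𝓝 s₀, ‖φ s‖ < 1 :=
      hφ.norm.eventually (gt_mem_nhds (by simp [φ, hid]))
    filter_upwards [hrank, hφ₀] with s ⟨M, hM⟩ hs x hx
    rw [hM] at hx ⊢
    simp only [ContinuousLinearMap.comp_apply] at hx ⊢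
    have h1 : φ s (T (M x)) = T (M x) := by simp [φ, hS, hx]
    have h2 : ‖T (M x)‖ ≤ ‖φ s‖ * ‖T (M x)‖ := by
      conv_lhs => rw [← h1]
      exact (φ s).le_opNorm _
    have h3 : T (M x) = 0 := by
      by_contra hne
      have := norm_pos_iff.mpr hne
      nlinarith
    simp [h3])
  have hstrict := ha.hasStrictFDerivAt (by simp)
  have hpart : ∀ y : F, fderiv ℝ (Function.uncurry a) (s₀, z₀) (0, y) = y := by
    intro y
    have h1 : HasFDerivAt (fun y ↦ Function.uncurry a (s₀, y))
        (fderiv ℝ (Function.uncurry a) (s₀, z₀) ∘L ContinuousLinearMap.inr ℝ E F) z₀ :=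
      HasFDerivAt.comp z₀ hstrict.hasFDerivAt (hasFDerivAt_prodMk_right s₀ z₀)
    have h2 := h1.fderiv
    have h3 : (fun y ↦ Function.uncurry a (s₀, y)) = a s₀ := rfl
    rw [h3, hid] at h2
    exact (congrArg (fun L : F →L[ℝ] F ↦ L y) h2).symm
  let pr : F →L[ℝ] F := ContinuousLinearMap.id ℝ F - T ∘L S
  have hprT : ∀ x, pr (T x) = 0 := fun x ↦ by simp [pr, hS]
  -- The difference q(u) − p(u) is split into a(s, z₀) − z₀, which is nearly killed by `pr`, and a
  -- remainder that strict differentiability bounds by ε‖p(u) − z₀‖. Only closeness of `s` to `s₀`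
  -- is known; s − s₀ is not bounded by u − u₀.
  have hlim : (fun u ↦ pr (q u - p u)) =o[𝓝 u₀] fun u ↦ u - u₀ := by
    have hpO : (fun u ↦ p u - z₀) =O[𝓝 u₀] fun u ↦ u - u₀ := hp₀ ▸ hp.isBigO_sub
    have hqO : (fun u ↦ q u - z₀) =O[𝓝 u₀] fun u ↦ u - u₀ := hq₀ ▸ hq.isBigO_sub
    obtain ⟨Kp, hKp, hpO⟩ := hpO.exists_pos
    obtain ⟨Kq, hKq, hqO⟩ := hqO.exists_pos
    refine isLittleO_iff.mpr fun c hc ↦ ?_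
    -- The bound on a(s, z₀) − z₀ has the constant Kq + Kp + εKp, and ε ≤ 1 turns it into Kq + 2Kp.
    obtain ⟨ε, hε, hε1, hεc⟩ : ∃ ε : ℝ, 0 < ε ∧ ε ≤ 1 ∧
        ε * (Kq + 2 * Kp) + ‖pr‖ * (ε * Kp) ≤ c := by
      refine ⟨min 1 (c / (Kq + 2 * Kp + ‖pr‖ * Kp)), by positivity, min_le_left _ _, ?_⟩
      have := min_le_right 1 (c / (Kq + 2 * Kp + ‖pr‖ * Kp))
      rw [le_div_iff₀ (by positivity)] at this
      linarith
    have hW1 := isLittleO_iff.mp hlo hε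
    have hW2 := isLittleO_iff.mp hstrict.isLittleO hε
    have hpc : Filter.Tendsto p (𝓝 u₀) (𝓝 z₀) := by
      simpa only [ContinuousAt, hp₀] using hp.continuousAt
    have htend : Filter.Tendsto (fun x : E × F ↦ ((x.1, x.2), (x.1, z₀))) (𝓝 (s₀, z₀))
        (𝓝 ((s₀, z₀), (s₀, z₀))) := by
      have : Continuous (fun x : E × F ↦ ((x.1, x.2), (x.1, z₀))) := by fun_prop
      exact this.tendsto _
    have hW3 := htend.eventually hW2
    rw [nhds_prod_eq] at hW3
    obtain ⟨W, hW, Z, hZ, hWZ⟩ := Filter.eventually_prod_iff.mp hW3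
    filter_upwards [hsel _ (Filter.inter_mem hW1 hW), hpc.eventually hZ, hpO.bound, hqO.bound]
      with u ⟨s, ⟨hs1, hs2⟩, hqs⟩ hu2 hup huq
    have h1 := hWZ hs2 hu2
    simp only [Function.uncurry, Prod.mk_sub_mk, sub_self, hpart, Prod.norm_mk, norm_zero] at h1
    rw [← hqs, max_eq_right (norm_nonneg _)] at h1
    simp only [Set.mem_ofPred_eq, hfs₀] at hs1
    have h2 : pr (a s z₀ - z₀) = a s z₀ - z₀ - T (S (a s z₀ - z₀)) := rfl
    rw [← h2] at hs1
    have h3 : ‖a s z₀ - z₀‖ ≤ (Kq + 2 * Kp) * ‖u - u₀‖ := by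
      have h4 : a s z₀ - z₀ = (q u - z₀) - (p u - z₀) - (q u - a s z₀ - (p u - z₀)) := by abel
      rw [h4]
      have := norm_sub_le ((q u - z₀) - (p u - z₀)) (q u - a s z₀ - (p u - z₀))
      have := norm_sub_le (q u - z₀) (p u - z₀)
      have : ε * ‖p u - z₀‖ ≤ 1 * ‖p u - z₀‖ := by gcongr
      nlinarith
    have h5 : pr (q u - p u) = pr (a s z₀ - z₀) + pr (q u - a s z₀ - (p u - z₀)) := by
      rw [← map_add]; congr 1; abel
    rw [h5]
    calc ‖pr (a s z₀ - z₀) + pr (q u - a s z₀ - (p u - z₀))‖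
        ≤ ε * ‖a s z₀ - z₀‖ + ‖pr‖ * (ε * ‖p u - z₀‖) :=
          (norm_add_le _ _).trans (add_le_add hs1 ((pr.le_opNorm _).trans (by gcongr)))
      _ ≤ ε * ((Kq + 2 * Kp) * ‖u - u₀‖) + ‖pr‖ * (ε * (Kp * ‖u - u₀‖)) := by gcongr
      _ = (ε * (Kq + 2 * Kp) + ‖pr‖ * (ε * Kp)) * ‖u - u₀‖ := by ring
      _ ≤ c * ‖u - u₀‖ := by gcongr
  have hz : HasFDerivAt (fun u ↦ pr (q u - p u)) (0 : V →L[ℝ] F) u₀ := by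
    refine HasFDerivAt.of_isLittleO ?_
    simpa [hp₀, hq₀] using hlim
  have hz' : HasFDerivAt (fun u ↦ pr (q u - p u)) (pr ∘L (q' - p')) u₀ :=
    pr.hasFDerivAt.comp u₀ (hq.sub hp)
  have huniq := hz'.unique hz
  refine ⟨S ∘L (q' - p'), ?_⟩
  ext v
  have := congrArg (fun L : V →L[ℝ] F ↦ L v) huniq
  simp only [ContinuousLinearMap.comp_apply, pr, _root_.sub_apply,
    ContinuousLinearMap.id_apply, _root_.zero_apply] at this
  rw [_root_.add_apply, ContinuousLinearMap.comp_apply, ContinuousLinearMap.comp_apply,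
    _root_.sub_apply, ← sub_eq_zero.mp this]
  abel

end OrbitTangency

/-! ### Generic openness for closed relations -/

section Baire

/-- For a closed relation with nonempty fibres, generic points `u₀` have the property that every
point related to `u₀` is a limit of points related to the points near `u₀`. -/
theorem dense_setOf_eventually_exists {G U : Type*} [TopologicalSpace G] [T2Space G]
    [SecondCountableTopology G] [LocallyCompactSpace G] [TopologicalSpace U] [BaireSpace U]
    {R : Set (G × U)} (hR : IsClosed R) :
    Dense {u₀ : U | ∀ g₀, (g₀, u₀) ∈ R → ∀ W ∈ 𝓝 g₀, ∀ᶠ u in 𝓝 u₀, ∃ g ∈ W, (g, u) ∈ R} := by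
  -- For a relatively compact `b`, the set `C b` of points related to the closure of `b` is closed,
  -- so its frontier is nowhere dense. Countably many such `b` suffice, and off all their frontiers
  -- membership in `C b` persists nearby.
  let B := {b ∈ TopologicalSpace.countableBasis G | IsCompact (closure b)}
  let C : Set G → Set U := fun b ↦ {u | ∃ g ∈ closure b, (g, u) ∈ R}
  have hC : ∀ b ∈ B, IsClosed (C b) := by
    intro b hb
    have := isCompact_iff_compactSpace.mp hb.2
    have hcl := (isClosedMap_snd_of_compactSpace (X := closure b) (Y := U)) _
      (hR.preimage (f := fun z : closure b × U ↦ (z.1.1, z.2)) (by fun_prop))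
    convert hcl using 1
    ext u
    constructor
    · rintro ⟨g, hg, h⟩
      exact ⟨(⟨g, hg⟩, u), h, rfl⟩
    · rintro ⟨⟨⟨g, hg⟩, u'⟩, h, rfl⟩
      exact ⟨g, hg, h⟩
  have hdense : Dense (⋂ b ∈ B, (frontier (C b))ᶜ) := by
    refine dense_biInter_of_isOpen (fun b _ ↦ isClosed_frontier.isOpen_compl)
      ((TopologicalSpace.countable_countableBasis G).mono fun b hb ↦ hb.1) fun b hb ↦ ?_
    exact interior_eq_empty_iff_dense_compl.mp (interior_frontier (hC b hb))
  refine hdense.mono fun u₀ hu₀ g₀ hg₀ W hW ↦ ?_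
  obtain ⟨K, hK, hKW, hKc⟩ := local_compact_nhds hW
  obtain ⟨b, hb, hgb, hbK⟩ :=
    (TopologicalSpace.isBasis_countableBasis G).mem_nhds_iff.mp hK
  have hcl : closure b ⊆ K := closure_minimal hbK hKc.isClosed
  have hbB : b ∈ B := ⟨hb, hKc.of_isClosed_subset isClosed_closure hcl⟩
  have h1 : u₀ ∈ C b := ⟨g₀, subset_closure hgb, hg₀⟩
  have h2 : u₀ ∉ frontier (C b) := Set.mem_iInter₂.mp hu₀ b hbB
  have h3 : u₀ ∈ interior (C b) := by
    rw [(hC b hbB).frontier_eq] at h2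
    by_contra h
    exact h2 ⟨h1, h⟩
  filter_upwards [mem_interior_iff_mem_nhds.mp h3] with u ⟨g, hg, h⟩
  exact ⟨g, hKW (hcl hg), h⟩

end Baire

/-! ### Pointwise values of diffeological forms on manifolds -/

section PointwiseValue

variable {F K Z : Type*} [NormedAddCommGroup F] [NormedSpace ℝ F] [FiniteDimensional ℝ F]
  [TopologicalSpace K] {I : ModelWithCorners ℝ F K} [I.Boundaryless] [TopologicalSpace Z]
  [ChartedSpace K Z] [IsManifold I ∞ Z] [DiffeologicalSpace Z]

omit [FiniteDimensional ℝ F] [DiffeologicalSpace Z] in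
theorem contMDiffAt_extChartAt_symm_self (z : Z) {y : F} (hy : y ∈ (extChartAt I z).target) :
    ContMDiffAt 𝓘(ℝ, F) I ∞ (extChartAt I z).symm y :=
  (contMDiffOn_extChartAt_symm z).contMDiffAt ((isOpen_extChartAt_target z).mem_nhds hy)

/-- On a manifold, a diffeological form has a value at each point: the value of the form on a plot
is the pullback of it along the derivative of the plot. -/
theorem DForm.exists_value_at (hZ : ∀ {n : ℕ} (p : Euc n → Z), IsPlot p ↔ ContMDiff (𝓡 n) I ∞ p)
    {k : ℕ} (σ : DForm Z k) (z : Z) :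
    ∃ α : F [⋀^Fin k]→L[ℝ] ℝ, ∀ {n : ℕ} (p : Euc n → Z) (hp : IsPlot p) (u : Euc n), p u = z →
      σ.toFun p hp u = α.compContinuousLinearMap (fderiv ℝ (extChartAt I z ∘ p) u) := by
  let φ := extChartAt I z
  let e := toEuclidean (E := F)
  -- Precomposition with `f` makes the inverse chart a global plot `C`. Near `u` any plot with p(u)
  -- = z factors through `C`, so compatibility expresses its value by that of `C`.
  obtain ⟨f, hft, hf, hfe⟩ := exists_smooth_into
    ((isOpen_extChartAt_target (I := I) z).preimage e.symm.continuous) (x := e (φ z))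
    (by simp [φ])
  let C : Euc _ → Z := fun y ↦ φ.symm (e.symm (f y))
  have hC : IsPlot C := (hZ C).mpr fun y ↦
    (contMDiffAt_extChartAt_symm_self z (hft y)).comp y
      ((e.symm.contDiff.comp hf).contMDiff.contMDiffAt)
  refine ⟨(σ.toFun C hC (e (φ z))).compContinuousLinearMap (e : F →L[ℝ] _), ?_⟩
  rintro n p hp u rfl
  have hp' := (hZ p).mp hp
  have hpc : Filter.Tendsto p (𝓝 u) (𝓝 (p u)) := hp'.continuous.continuousAt
  have hφp : ∀ y, p y ∈ φ.source → ContDiffAt ℝ ∞ (φ ∘ p) y := fun y hy ↦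
    ((contMDiffAt_extChartAt' (by simpa [φ] using hy)).comp y (hp' y)).contDiffAt
  have hev : ∀ᶠ y in 𝓝 u, p y ∈ φ.source ∧ f (e (φ (p y))) = e (φ (p y)) := by
    refine (hpc.eventually (extChartAt_source_mem_nhds (I := I) (p u))).and ?_
    exact ((e.continuous.continuousAt.comp (continuousAt_extChartAt (I := I) (p u))).comp
      hpc).eventually hfe
  obtain ⟨s, hs, hso, hus⟩ := mem_nhds_iff.mp hev
  obtain ⟨g, hgs, hg, hgu⟩ := exists_smooth_into hso hus
  let k : Euc n → Euc _ := fun y ↦ e (φ (p (g y)))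
  have hk : ContDiff ℝ ∞ k := contDiff_iff_contDiffAt.mpr fun y ↦
    e.contDiff.contDiffAt.comp y ((hφp _ (hs (hgs y)).1).comp y hg.contDiffAt)
  have hpg : p ∘ g = C ∘ k := by
    funext y
    obtain ⟨h1, h2⟩ := hs (hgs y)
    simp [C, k, h2, φ.left_inv h1]
  have hgu₀ : g u = u := hgu.self_of_nhds
  have hku : fderiv ℝ k u = (e : F →L[ℝ] _) ∘L fderiv ℝ (φ ∘ p) u := by
    have h1 : k =ᶠ[𝓝 u] e ∘ (φ ∘ p) := by
      filter_upwards [hgu] with y hy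
      simp [k, hy]
    rw [h1.fderiv_eq]
    exact (e.toContinuousLinearMap.hasFDerivAt.comp u
      ((hφp u (mem_extChartAt_source (I := I) (p u))).differentiableAt (by simp)).hasFDerivAt).fderiv
  have hpgu : p ∘ g =ᶠ[𝓝 u] p := by
    filter_upwards [hgu] with y hy
    simp [hy]
  have h1 : k u = e (φ (p u)) := by simp [k, hgu₀]
  rw [← σ.toFun_congr (isPlot_reparam hp hg) hp hpgu, σ.toFun_eq _ hpg, σ.compat C hC k hk u, hku,
    h1]
  rfl

end PointwiseValue

/-! ### Forms on plots related by discontinuous families of group elements -/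

section OrbitInvariance

variable {E G : Type*} [NormedAddCommGroup E] [NormedSpace ℝ E] [FiniteDimensional ℝ E]
  [TopologicalSpace G] [T2Space G] [SecondCountableTopology G] [ChartedSpace E G] [Group G]
  [LieGroup 𝓘(ℝ, E) ∞ G]
  {F K Z : Type*} [NormedAddCommGroup F] [NormedSpace ℝ F] [FiniteDimensional ℝ F]
  [TopologicalSpace K] {I : ModelWithCorners ℝ F K} [I.Boundaryless] [TopologicalSpace Z]
  [ChartedSpace K Z] [IsManifold I ∞ Z]

omit [T2Space G] [SecondCountableTopology G] in
/-- If the values of the plots `P` and `Q` near `u₀` are related by group elements close to `1`,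
then `Q` has the same first derivative at `u₀` as a plot `γ P` for a smooth family `γ` of group
elements. -/
theorem exists_smooth_family {ρ : G →* Equiv.Perm Z}
    (hρ : ContMDiff (𝓘(ℝ, E).prod I) I ∞ (fun z : G × Z ↦ ρ z.1 z.2)) {n : ℕ} {P Q : Euc n → Z}
    (hP : ContMDiff (𝓡 n) I ∞ P) (hQ : ContMDiff (𝓡 n) I ∞ Q) {u₀ : Euc n} (h₀ : Q u₀ = P u₀)
    (hsel : ∀ W ∈ 𝓝 (1 : G), ∀ᶠ u in 𝓝 u₀, ∃ g ∈ W, ρ g (P u) = Q u) :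
    ∃ γ : Euc n → G, ContMDiff (𝓡 n) 𝓘(ℝ, E) ∞ γ ∧ γ u₀ = 1 ∧
      fderiv ℝ (extChartAt I (P u₀) ∘ fun u ↦ ρ (γ u) (P u)) u₀ =
        fderiv ℝ (extChartAt I (P u₀) ∘ Q) u₀ := by
  set z := P u₀ with hz
  let φ := extChartAt I z
  let ψ := extChartAt 𝓘(ℝ, E) (1 : G)
  have hφz : z ∈ φ.source := mem_extChartAt_source z
  have hψ1 : (1 : G) ∈ ψ.source := mem_extChartAt_source 1
  have hψ1t : ψ 1 ∈ ψ.target := mem_extChartAt_target 1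
  have hψs : ψ.symm (ψ 1) = 1 := ψ.left_inv hψ1
  have hφs : φ.symm (φ z) = z := φ.left_inv hφz
  have hcψ : ∀ s ∈ ψ.target, ContMDiffAt 𝓘(ℝ, E) 𝓘(ℝ, E) ∞ ψ.symm s := fun s hs ↦
    contMDiffAt_extChartAt_symm_self 1 hs
  have hcφ : ∀ w ∈ φ.source, ContMDiffAt I 𝓘(ℝ, F) ∞ φ w := fun w hw ↦
    contMDiffAt_extChartAt' (by simpa [φ] using hw)
  have hcψ' : ∀ w ∈ ψ.source, ContMDiffAt 𝓘(ℝ, E) 𝓘(ℝ, E) ∞ ψ w := fun w hw ↦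
    contMDiffAt_extChartAt' (by simpa [ψ] using hw)
  have hφo : ∀ w ∈ φ.source, φ.source ∈ 𝓝 w := fun w hw ↦
    (isOpen_extChartAt_source (I := I) z).mem_nhds hw
  have hψo : ∀ w ∈ ψ.source, ψ.source ∈ 𝓝 w := fun w hw ↦
    (isOpen_extChartAt_source (I := 𝓘(ℝ, E)) (1 : G)).mem_nhds hw
  let a : E → F → F := fun s y ↦ φ (ρ (ψ.symm s) (φ.symm y))
  have ha : ContDiffAt ℝ ∞ (Function.uncurry a) (ψ 1, φ z) := by
    have h1 : ContMDiffAt 𝓘(ℝ, E × F) 𝓘(ℝ, E) ∞ (fun x : E × F ↦ ψ.symm x.1) (ψ 1, φ z) :=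
      ContMDiffAt.comp (I' := 𝓘(ℝ, E)) (ψ 1, φ z) (hcψ _ hψ1t) contDiffAt_fst.contMDiffAt
    have h2 : ContMDiffAt 𝓘(ℝ, E × F) I ∞ (fun x : E × F ↦ φ.symm x.2) (ψ 1, φ z) :=
      ContMDiffAt.comp (I' := 𝓘(ℝ, F)) (ψ 1, φ z)
        (contMDiffAt_extChartAt_symm_self z (mem_extChartAt_target z)) contDiffAt_snd.contMDiffAt
    have h3 : ContMDiffAt 𝓘(ℝ, E × F) I ∞ (fun x : E × F ↦ ρ (ψ.symm x.1) (φ.symm x.2))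
        (ψ 1, φ z) := (hρ _).comp (ψ 1, φ z) (h1.prodMk h2)
    exact ((hcφ _ (by simpa [hψs, hφs] using hφz)).comp (ψ 1, φ z) h3).contDiffAt
  have ha1 : ∀ᶠ y in 𝓝 (φ z), a (ψ 1) y = y := by
    filter_upwards [extChartAt_target_mem_nhds (I := I) z] with y hy
    simp [a, hψs, φ.right_inv hy]
  let f : E → F := fun s ↦ a s (φ z)
  have hf : ContDiffAt ℝ ∞ f (ψ 1) := 
    ContDiffAt.comp (g := Function.uncurry a) (f := fun s ↦ (s, φ z)) (ψ 1) ha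
      (contDiffAt_id.prodMk contDiffAt_const)
  have hf0 : f (ψ 1) = φ z := ha1.self_of_nhds
  -- Constant rank comes from homogeneity: τz = s((s⁻¹τ)z), so near `s` the orbit map is the
  -- composite of `ν` (the chart form of τ ↦ s⁻¹τ), the orbit map near 1, and the action of `s`.
  have hrank : ∀ᶠ s in 𝓝 (ψ 1), ∃ M : E →L[ℝ] E, fderiv ℝ f s =
      fderiv ℝ (a s) (φ z) ∘L fderiv ℝ f (ψ 1) ∘L M := by
    have hd : ∀ᶠ s in 𝓝 (ψ 1), ContDiffAt ℝ 1 (Function.uncurry a) (s, φ z) :=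
      (Continuous.tendsto' (by fun_prop) _ _ rfl : Filter.Tendsto (fun s : E ↦ (s, φ z))
        (𝓝 (ψ 1)) (𝓝 (ψ 1, φ z))).eventually ((ha.of_le (by simp)).eventually (by simp))
    filter_upwards [hd, extChartAt_target_mem_nhds (I := 𝓘(ℝ, E)) (1 : G)] with s hs hst
    let ν : E → E := fun τ ↦ ψ ((ψ.symm s)⁻¹ * ψ.symm τ)
    have hνG : ContMDiffAt 𝓘(ℝ, E) 𝓘(ℝ, E) ∞ (fun τ ↦ (ψ.symm s)⁻¹ * ψ.symm τ) s :=
      (contMDiff_mul_left (I := 𝓘(ℝ, E)) (n := ∞)).contMDiffAt.comp s (hcψ s hst)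
    have hν0 : ν s = ψ 1 := by simp [ν]
    have hν : DifferentiableAt ℝ ν s :=
      ((hcψ' _ (by simpa using hψ1)).comp s hνG).contDiffAt.differentiableAt (by simp)
    have hev : f =ᶠ[𝓝 s] a s ∘ f ∘ ν := by
      have hc1 := hνG.continuousAt.eventually (hψo _ (by simpa using hψ1))
      have hc2 : ∀ᶠ τ in 𝓝 s, ρ ((ψ.symm s)⁻¹ * ψ.symm τ) z ∈ φ.source := by
        have hcont : ContinuousAt (fun τ ↦ ρ ((ψ.symm s)⁻¹ * ψ.symm τ) z) s :=
          hρ.continuous.continuousAt.comp (hνG.continuousAt.prodMk continuousAt_const)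
        exact hcont.eventually (hφo _ (by simpa using hφz))
      filter_upwards [hc1, hc2] with τ h1 h2
      simp only [Function.comp_apply, f, a, ν, hφs]
      rw [ψ.left_inv h1, φ.left_inv h2, ← Equiv.Perm.mul_apply, ← map_mul, mul_inv_cancel_left]
    have has : DifferentiableAt ℝ (a s) (φ z) :=
      (hs.comp (φ z) (contDiffAt_const.prodMk contDiffAt_id) : ContDiffAt ℝ 1 (a s) (φ z)
        ).differentiableAt (by simp)
    have hff := hf.differentiableAt (by simp : (∞ : WithTop ℕ∞) ≠ 0)
    refine ⟨fderiv ℝ ν s, ?_⟩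
    have h1 : HasFDerivAt f (fderiv ℝ f (ψ 1)) (ν s) := hν0.symm ▸ hff.hasFDerivAt
    have h2 := h1.comp s hν.hasFDerivAt
    have h3 : HasFDerivAt (a s) (fderiv ℝ (a s) (φ z)) ((f ∘ ν) s) := by
      have : (f ∘ ν) s = φ z := by simp [hν0, hf0]
      exact this.symm ▸ has.hasFDerivAt
    exact ((h3.comp s h2).congr_of_eventuallyEq hev).fderiv
  have hPs : ∀ᶠ u in 𝓝 u₀, P u ∈ φ.source := hP.continuous.continuousAt.eventually (hφo _ hφz)
  have hpd : DifferentiableAt ℝ (φ ∘ P) u₀ :=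
    ((hcφ _ hφz).comp u₀ (hP u₀)).contDiffAt.differentiableAt (by simp)
  have hqd : DifferentiableAt ℝ (φ ∘ Q) u₀ :=
    (((hcφ _ (by rwa [h₀])).comp u₀ (hQ u₀)).contDiffAt).differentiableAt (by simp)
  obtain ⟨ℓ, hℓ⟩ := exists_fderiv_sub_eq ha ha1 hrank hpd.hasFDerivAt hqd.hasFDerivAt rfl
    (congrArg φ h₀) (by
      intro W hW
      have hW' : ψ.source ∩ ψ ⁻¹' W ∈ 𝓝 (1 : G) :=
        Filter.inter_mem (hψo _ hψ1) ((continuousAt_extChartAt (I := 𝓘(ℝ, E)) (1 : G)) hW)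
      filter_upwards [hsel _ hW', hPs] with u ⟨g, ⟨hg1, hg2⟩, hgu⟩ hu
      refine ⟨ψ g, hg2, ?_⟩
      simp [a, ψ.left_inv hg1, φ.left_inv hu, hgu])
  have hcl : Continuous fun u ↦ ψ 1 + ℓ (u - u₀) := by fun_prop
  -- In the chart, γ is the affine map u ↦ ψ(1) + ℓ(u − u₀), whose derivative produces exactly the
  -- missing orbit direction; `κ` keeps it inside the chart.
  obtain ⟨κ, hκU, hκ, hκu⟩ := exists_smooth_into
    ((isOpen_extChartAt_target (I := 𝓘(ℝ, E)) (1 : G)).preimage hcl) (x := u₀)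
    (by simpa only [Set.mem_preimage, sub_self, map_zero, add_zero] using hψ1t)
  have hκ0 : κ u₀ = u₀ := hκu.self_of_nhds
  have hsm : ContDiff ℝ ∞ fun u ↦ ψ 1 + ℓ (κ u - u₀) :=
    contDiff_const.add (ℓ.contDiff.comp (hκ.sub contDiff_const))
  refine ⟨fun u ↦ ψ.symm (ψ 1 + ℓ (κ u - u₀)), fun u ↦
    (hcψ _ (hκU u)).comp u hsm.contMDiff.contMDiffAt, by simp [hκ0, hψs], ?_⟩
  have hev : (φ ∘ fun u ↦ ρ (ψ.symm (ψ 1 + ℓ (κ u - u₀))) (P u)) =ᶠ[𝓝 u₀]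
      Function.uncurry a ∘ fun u ↦ (ψ 1 + ℓ (u - u₀), φ (P u)) := by
    filter_upwards [hPs, hκu] with u h1 h2
    simp [a, φ.left_inv h1, h2]
  have hD := ha.differentiableAt (by simp : (∞ : WithTop ℕ∞) ≠ 0)
  have hin : HasFDerivAt (fun u ↦ (ψ 1 + ℓ (u - u₀), φ (P u))) (ℓ.prod (fderiv ℝ (φ ∘ P) u₀)) u₀ := by
    have h1 : HasFDerivAt (fun u ↦ ψ 1 + ℓ (u - u₀)) ℓ u₀ := by
      have := (ℓ.hasFDerivAt.comp u₀ ((hasFDerivAt_id u₀).sub_const u₀)).const_add (ψ 1)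
      simpa using this
    exact h1.prodMk hpd.hasFDerivAt
  have htot : HasFDerivAt (Function.uncurry a ∘ fun u ↦ (ψ 1 + ℓ (u - u₀), φ (P u)))
      (fderiv ℝ (Function.uncurry a) (ψ 1, φ z) ∘L ℓ.prod (fderiv ℝ (φ ∘ P) u₀)) u₀ := by
    refine HasFDerivAt.comp u₀ ?_ hin
    simpa [← hz] using hD.hasFDerivAt
  have hL1 : fderiv ℝ f (ψ 1) =
      fderiv ℝ (Function.uncurry a) (ψ 1, φ z) ∘L ContinuousLinearMap.inl ℝ E F :=
    (HasFDerivAt.comp (ψ 1) (f := fun s ↦ (s, φ z)) hD.hasFDerivAt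
      (hasFDerivAt_prodMk_left (ψ 1) (φ z))).fderiv
  have hL2 : ContinuousLinearMap.id ℝ F =
      fderiv ℝ (Function.uncurry a) (ψ 1, φ z) ∘L ContinuousLinearMap.inr ℝ E F := by
    rw [← fderiv_id (x := φ z), ← Filter.EventuallyEq.fderiv_eq (f := id) (f₁ := a (ψ 1)) ha1]
    exact (HasFDerivAt.comp (φ z) (f := fun y ↦ (ψ 1, y)) hD.hasFDerivAt
      (hasFDerivAt_prodMk_right (ψ 1) (φ z))).fderiv
  rw [hev.fderiv_eq, htot.fderiv, hℓ]
  ext v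
  have e1 := congrArg (fun L : E →L[ℝ] F ↦ L (ℓ v)) hL1
  have e2 := congrArg (fun L : F →L[ℝ] F ↦ L (fderiv ℝ (φ ∘ P) u₀ v)) hL2
  simp only [ContinuousLinearMap.comp_apply, ContinuousLinearMap.inl_apply,
    ContinuousLinearMap.inr_apply, ContinuousLinearMap.id_apply] at e1 e2
  have e3 : (ℓ v, fderiv ℝ (φ ∘ P) u₀ v) = (ℓ v, 0) + (0, fderiv ℝ (φ ∘ P) u₀ v) := by simp
  simp only [ContinuousLinearMap.comp_apply, ContinuousLinearMap.prod_apply, _root_.add_apply]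
  rw [e3, map_add, ← e1, ← e2]
  exact add_comm _ _

/-- A form on a `G`-manifold that is invariant under smooth families of group elements on a subset
`N` takes the same value on plots in `N` whose values are related by arbitrary, possibly
discontinuous, families of group elements. -/
theorem DForm.toFun_eq_of_orbit [T2Space Z] [DiffeologicalSpace Z]
    (hZ : ∀ {n : ℕ} (p : Euc n → Z), IsPlot p ↔ ContMDiff (𝓡 n) I ∞ p) {ρ : G →* Equiv.Perm Z}
    (hρ : ContMDiff (𝓘(ℝ, E).prod I) I ∞ (fun z : G × Z ↦ ρ z.1 z.2)) {k : ℕ} {σ : DForm Z k}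
    {N : Set Z} (hN : ∀ {n : ℕ} (γ : Euc n → G) (P : Euc n → Z) (hP : IsPlot P)
      (hγP : IsPlot fun u ↦ ρ (γ u) (P u)), ContMDiff (𝓡 n) 𝓘(ℝ, E) ∞ γ → (∀ u, P u ∈ N) →
      σ.toFun _ hγP = σ.toFun P hP)
    {n : ℕ} {P Q : Euc n → Z} (hP : IsPlot P) (hQ : IsPlot Q) (hPN : ∀ u, P u ∈ N)
    (hQN : ∀ u, Q u ∈ N) (hPQ : ∀ u, ∃ g, ρ g (P u) = Q u) : σ.toFun P hP = σ.toFun Q hQ := by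
  have hP' := (hZ P).mp hP
  have hQ' := (hZ Q).mp hQ
  have : LocallyCompactSpace G := ChartedSpace.locallyCompactSpace E G
  have hact : ∀ {m : ℕ} (γ : Euc m → G) (p : Euc m → Z), ContMDiff (𝓡 m) 𝓘(ℝ, E) ∞ γ →
      ContMDiff (𝓡 m) I ∞ p → IsPlot fun u ↦ ρ (γ u) (p u) := fun γ p hγ hp ↦
    (hZ _).mpr (hρ.comp (hγ.prodMk hp))
  have hR : IsClosed {x : G × Euc n | ρ x.1 (P x.2) = Q x.2} :=
    isClosed_eq (hρ.continuous.comp (continuous_fst.prodMk (hP'.continuous.comp continuous_snd)))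
      (hQ'.continuous.comp continuous_snd)
  -- Both sides are continuous in `u`, so comparing them at generic points is enough.
  refine Continuous.ext_on (dense_setOf_eventually_exists hR) (σ.smooth P hP).continuous
    (σ.smooth Q hQ).continuous fun u₀ hu₀ ↦ ?_
  obtain ⟨g₀, hg₀⟩ := hPQ u₀
  -- Translation by the constant g₀⁻¹ keeps the value of σ, by `hN`, and carries group elements near
  -- g₀ to elements near 1.
  let Q₁ : Euc n → Z := fun u ↦ ρ g₀⁻¹ (Q u)
  have hQ₁ : IsPlot Q₁ := hact (fun _ ↦ g₀⁻¹) Q contMDiff_const hQ'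
  have hQ₁₀ : Q₁ u₀ = P u₀ := by simp [Q₁, ← hg₀]
  obtain ⟨γ, hγ, hγ₀, hjet⟩ := exists_smooth_family hρ hP' ((hZ Q₁).mp hQ₁) hQ₁₀ (by
    intro W hW
    have hW' : (fun g ↦ g₀⁻¹ * g) ⁻¹' W ∈ 𝓝 g₀ :=
      (contMDiff_mul_left (I := 𝓘(ℝ, E)) (n := ∞) (a := g₀⁻¹)).continuous.continuousAt (by simpa using hW)
    filter_upwards [hu₀ g₀ hg₀ _ hW'] with u ⟨g, hg, hgu⟩
    refine ⟨_, hg, ?_⟩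
    have hgu' : ρ g (P u) = Q u := hgu
    simp [Q₁, ← hgu'])
  obtain ⟨α, hα⟩ := σ.exists_value_at hZ (P u₀)
  have hγP := hact γ P hγ hP'
  rw [← hN γ P hP hγP hγ hPN, ← hN (fun _ ↦ g₀⁻¹) Q hQ hQ₁ contMDiff_const hQN,
    hα _ hγP u₀ (by simp [hγ₀]), hα _ hQ₁ u₀ hQ₁₀, hjet]

end OrbitInvariance

/-! ### Derivatives as maps of model spaces -/

section Derivative

variable {E₁ E₂ E₃ : Type*} [NormedAddCommGroup E₁] [NormedSpace ℝ E₁] [NormedAddCommGroup E₂]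
  [NormedSpace ℝ E₂] [NormedAddCommGroup E₃] [NormedSpace ℝ E₃] {M₁ M₂ M₃ : Type*}
  [TopologicalSpace M₁] [ChartedSpace E₁ M₁] [TopologicalSpace M₂] [ChartedSpace E₂ M₂]
  [TopologicalSpace M₃] [ChartedSpace E₃ M₃]

variable (E₁ E₂) in
/-- The derivative of a map of manifolds, as a map of the model spaces. -/
def modelDeriv (f : M₁ → M₂) (a : M₁) : E₁ →L[ℝ] E₂ := mfderiv 𝓘(ℝ, E₁) 𝓘(ℝ, E₂) f a

theorem modelDeriv_comp {f : M₂ → M₃} {g : M₁ → M₂} {k : M₁ → M₃} {a : M₁} {b : M₂}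
    (hf : MDifferentiableAt 𝓘(ℝ, E₂) 𝓘(ℝ, E₃) f b) (hg : MDifferentiableAt 𝓘(ℝ, E₁) 𝓘(ℝ, E₂) g a)
    (hk : k = f ∘ g) (hb : g a = b) (v : E₁) :
    modelDeriv E₁ E₃ k a v = modelDeriv E₂ E₃ f b (modelDeriv E₁ E₂ g a v) := by
  subst hk hb
  exact congrArg (fun L : E₁ →L[ℝ] E₃ ↦ L v) (mfderiv_comp a hf hg)

theorem modelDeriv_eq_fderiv (f : E₁ → E₂) (a : E₁) : modelDeriv E₁ E₂ f a = fderiv ℝ f a :=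
  mfderiv_eq_fderiv

theorem modelDeriv_const (a : M₁) (b : M₂) : modelDeriv E₁ E₂ (fun _ : M₁ ↦ b) a = 0 :=
  mfderiv_const

theorem modelDeriv_comp₂ {V M : Type*} [NormedAddCommGroup V] [NormedSpace ℝ V] [TopologicalSpace M]
    [ChartedSpace V M] {f : M₁ → M₂ → M₃} {g : M → M₁} {h : M → M₂} {u : M}
    (hf : MDifferentiableAt (𝓘(ℝ, E₁).prod 𝓘(ℝ, E₂)) 𝓘(ℝ, E₃) (fun z : M₁ × M₂ ↦ f z.1 z.2)
      (g u, h u)) (hg : MDifferentiableAt 𝓘(ℝ, V) 𝓘(ℝ, E₁) g u)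
    (hh : MDifferentiableAt 𝓘(ℝ, V) 𝓘(ℝ, E₂) h u) (v : V) :
    modelDeriv V E₃ (fun w ↦ f (g w) (h w)) u v =
      modelDeriv E₁ E₃ (fun a ↦ f a (h u)) (g u) (modelDeriv V E₁ g u v) +
        modelDeriv E₂ E₃ (f (g u)) (h u) (modelDeriv V E₂ h u v) := by
  have h1 := mfderiv_comp (f := fun w ↦ (g w, h w)) u hf (hg.prodMk hh)
  have h2 := mfderiv_prod_eq_add_comp hf
  have h3 := mfderiv_prodMk hg hh
  have h4 := congrArg (fun L : V →L[ℝ] E₃ ↦ L v) h1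
  have h5 := congrArg (fun L : E₁ × E₂ →L[ℝ] E₃ ↦ L (modelDeriv V E₁ g u v, modelDeriv V E₂ h u v)) h2
  have h6 := congrArg (fun L : V →L[ℝ] E₁ × E₂ ↦ L v) h3
  refine h4.trans (Eq.trans ?_ h5)
  exact congrArg (mfderiv (𝓘(ℝ, E₁).prod 𝓘(ℝ, E₂)) 𝓘(ℝ, E₃) (fun z : M₁ × M₂ ↦ f z.1 z.2)
    (g u, h u) : E₁ × E₂ →L[ℝ] E₃) h6

end Derivative

/-! ### Maurer-Cartan forms and their structure equation -/

section MaurerCartan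

variable {E G V : Type*} [NormedAddCommGroup E] [NormedSpace ℝ E] [TopologicalSpace G]
  [ChartedSpace E G] [Group G] [NormedAddCommGroup V] [NormedSpace ℝ V]

variable (E) in
/-- The pullback `γ⁻¹dγ` of the left Maurer-Cartan form. -/
def leftMC (γ : V → G) (u : V) : V →L[ℝ] E := modelDeriv V E (fun w ↦ (γ u)⁻¹ * γ w) u

variable (E) in
/-- The pullback `dγ γ⁻¹` of the right Maurer-Cartan form. -/
def rightMC (γ : V → G) (u : V) : V →L[ℝ] E := modelDeriv V E (fun w ↦ γ w * (γ u)⁻¹) u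

theorem leftMC_const_mul (g : G) (γ : V → G) : leftMC E (fun u ↦ g * γ u) = leftMC E γ := by
  funext u
  unfold leftMC
  congr 1
  funext w
  simp [mul_assoc]

/-- The derivative of a map to `G` at a point with value `1`, in the chart at `1`. -/
theorem modelDeriv_eq_fderiv_chart {f : V → G} {u : V} (hf : MDifferentiableAt 𝓘(ℝ, V) 𝓘(ℝ, E) f u)
    (h : f u = 1) : modelDeriv V E f u = fderiv ℝ (extChartAt 𝓘(ℝ, E) (1 : G) ∘ f) u := by
  rw [modelDeriv, hf.mfderiv]
  simp only [writtenInExtChartAt, extChartAt_model_space_eq_id, h]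
  simp only [modelWithCornersSelf_coe, Set.range_id, PartialEquiv.refl_symm, PartialEquiv.refl_coe,
    Function.comp_id, fderivWithin_univ]
  rfl

theorem contMDiffAt_extChartAt_one [IsManifold 𝓘(ℝ, E) ∞ G] {g : G} (h : g = 1) :
    ContMDiffAt 𝓘(ℝ, E) 𝓘(ℝ, E) ∞ (extChartAt 𝓘(ℝ, E) (1 : G)) g := h ▸ contMDiffAt_extChartAt

variable [LieGroup 𝓘(ℝ, E) ∞ G]

/-- At the identity, the derivative of a product is the sum of the derivatives. -/
theorem modelDeriv_mul {f g : V → G} {u : V} (hf : ContMDiff 𝓘(ℝ, V) 𝓘(ℝ, E) ∞ f)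
    (hg : ContMDiff 𝓘(ℝ, V) 𝓘(ℝ, E) ∞ g) (hfu : f u = 1) (hgu : g u = 1) (v : V) :
    modelDeriv V E (fun w ↦ f w * g w) u v = modelDeriv V E f u v + modelDeriv V E g u v := by
  let ψ := extChartAt 𝓘(ℝ, E) (1 : G)
  let k : V × V → E := fun x ↦ ψ (f x.1 * g x.2)
  have hk : ContDiffAt ℝ ∞ k (u, u) := by
    have h : ContMDiffAt 𝓘(ℝ, V × V) 𝓘(ℝ, E) ∞ (fun x : V × V ↦ f x.1 * g x.2) (u, u) :=
      ((hf.comp contDiff_fst.contMDiff).mul (hg.comp contDiff_snd.contMDiff)).contMDiffAt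
    exact ((contMDiffAt_extChartAt_one (by simp [hfu, hgu])).comp (u, u) h).contDiffAt
  have hd := (hk.differentiableAt (by simp)).hasFDerivAt
  have h1 : HasFDerivAt (fun w ↦ k (w, w)) _ u :=
    HasFDerivAt.comp u (f := fun w ↦ (w, w)) hd ((hasFDerivAt_id u).prodMk (hasFDerivAt_id u))
  have h2 : HasFDerivAt (fun w ↦ k (w, u)) _ u :=
    HasFDerivAt.comp u (f := fun w ↦ (w, u)) hd (hasFDerivAt_prodMk_left u u)
  have h3 : HasFDerivAt (fun w ↦ k (u, w)) _ u :=
    HasFDerivAt.comp u (f := fun w ↦ (u, w)) hd (hasFDerivAt_prodMk_right u u)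
  have e2 : (fun w ↦ k (w, u)) = ψ ∘ f := by funext w; simp [k, hgu]
  have e3 : (fun w ↦ k (u, w)) = ψ ∘ g := by funext w; simp [k, hfu]
  rw [modelDeriv_eq_fderiv_chart (f := fun w ↦ f w * g w) ((hf.mul hg).mdifferentiable (by simp) u) (by simp [hfu, hgu]),
    modelDeriv_eq_fderiv_chart (hf.mdifferentiable (by simp) u) hfu,
    modelDeriv_eq_fderiv_chart (hg.mdifferentiable (by simp) u) hgu, ← e2, ← e3]
  refine (congrArg (fun L : V →L[ℝ] E ↦ L v) h1.fderiv).trans ?_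
  rw [h2.fderiv, h3.fderiv]
  simp [← map_add]

/-- The map w ↦ γ(u)⁻¹γ(w) has the value 1 at w = u for every `u`, so the single chart at 1 reduces
the claim to smoothness of a partial derivative. -/
theorem contDiff_leftMC {γ : V → G} (hγ : ContMDiff 𝓘(ℝ, V) 𝓘(ℝ, E) ∞ γ) :
    ContDiff ℝ ∞ (leftMC E γ) := by
  have h : leftMC E γ = fun u ↦ fderiv ℝ (fun w ↦ extChartAt 𝓘(ℝ, E) (1 : G) ((γ u)⁻¹ * γ w)) u := by
    funext u
    exact modelDeriv_eq_fderiv_chart ((contMDiff_const.mul hγ).mdifferentiable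
      (by simp) u) (by simp)
  rw [h]
  refine contDiff_iff_contDiffAt.mpr fun u ↦ ContDiffAt.fderiv (n := ∞)
    (f := fun u w ↦ extChartAt 𝓘(ℝ, E) (1 : G) ((γ u)⁻¹ * γ w)) (g := fun u ↦ u) ?_ contDiffAt_id
    (by simp)
  have h1 : ContMDiffAt 𝓘(ℝ, V × V) 𝓘(ℝ, E) ∞ (fun x : V × V ↦ (γ x.1)⁻¹ * γ x.2) (u, u) :=
    ((hγ.comp contDiff_fst.contMDiff).inv.mul (hγ.comp contDiff_snd.contMDiff)).contMDiffAt
  exact ((contMDiffAt_extChartAt_one (by simp)).comp (u, u) h1).contDiffAt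

theorem contDiff_rightMC {γ : V → G} (hγ : ContMDiff 𝓘(ℝ, V) 𝓘(ℝ, E) ∞ γ) :
    ContDiff ℝ ∞ (rightMC E γ) := by
  have h : rightMC E γ = fun u ↦ fderiv ℝ (fun w ↦ extChartAt 𝓘(ℝ, E) (1 : G) (γ w * (γ u)⁻¹)) u := by
    funext u
    exact modelDeriv_eq_fderiv_chart ((hγ.mul contMDiff_const).mdifferentiable
      (by simp) u) (by simp)
  rw [h]
  refine contDiff_iff_contDiffAt.mpr fun u ↦ ContDiffAt.fderiv (n := ∞)
    (f := fun u w ↦ extChartAt 𝓘(ℝ, E) (1 : G) (γ w * (γ u)⁻¹)) (g := fun u ↦ u) ?_ contDiffAt_id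
    (by simp)
  have h1 : ContMDiffAt 𝓘(ℝ, V × V) 𝓘(ℝ, E) ∞ (fun x : V × V ↦ γ x.2 * (γ x.1)⁻¹) (u, u) :=
    ((hγ.comp contDiff_snd.contMDiff).mul (hγ.comp contDiff_fst.contMDiff).inv).contMDiffAt
  exact ((contMDiffAt_extChartAt_one (by simp)).comp (u, u) h1).contDiffAt

/-- The adjoint action intertwines the two Maurer-Cartan forms. -/
theorem adjointAction_leftMC {γ : V → G} (hγ : ContMDiff 𝓘(ℝ, V) 𝓘(ℝ, E) ∞ γ) (u v : V) :
    adjointAction E (γ u) (leftMC E γ u v) = rightMC E γ u v :=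
  mfderiv_chain (k := fun w ↦ γ w * (γ u)⁻¹) (g := fun w ↦ (γ u)⁻¹ * γ w) (b := (1 : G))
    (by funext w; simp) (by simp) (mdifferentiable_conj (γ u))
    (((contMDiff_mul_left (I := 𝓘(ℝ, E)) (n := ∞)).comp hγ).mdifferentiable (by simp)) v

/-- Symmetry of mixed partial derivatives. -/
theorem fderiv_partial_comm {k : V × V → E} (hk : ContDiffAt ℝ ∞ k (0, 0)) (v w : V) :
    fderiv ℝ (fun s ↦ fderiv ℝ (fun t ↦ k (s, t)) 0 w) 0 v =
      fderiv ℝ (fun t ↦ fderiv ℝ (fun s ↦ k (s, t)) 0 v) 0 w := by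
  have hd : ∀ᶠ x in 𝓝 ((0, 0) : V × V), DifferentiableAt ℝ k x :=
    ((hk.of_le (by simp : (1 : WithTop ℕ∞) ≤ ∞)).eventually (by simp)).mono
      fun x hx ↦ hx.differentiableAt (by simp)
  have h1 : ∀ᶠ s in 𝓝 (0 : V), fderiv ℝ (fun t ↦ k (s, t)) 0 w = fderiv ℝ k (s, 0) (0, w) := by
    filter_upwards [(Continuous.tendsto' (by fun_prop) _ _ rfl : Filter.Tendsto
      (fun s : V ↦ (s, (0 : V))) (𝓝 0) (𝓝 (0, 0))).eventually hd] with s hs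
    exact congrArg (fun L : V →L[ℝ] E ↦ L w) (HasFDerivAt.comp (0 : V) (f := fun t ↦ (s, t))
      hs.hasFDerivAt (hasFDerivAt_prodMk_right s 0)).fderiv
  have h2 : ∀ᶠ t in 𝓝 (0 : V), fderiv ℝ (fun s ↦ k (s, t)) 0 v = fderiv ℝ k (0, t) (v, 0) := by
    filter_upwards [(Continuous.tendsto' (by fun_prop) _ _ rfl : Filter.Tendsto
      (fun t : V ↦ ((0 : V), t)) (𝓝 0) (𝓝 (0, 0))).eventually hd] with t ht
    exact congrArg (fun L : V →L[ℝ] E ↦ L v) (HasFDerivAt.comp (0 : V) (f := fun s ↦ (s, t))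
      ht.hasFDerivAt (hasFDerivAt_prodMk_left 0 t)).fderiv
  have hdd : DifferentiableAt ℝ (fderiv ℝ k) (0, 0) :=
    (hk.fderiv_right (m := ∞) (by simp)).differentiableAt (by simp)
  rw [Filter.EventuallyEq.fderiv_eq h1, Filter.EventuallyEq.fderiv_eq h2]
  have e1 : HasFDerivAt (fun s : V ↦ fderiv ℝ k (s, 0) (0, w)) _ 0 :=
    (HasFDerivAt.comp (0 : V) (f := fun s ↦ (s, (0 : V))) hdd.hasFDerivAt
      (hasFDerivAt_prodMk_left (0 : V) (0 : V))).clm_apply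
      (hasFDerivAt_const ((0, w) : V × V) (0 : V))
  have e2 : HasFDerivAt (fun t : V ↦ fderiv ℝ k (0, t) (v, 0)) _ 0 :=
    (HasFDerivAt.comp (0 : V) (f := fun s ↦ ((0 : V), s)) hdd.hasFDerivAt
      (hasFDerivAt_prodMk_right (0 : V) (0 : V))).clm_apply
      (hasFDerivAt_const ((v, 0) : V × V) (0 : V))
  rw [e1.fderiv, e2.fderiv]
  have hsymm := hk.isSymmSndFDerivAt (by simpa using ENat.LEInfty.out) (v, 0) (0, w)
  simpa using hsymm

/-- The Maurer-Cartan equation at a point with value `1`, without brackets. -/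
theorem fderiv_leftMC_eq_fderiv_rightMC {γ : V → G} (hγ : ContMDiff 𝓘(ℝ, V) 𝓘(ℝ, E) ∞ γ) {u₀ : V}
    (h : γ u₀ = 1) (v w : V) : fderiv ℝ (fun u ↦ leftMC E γ u w) u₀ v =
      fderiv ℝ (fun u ↦ rightMC E γ u v) u₀ w := by
  let ψ := extChartAt 𝓘(ℝ, E) (1 : G)
  -- Up to a constant, the derivative of `K` in the second variable at 0 is the left form at u₀ + s,
  -- and the one in the first variable is the right form at u₀ + t. Symmetry of mixed partials gives
  -- the claim.
  let K : V × V → G := fun x ↦ (γ (u₀ + x.1))⁻¹ * γ (u₀ + x.1 + x.2) * (γ (u₀ + x.2))⁻¹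
  have hγ1 : ∀ c : V, ContMDiff 𝓘(ℝ, V) 𝓘(ℝ, E) ∞ (fun t ↦ γ (c + t)) := fun c ↦
    hγ.comp (contDiff_const.add contDiff_id).contMDiff
  have hγ2 : ∀ c : V, ContMDiff 𝓘(ℝ, V) 𝓘(ℝ, E) ∞ (fun s ↦ γ (u₀ + s + c)) := fun c ↦
    hγ.comp ((contDiff_const.add contDiff_id).add contDiff_const).contMDiff
  have hK : ContMDiff 𝓘(ℝ, V × V) 𝓘(ℝ, E) ∞ K :=
    ((hγ.comp (contDiff_const.add contDiff_fst).contMDiff).inv.mul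
      (hγ.comp ((contDiff_const.add contDiff_fst).add contDiff_snd).contMDiff)).mul
      (hγ.comp (contDiff_const.add contDiff_snd).contMDiff).inv
  have hk : ContDiffAt ℝ ∞ (ψ ∘ K) (0, 0) :=
    ((contMDiffAt_extChartAt_one (by simp [K, h])).comp (0, 0) (hK _)).contDiffAt
  let c : V →L[ℝ] E := modelDeriv V E (fun t ↦ (γ (u₀ + t))⁻¹) 0
  have hshift : ∀ (f : V → G) (a : V), MDifferentiable 𝓘(ℝ, V) 𝓘(ℝ, E) f → ∀ x : V,
      modelDeriv V E (fun t ↦ f (a + t)) 0 x = modelDeriv V E f a x := by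
    intro f a hf x
    have ht : MDifferentiable 𝓘(ℝ, V) 𝓘(ℝ, V) (fun t : V ↦ a + t) :=
      (contDiff_const.add contDiff_id).contMDiff.mdifferentiable (n := 1) (by simp)
    rw [modelDeriv_comp (hf a) (ht 0) (k := fun t ↦ f (a + t)) rfl (add_zero a) x,
      modelDeriv_eq_fderiv, fderiv_const_add, fderiv_fun_id]
    rfl
  have hleft : ∀ s, fderiv ℝ (fun t ↦ (ψ ∘ K) (s, t)) 0 w = leftMC E γ (u₀ + s) w + c w := by
    intro s
    have h1 : ContMDiff 𝓘(ℝ, V) 𝓘(ℝ, E) ∞ (fun t ↦ (γ (u₀ + s))⁻¹ * γ (u₀ + s + t)) :=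
      contMDiff_const.mul (hγ1 (u₀ + s))
    have h2 : ContMDiff 𝓘(ℝ, V) 𝓘(ℝ, E) ∞ (fun t ↦ (γ (u₀ + t))⁻¹) := (hγ1 u₀).inv
    have e1 := modelDeriv_mul (u := 0) h1 h2 (by simp) (by simp [h]) w
    rw [modelDeriv_eq_fderiv_chart
        (f := fun t ↦ (γ (u₀ + s))⁻¹ * γ (u₀ + s + t) * (γ (u₀ + t))⁻¹) ((h1.mul h2).mdifferentiable (by simp) 0) (by simp [h]),
      hshift (fun t ↦ (γ (u₀ + s))⁻¹ * γ t) (u₀ + s)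
        ((contMDiff_const.mul hγ).mdifferentiable (by simp)) w] at e1
    exact e1
  have hright : ∀ t, fderiv ℝ (fun s ↦ (ψ ∘ K) (s, t)) 0 v = c v + rightMC E γ (u₀ + t) v := by
    intro t
    have h1 : ContMDiff 𝓘(ℝ, V) 𝓘(ℝ, E) ∞ (fun s ↦ γ (u₀ + s + t) * (γ (u₀ + t))⁻¹) :=
      (hγ2 t).mul contMDiff_const
    have h2 : ContMDiff 𝓘(ℝ, V) 𝓘(ℝ, E) ∞ (fun t ↦ (γ (u₀ + t))⁻¹) := (hγ1 u₀).inv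
    have e1 := modelDeriv_mul (u := 0) h2 h1 (by simp [h]) (by simp) v
    have e2 : (fun s ↦ γ (u₀ + s + t) * (γ (u₀ + t))⁻¹) = fun s ↦ γ ((u₀ + t) + s) * (γ (u₀ + t))⁻¹ := by
      funext s
      rw [add_right_comm]
    rw [modelDeriv_eq_fderiv_chart
        (f := fun s ↦ (γ (u₀ + s))⁻¹ * (γ (u₀ + s + t) * (γ (u₀ + t))⁻¹)) ((h2.mul h1).mdifferentiable (by simp) 0) (by simp [h]), e2,
      hshift (fun s ↦ γ s * (γ (u₀ + t))⁻¹) (u₀ + t)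
        ((hγ.mul contMDiff_const).mdifferentiable (by simp)) v] at e1
    refine Eq.trans ?_ e1
    congr 2
    funext s
    simp [K, ψ, mul_assoc, add_right_comm]
  have hsymm := fderiv_partial_comm hk v w
  simp only [hleft, hright, fderiv_add_const, fderiv_const_add] at hsymm
  have e3 : ∀ f : V → E, fderiv ℝ (fun s ↦ f (u₀ + s)) 0 = fderiv ℝ f u₀ := fun f ↦ by
    rw [fderiv_comp_add_left, add_zero]
  rwa [e3 (fun u ↦ leftMC E γ u w), e3 (fun u ↦ rightMC E γ u v)] at hsymm

end MaurerCartan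

/-! ### The 1-form ⟨m, γ⁻¹dγ⟩ -/

section MomentumForm

variable {E G : Type*} [NormedAddCommGroup E] [NormedSpace ℝ E] [TopologicalSpace G]
  [ChartedSpace E G] [Group G] {n : ℕ}

/-- The `1`-form `⟨m, γ⁻¹dγ⟩`. -/
def momentumForm (m : Euc n → E →L[ℝ] ℝ) (γ : Euc n → G) (u : Euc n) : Euc n [⋀^Fin 1]→L[ℝ] ℝ :=
  ContinuousAlternatingMap.ofSubsingleton ℝ (Euc n) ℝ (0 : Fin 1)
    ((m u).comp (leftMC E γ u))

variable [LieGroup 𝓘(ℝ, E) ∞ G]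

theorem contDiff_momentumForm {m : Euc n → E →L[ℝ] ℝ} (hm : ContDiff ℝ ∞ m) {γ : Euc n → G}
    (hγ : ContMDiff (𝓡 n) 𝓘(ℝ, E) ∞ γ) : ContDiff ℝ ∞ (momentumForm m γ) :=
  contDiff_iff_contDiffAt.mpr fun _ ↦ contDiff_alternating fun _ ↦
    (hm.clm_apply ((contDiff_leftMC hγ).clm_apply contDiff_const)).contDiffAt

/-- The derivative of `⟨m, γ⁻¹dγ⟩` at a point where `γ = 1`, when `m'` is the functional that
corresponds to `m` under the coadjoint action of `γ`. -/
theorem extDeriv_momentumForm {m m' : Euc n → E →L[ℝ] ℝ} (hm : ContDiff ℝ ∞ m)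
    (hm' : ContDiff ℝ ∞ m') {γ : Euc n → G} (hγ : ContMDiff (𝓡 n) 𝓘(ℝ, E) ∞ γ)
    (hmm : ∀ u v, m u (leftMC E γ u v) = m' u (rightMC E γ u v)) {u₀ : Euc n} (h : γ u₀ = 1)
    (hmm₀ : m u₀ = m' u₀) (v : Fin 2 → Euc n) :
    extDeriv (momentumForm m γ) u₀ v = fderiv ℝ m u₀ (v 0) (modelDeriv _ E γ u₀ (v 1)) -
      fderiv ℝ m' u₀ (v 1) (modelDeriv _ E γ u₀ (v 0)) := by
  have hl : leftMC E γ u₀ = modelDeriv _ E γ u₀ := by simp [leftMC, h]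
  have hr : rightMC E γ u₀ = modelDeriv _ E γ u₀ := by simp [rightMC, h]
  rw [extDeriv_apply ((contDiff_momentumForm hm hγ).differentiable (by simp) u₀), Fin.sum_univ_two]
  have e0 : ∀ u, momentumForm m γ u (Fin.removeNth 0 v) = m u (leftMC E γ u (v 1)) :=
    fun u ↦ rfl
  -- Only this term is rewritten with `m'` and the right form; the derivatives of the two
  -- Maurer-Cartan forms then cancel and no bracket appears.
  have e1 : ∀ u, momentumForm m γ u (Fin.removeNth 1 v) = m' u (rightMC E γ u (v 0)) :=
    fun u ↦ hmm u (v 0)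
  simp only [e0, e1]
  have d0 := ((hm.differentiable (by simp) u₀).hasFDerivAt.clm_apply
    ((((contDiff_leftMC hγ).clm_apply (contDiff_const (c := v 1))).differentiable (by simp)
      u₀).hasFDerivAt)).fderiv
  have d1 := ((hm'.differentiable (by simp) u₀).hasFDerivAt.clm_apply
    ((((contDiff_rightMC hγ).clm_apply (contDiff_const (c := v 0))).differentiable (by simp)
      u₀).hasFDerivAt)).fderiv
  rw [d0, d1]
  have hmc := fderiv_leftMC_eq_fderiv_rightMC hγ h (v 0) (v 1)
  simp [hmc, hmm₀, hl, hr]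
  ring

end MomentumForm

/-! ### Symplectic forms under smooth families of group elements -/

namespace HamiltonianSpace

variable {E G : Type*} [NormedAddCommGroup E] [NormedSpace ℝ E]
  [TopologicalSpace G] [ChartedSpace E G] [Group G] (X : HamiltonianSpace E G)

/-- The symplectic form as a function of two vectors. -/
def formAt (x : X.carrier) (a b : X.model) : ℝ := X.form x ![a, b]

theorem formAt_add_left (x : X.carrier) (a a' b : X.model) :
    X.formAt x (a + a') b = X.formAt x a b + X.formAt x a' b :=
  (X.form x).toContinuousMultilinearMap.cons_add ![b] a a'

theorem formAt_swap (x : X.carrier) (a b : X.model) : X.formAt x a b = - X.formAt x b a := by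
  have h := (X.form x).toAlternatingMap.map_swap ![b, a] (i := 0) (j := 1) (by simp)
  have e : (![b, a] ∘ Equiv.swap 0 1 : Fin 2 → X.model) = ![a, b] := by
    funext i; fin_cases i <;> rfl
  exact (congrArg (X.form x) e).symm.trans h

theorem formAt_add_right (x : X.carrier) (a b b' : X.model) :
    X.formAt x a (b + b') = X.formAt x a b + X.formAt x a b' := by
  rw [formAt_swap, formAt_add_left, formAt_swap X x a b, formAt_swap X x a b']
  ring

theorem dForm_apply {n : ℕ} (x : Euc n → X.carrier) (hx : IsPlot x) (u : Euc n)
    (v : Fin 2 → Euc n) : X.dForm.toFun x hx u v =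
      X.formAt (x u) (modelDeriv _ X.model x u (v 0)) (modelDeriv _ X.model x u (v 1)) := by
  refine congrArg (X.form (x u)) ?_
  funext i
  fin_cases i <;> rfl

/-- The moment map, as a functional on the model space. -/
def momentFun (x : X.carrier) : E →L[ℝ] ℝ := X.moment x

theorem formAt_fundamental (ξ : E) (x : X.carrier) (a : X.model) :
    X.formAt x (modelDeriv E X.model (fun g : G ↦ X.act g x) 1 ξ) a =
      -modelDeriv X.model ℝ (fun z ↦ X.momentFun z ξ) x a :=
  X.form_fundamental ξ x a

theorem contMDiff_act_fun {n : ℕ} {γ : Euc n → G} (hγ : ContMDiff (𝓡 n) 𝓘(ℝ, E) ∞ γ)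
    {x : Euc n → X.carrier} (hx : ContMDiff (𝓡 n) 𝓘(ℝ, X.model) ∞ x) :
    ContMDiff (𝓡 n) 𝓘(ℝ, X.model) ∞ (fun u ↦ X.act (γ u) (x u)) :=
  X.contMDiff_act.comp (hγ.prodMk hx)

theorem isPlot_act {n : ℕ} {γ : Euc n → G} (hγ : ContMDiff (𝓡 n) 𝓘(ℝ, E) ∞ γ)
    {x : Euc n → X.carrier} (hx : IsPlot x) : IsPlot (fun u ↦ X.act (γ u) (x u)) :=
  X.contMDiff_act_fun hγ hx

theorem contMDiff_act_const (g : G) : ContMDiff 𝓘(ℝ, X.model) 𝓘(ℝ, X.model) ∞ (X.act g) :=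
  X.contMDiff_act.comp (contMDiff_const.prodMk contMDiff_id)

theorem contDiff_moment [FiniteDimensional ℝ E] {n : ℕ} {x : Euc n → X.carrier}
    (hx : ContMDiff (𝓡 n) 𝓘(ℝ, X.model) ∞ x) :
    ContDiff ℝ ∞ (fun u ↦ X.momentFun (x u)) :=
  contDiff_clm_apply_iff.mpr fun ξ ↦ ((X.contMDiff_moment ξ).comp hx).contDiff

theorem fderiv_moment [FiniteDimensional ℝ E] {n : ℕ} {x : Euc n → X.carrier}
    (hx : ContMDiff (𝓡 n) 𝓘(ℝ, X.model) ∞ x) (u v : Euc n) (ξ : E) :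
    fderiv ℝ (fun u ↦ X.momentFun (x u)) u v ξ =
      -X.formAt (x u) (modelDeriv E X.model (fun g : G ↦ X.act g (x u)) 1 ξ)
        (modelDeriv _ X.model x u v) := by
  rw [formAt_fundamental, neg_neg, ← modelDeriv_comp (f := fun z ↦ X.momentFun z ξ)
    ((X.contMDiff_moment ξ).mdifferentiable (by simp) _) (hx.mdifferentiable (by simp) u) rfl rfl,
    modelDeriv_eq_fderiv]
  have h := (((X.contDiff_moment hx).differentiable (by simp) u).hasFDerivAt.clm_apply
    (hasFDerivAt_const ξ u)).fderiv
  refine Eq.trans ?_ (congrArg (fun L : Euc n →L[ℝ] ℝ ↦ L v) h).symm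
  simp

theorem dForm_act_const (g : G) {n : ℕ} {x : Euc n → X.carrier} (hx : IsPlot x)
    (hgx : IsPlot fun u ↦ X.act g (x u)) : X.dForm.toFun _ hgx = X.dForm.toFun x hx := by
  have hx' : ContMDiff (𝓡 n) 𝓘(ℝ, X.model) ∞ x := hx
  funext u
  ext v
  have h := modelDeriv_comp (k := fun u ↦ X.act g (x u))
    ((X.contMDiff_act_const g).mdifferentiable (by simp) (x u)) (hx'.mdifferentiable (by simp) u)
    rfl rfl
  rw [dForm_apply, dForm_apply, h, h]
  exact X.form_act g (x u) _ _

theorem modelDeriv_act {n : ℕ} {γ : Euc n → G} (hγ : ContMDiff (𝓡 n) 𝓘(ℝ, E) ∞ γ)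
    {x : Euc n → X.carrier} (hx : ContMDiff (𝓡 n) 𝓘(ℝ, X.model) ∞ x) {u : Euc n} (h : γ u = 1)
    (v : Euc n) : modelDeriv _ X.model (fun u ↦ X.act (γ u) (x u)) u v =
      modelDeriv _ X.model x u v +
        modelDeriv E X.model (fun g : G ↦ X.act g (x u)) 1 (modelDeriv _ E γ u v) := by
  have hxu := hx.mdifferentiable (by simp) u
  rw [modelDeriv_comp₂ (f := fun g z ↦ X.act g z) (X.contMDiff_act.mdifferentiable (by simp) _)
    (hγ.mdifferentiable (by simp) u) hxu, ← modelDeriv_comp (k := x)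
    ((X.contMDiff_act_const (γ u)).mdifferentiable (by simp) _) hxu (by simp [h])
    rfl, h, add_comm]

variable [LieGroup 𝓘(ℝ, E) ∞ G]

/-- Equivariance of the moment map, in the shape needed by `extDeriv_momentumForm`, with `m'` the
moment of γx. -/
theorem moment_leftMC {n : ℕ} {γ : Euc n → G} (hγ : ContMDiff (𝓡 n) 𝓘(ℝ, E) ∞ γ)
    (x : Euc n → X.carrier) (u v : Euc n) :
    X.momentFun (x u) (leftMC E γ u v) =
      X.momentFun (X.act (γ u) (x u)) (rightMC E γ u v) := by
  rw [← adjointAction_leftMC hγ]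
  exact (X.moment_act (γ u) (x u) _).symm

/-- The change of the symplectic form under a smooth family of group elements. -/
theorem dForm_act [FiniteDimensional ℝ E] {n : ℕ} {γ : Euc n → G} (hγ : ContMDiff (𝓡 n) 𝓘(ℝ, E) ∞ γ)
    {x : Euc n → X.carrier} (hx : IsPlot x) (u : Euc n) :
    X.dForm.toFun (fun u ↦ X.act (γ u) (x u)) (X.isPlot_act hγ hx) u =
      X.dForm.toFun x hx u + extDeriv (momentumForm (fun u ↦ X.momentFun (x u)) γ) u := by
  -- The constant γ(u)⁻¹ preserves the symplectic form, and left translation preserves γ⁻¹dγ.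
  wlog h : γ u = 1 generalizing γ
  · let γ' : Euc n → G := fun w ↦ (γ u)⁻¹ * γ w
    have hγ' : ContMDiff (𝓡 n) 𝓘(ℝ, E) ∞ γ' := contMDiff_const.mul hγ
    have h1 := this hγ' (by simp [γ'])
    have h2 : momentumForm (fun u ↦ X.momentFun (x u)) γ' =
        momentumForm (fun u ↦ X.momentFun (x u)) γ := by
      funext w
      simp only [momentumForm, γ', leftMC_const_mul]
    rw [h2] at h1
    rw [← h1]
    have h3 : (fun w ↦ X.act (γ' w) (x w)) = fun w ↦ X.act (γ u)⁻¹ (X.act (γ w) (x w)) := by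
      funext w
      simp [γ']
    rw [X.dForm.toFun_eq _ h3]
    exact congrFun (X.dForm_act_const (γ u)⁻¹ _ _).symm u
  have hx' : ContMDiff (𝓡 n) 𝓘(ℝ, X.model) ∞ x := hx
  ext v
  have hxu : X.act (γ u) (x u) = x u := by simp [h]
  rw [dForm_apply, ContinuousAlternatingMap.add_apply, dForm_apply]
  have hd := extDeriv_momentumForm (X.contDiff_moment hx')
    (X.contDiff_moment (X.contMDiff_act_fun hγ hx')) hγ (X.moment_leftMC hγ x) h (by simp [hxu]) v
  rw [X.fderiv_moment hx', X.fderiv_moment (X.contMDiff_act_fun hγ hx')] at hd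
  refine Eq.trans ?_ (congrArg _ hd.symm)
  -- Let ξᵢ be the fundamental vector of dγ(vᵢ), so that γx has the derivatives dx(vᵢ) + ξᵢ. The
  -- moment of x yields ω(dx(v₀), ξ₁); the moment of γx yields ω(ξ₀, dx(v₁) + ξ₁), which also
  -- accounts for ω(ξ₀, ξ₁).
  simp only [X.modelDeriv_act hγ hx' h, hxu, formAt_add_left, formAt_add_right]
  rw [formAt_swap X (x u) (modelDeriv _ X.model x u (v 0))
    (modelDeriv E X.model (fun g : G ↦ X.act g (x u)) 1 (modelDeriv _ E γ u (v 1)))]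
  ring

end HamiltonianSpace

/-! ### Topology and smooth maps of the cotangent bundle -/

section CotangentSmooth

variable {E : Type*} [NormedAddCommGroup E] [NormedSpace ℝ E] {G : Type*} [TopologicalSpace G]
  [ChartedSpace E G] [IsManifold 𝓘(ℝ, E) ∞ G]

/-- Needed for the orbit relation on T*G × Y to be closed. Points of one fibre are separated in a
trivialization, other points in the base. -/
instance [T2Space G] : T2Space (CotangentBundle E G) := by
  refine ⟨fun x y hxy ↦ ?_⟩
  have hc : Continuous (TotalSpace.proj : CotangentBundle E G → G) :=
    FiberBundle.continuous_proj (E →L[ℝ] ℝ) (fun q : G ↦ TangentSpace 𝓘(ℝ, E) q →L[ℝ] ℝ)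
  by_cases h : x.1 = y.1
  · let e := trivializationAt (E →L[ℝ] ℝ) (fun q : G ↦ TangentSpace 𝓘(ℝ, E) q →L[ℝ] ℝ) x.1
    have hx : x ∈ e.source := e.mem_source.mpr (mem_baseSet_trivializationAt _ _ _)
    have hy : y ∈ e.source := e.mem_source.mpr (h ▸ mem_baseSet_trivializationAt _ _ _)
    have hne : e x ≠ e y := fun he ↦ hxy (e.injOn hx hy he)
    obtain ⟨U, V, hU, hV, hxU, hyV, hUV⟩ := t2_separation hne
    refine ⟨e.source ∩ e ⁻¹' U, e.source ∩ e ⁻¹' V, e.continuousOn.isOpen_inter_preimage e.open_source hU,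
      e.continuousOn.isOpen_inter_preimage e.open_source hV, ⟨hx, hxU⟩, ⟨hy, hyV⟩, ?_⟩
    exact (hUV.preimage e).mono Set.inter_subset_right Set.inter_subset_right
  · obtain ⟨U, V, hU, hV, hxU, hyV, hUV⟩ := t2_separation h
    exact ⟨_, _, hU.preimage hc, hV.preimage hc, hxU, hyV, hUV.preimage _⟩

variable {EN KN N : Type*} [NormedAddCommGroup EN] [NormedSpace ℝ EN] [TopologicalSpace KN]
  {J : ModelWithCorners ℝ EN KN} [TopologicalSpace N] [ChartedSpace KN N]

theorem contMDiff_cotangent_proj {p : N → CotangentBundle E G}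
    (hp : ContMDiff J (𝓘(ℝ, E).prod 𝓘(ℝ, E →L[ℝ] ℝ)) ∞ p) :
    ContMDiff J 𝓘(ℝ, E) ∞ (fun x ↦ (p x).1) :=
  (contMDiff_proj (fun q : G ↦ TangentSpace 𝓘(ℝ, E) q →L[ℝ] ℝ)).comp hp

/-- A family of covectors transported along a smooth family of maps is smooth. -/
theorem contMDiff_cotangent_comp [IsManifold J 1 N] {p : N → CotangentBundle E G} {b : N → G}
    {f : N → G → G} (hp : ContMDiff J (𝓘(ℝ, E).prod 𝓘(ℝ, E →L[ℝ] ℝ)) ∞ p)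
    (hb : ContMDiff J 𝓘(ℝ, E) ∞ b)
    (hf : ContMDiff (J.prod 𝓘(ℝ, E)) 𝓘(ℝ, E) ∞ (fun z : N × G ↦ f z.1 z.2))
    (h : ∀ x, f x (b x) = (p x).1) :
    ContMDiff J (𝓘(ℝ, E).prod 𝓘(ℝ, E →L[ℝ] ℝ)) ∞ (fun x ↦
      (⟨b x, (p x).covector.comp (modelDeriv E E (f x) (b x))⟩ : CotangentBundle E G)) := by
  intro x₀
  have h1 := (contMDiffAt_hom_bundle p).mp (hp x₀)
  have h2 := ContMDiffAt.mfderiv (m := ∞) f b (hf (x₀, b x₀)) (hb x₀) (by simp)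
  refine (contMDiffAt_hom_bundle _).mpr ⟨hb x₀, ?_⟩
  refine (h1.2.clm_comp h2).congr_of_eventuallyEq ?_
  have hq := (contMDiff_cotangent_proj hp).continuous.continuousAt (x := x₀)
  let e := trivializationAt E (TangentSpace 𝓘(ℝ, E)) (p x₀).1
  filter_upwards [hq.eventually (e.open_baseSet.mem_nhds (mem_baseSet_trivializationAt _ _ _))]
    with x hx
  -- The trivialization at the point f(b(x)) cancels against its inverse. Equal base points are kept
  -- as separate variables so that `h x` and `h x₀` can be substituted in dependent types.
  have key : ∀ q q' c : G, q' = q → c = (p x₀).1 → q ∈ e.baseSet → ∀ w : E,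
      (e.symmL ℝ q : E →L[ℝ] E) (((trivializationAt E (TangentSpace 𝓘(ℝ, E)) c).continuousLinearMapAt
        ℝ q' : E →L[ℝ] E) w) = w := by
    rintro q _ _ rfl rfl hq w
    exact e.symmL_continuousLinearMapAt (R := ℝ) hq w
  ext v
  simp only [inTangentCoordinates, ContinuousLinearMap.inCoordinates,
    ContinuousLinearMap.comp_apply]
  congr 1
  exact congrArg (p x).covector (key _ _ _ (h x) (h x₀) hx _).symm

/-- A smooth family of covectors at a fixed point is smooth. -/
theorem contMDiff_cotangent_fixed {m : N → E →L[ℝ] ℝ} (hm : ContMDiff J 𝓘(ℝ, E →L[ℝ] ℝ) ∞ m)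
    (q : G) : ContMDiff J (𝓘(ℝ, E).prod 𝓘(ℝ, E →L[ℝ] ℝ)) ∞ (fun x ↦
      (⟨q, m x⟩ : CotangentBundle E G)) := by
  intro x₀
  refine (contMDiffAt_hom_bundle _).mpr ⟨contMDiffAt_const, ?_⟩
  let c : E →L[ℝ] E := (trivializationAt E (TangentSpace 𝓘(ℝ, E)) q).symmL ℝ q
  let d : ℝ →L[ℝ] ℝ := (trivializationAt ℝ (Bundle.Trivial G ℝ) q).continuousLinearMapAt ℝ q
  have hc : ContMDiffAt J 𝓘(ℝ, E →L[ℝ] E) ∞ (fun _ : N ↦ c) x₀ := contMDiffAt_const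
  have hd : ContMDiffAt J 𝓘(ℝ, ℝ →L[ℝ] ℝ) ∞ (fun _ : N ↦ d) x₀ := contMDiffAt_const
  exact hd.clm_comp ((hm x₀).clm_comp hc)

end CotangentSmooth

section CotangentActions

variable {E : Type*} [NormedAddCommGroup E] [NormedSpace ℝ E] {G : Type*} [TopologicalSpace G]
  [ChartedSpace E G] [Group G] [LieGroup 𝓘(ℝ, E) ∞ G]
  {EN KN N : Type*} [NormedAddCommGroup EN] [NormedSpace ℝ EN] [TopologicalSpace KN]
  {J : ModelWithCorners ℝ EN KN} [TopologicalSpace N] [ChartedSpace KN N] [IsManifold J 1 N]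

theorem contMDiff_leftAction {g : N → G} (hg : ContMDiff J 𝓘(ℝ, E) ∞ g)
    {p : N → CotangentBundle E G} (hp : ContMDiff J (𝓘(ℝ, E).prod 𝓘(ℝ, E →L[ℝ] ℝ)) ∞ p) :
    ContMDiff J (𝓘(ℝ, E).prod 𝓘(ℝ, E →L[ℝ] ℝ)) ∞ (fun x ↦ leftAction E G (g x) (p x)) :=
  contMDiff_cotangent_comp (f := fun x a ↦ (g x)⁻¹ * a) (b := fun x ↦ g x * (p x).1) hp
    (hg.mul (contMDiff_cotangent_proj hp)) ((hg.inv.comp contMDiff_fst).mul contMDiff_snd)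
    fun x ↦ by simp

theorem contMDiff_rightAction {g : N → G} (hg : ContMDiff J 𝓘(ℝ, E) ∞ g)
    {p : N → CotangentBundle E G} (hp : ContMDiff J (𝓘(ℝ, E).prod 𝓘(ℝ, E →L[ℝ] ℝ)) ∞ p) :
    ContMDiff J (𝓘(ℝ, E).prod 𝓘(ℝ, E →L[ℝ] ℝ)) ∞ (fun x ↦ rightAction E G (g x) (p x)) :=
  contMDiff_cotangent_comp (f := fun x a ↦ a * g x) (b := fun x ↦ (p x).1 * (g x)⁻¹) hp
    ((contMDiff_cotangent_proj hp).mul hg.inv) (contMDiff_snd.mul (hg.comp contMDiff_fst))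
    fun x ↦ by simp

end CotangentActions

/-! ### The canonical 1-form under translations -/

section Liouville

variable {E : Type*} [NormedAddCommGroup E] [NormedSpace ℝ E] {G : Type*}
  [TopologicalSpace G] [ChartedSpace E G] [Group G] [LieGroup 𝓘(ℝ, E) ∞ G] {n : ℕ}

theorem liouvilleForm_apply {p : Euc n → CotangentBundle E G} (hp : IsPlot p) (u : Euc n)
    (v : Fin 1 → Euc n) : (liouvilleForm E G).toFun p hp u v =
      (p u).covector (modelDeriv _ E (fun w ↦ (p w).1) u (v 0)) := rfl

theorem leftDeriv_inv_leftDeriv (g a : G) (v : E) :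
    leftDeriv E g⁻¹ (g * a) (leftDeriv E g a v) = v := by
  rw [leftDeriv_leftDeriv, inv_mul_cancel, leftDeriv_one]
  rfl

theorem leftMC_eq_leftDeriv {γ : Euc n → G} (hγ : ContMDiff (𝓡 n) 𝓘(ℝ, E) ∞ γ) (u v : Euc n) :
    leftMC E γ u v = leftDeriv E (γ u)⁻¹ (γ u) (modelDeriv _ E γ u v) :=
  modelDeriv_comp (mdifferentiable_left (γ u)⁻¹ _) (hγ.mdifferentiable (by simp) u) rfl rfl v

theorem isPlot_leftAction {γ : Euc n → G} (hγ : ContMDiff (𝓡 n) 𝓘(ℝ, E) ∞ γ)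
    {p : Euc n → CotangentBundle E G} (hp : IsPlot p) :
    IsPlot (fun u ↦ leftAction E G (γ u) (p u)) := contMDiff_leftAction hγ hp

theorem isPlot_rightAction {γ : Euc n → G} (hγ : ContMDiff (𝓡 n) 𝓘(ℝ, E) ∞ γ)
    {p : Euc n → CotangentBundle E G} (hp : IsPlot p) :
    IsPlot (fun u ↦ rightAction E G (γ u) (p u)) := contMDiff_rightAction hγ hp

theorem modelDeriv_mul_fun {f g : Euc n → G} (hf : ContMDiff (𝓡 n) 𝓘(ℝ, E) ∞ f)
    (hg : ContMDiff (𝓡 n) 𝓘(ℝ, E) ∞ g) (u v : Euc n) :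
    modelDeriv _ E (fun w ↦ f w * g w) u v =
      rightDeriv E (g u) (f u) (modelDeriv _ E f u v) +
        leftDeriv E (f u) (g u) (modelDeriv _ E g u v) :=
  modelDeriv_comp₂ (f := fun a b ↦ a * b)
    ((contMDiff_mul 𝓘(ℝ, E) ∞).mdifferentiable (by simp) (f u, g u))
    (hf.mdifferentiable (by simp) u) (hg.mdifferentiable (by simp) u) v

/-- The base point γq has the velocity (dγ)q + γ(dq). After γ is undone, the second summand pairs
with p to ϖ(p), and the first to ⟨p, (γ⁻¹dγ)q⟩ = ⟨pq⁻¹, γ⁻¹dγ⟩. -/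
theorem liouvilleForm_leftAction {γ : Euc n → G} (hγ : ContMDiff (𝓡 n) 𝓘(ℝ, E) ∞ γ)
    {p : Euc n → CotangentBundle E G} (hp : IsPlot p) :
    (liouvilleForm E G).toFun _ (isPlot_leftAction hγ hp) = fun u ↦
      (liouvilleForm E G).toFun p hp u + momentumForm (fun u ↦ (p u).covector.comp (rightDeriv E (p u).1 1)) γ u := by
  funext u
  ext v
  have hq := contMDiff_cotangent_proj (p := p) hp
  have h1 := modelDeriv_mul_fun hγ hq u (v 0)
  have h2 := leftDeriv_rightDeriv (γ u)⁻¹ (p u).1 (γ u) (modelDeriv _ E γ u (v 0))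
  rw [inv_mul_cancel, ← leftMC_eq_leftDeriv hγ] at h2
  rw [liouvilleForm_apply]
  refine (congrArg (p u).covector (congrArg (leftDeriv E (γ u)⁻¹ (γ u * (p u).1)) h1)).trans ?_
  rw [map_add, h2, leftDeriv_inv_leftDeriv, map_add, add_comm]
  rfl

/-- The product of k(w)⁻¹k(u) and k(u)⁻¹k(w) is constantly 1, and both factors are 1 at w = u. -/
theorem rightDeriv_inv {k : Euc n → G} (hk : ContMDiff (𝓡 n) 𝓘(ℝ, E) ∞ k) (u v : Euc n) :
    rightDeriv E (k u) (k u)⁻¹ (modelDeriv _ E (fun w ↦ (k w)⁻¹) u v) = -leftMC E k u v := by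
  have h1 := modelDeriv_mul (u := u) (f := fun w ↦ (k w)⁻¹ * k u) (g := fun w ↦ (k u)⁻¹ * k w)
    (hk.inv.mul contMDiff_const) (contMDiff_const.mul hk) (by simp) (by simp) v
  have h2 : (fun w ↦ (k w)⁻¹ * k u * ((k u)⁻¹ * k w)) = fun _ ↦ 1 := by
    funext w
    simp [mul_assoc]
  rw [h2, modelDeriv_const] at h1
  have h3 := modelDeriv_comp (k := fun w ↦ (k w)⁻¹ * k u) (f := fun a ↦ a * k u)
    (g := fun w ↦ (k w)⁻¹) (mdifferentiable_right (k u) (k u)⁻¹)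
    (hk.inv.mdifferentiable (by simp) u) rfl rfl v
  rw [h3] at h1
  exact eq_neg_of_add_eq_zero_left h1.symm

/-- The velocity of k⁻¹ contributes −⟨q⁻¹p, k⁻¹dk⟩ to the form of pk⁻¹. Solving for the form of p
makes the correction match the one in `HamiltonianSpace.dForm_act`. -/
theorem liouvilleForm_rightAction {k : Euc n → G} (hk : ContMDiff (𝓡 n) 𝓘(ℝ, E) ∞ k)
    {p : Euc n → CotangentBundle E G} (hp : IsPlot p) :
    (liouvilleForm E G).toFun p hp = fun u ↦
      (liouvilleForm E G).toFun _ (isPlot_rightAction hk hp) u +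
        momentumForm (fun u ↦ (p u).covector.comp (leftDeriv E (p u).1 1)) k u := by
  funext u
  ext v
  have hq := contMDiff_cotangent_proj (p := p) hp
  have h1 := modelDeriv_mul_fun hq hk.inv u (v 0)
  have h2 := leftDeriv_rightDeriv (p u).1 (k u) (k u)⁻¹ (modelDeriv _ E (fun w ↦ (k w)⁻¹) u (v 0))
  rw [rightDeriv_inv hk, inv_mul_cancel] at h2
  have h3 := rightDeriv_rightDeriv (k u) (k u)⁻¹ (p u).1 (modelDeriv _ E (fun w ↦ (p w).1) u (v 0))
  rw [inv_mul_cancel, rightDeriv_one] at h3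
  have h4 : (liouvilleForm E G).toFun _ (isPlot_rightAction hk hp) u v =
      (p u).covector (modelDeriv _ E (fun w ↦ (p w).1) u (v 0)) -
        momentumForm (fun u ↦ (p u).covector.comp (leftDeriv E (p u).1 1)) k u v := by
    rw [liouvilleForm_apply]
    refine (congrArg (p u).covector
      (congrArg (rightDeriv E (k u) ((p u).1 * (k u)⁻¹)) h1)).trans ?_
    rw [map_add, h3, ← h2, map_add, map_neg, map_neg, sub_eq_add_neg]
    rfl
  rw [ContinuousAlternatingMap.add_apply, h4]
  exact (sub_add_cancel _ _).symm

theorem extDeriv_of_eq_add {k : ℕ} {α β δ : Euc n → Euc n [⋀^Fin k]→L[ℝ] ℝ} (hα : ContDiff ℝ ∞ α)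
    (hβ : ContDiff ℝ ∞ β) (h : α = fun u ↦ β u + δ u) (u : Euc n) :
    extDeriv α u = extDeriv β u + extDeriv δ u := by
  have hδ : δ = fun u ↦ α u - β u := by
    funext u
    simp [h]
  have hδs : ContDiff ℝ ∞ δ := hδ ▸ hα.sub hβ
  rw [h]
  exact extDeriv_fun_add (hβ.differentiable (by simp) u) (hδs.differentiable (by simp) u)

theorem d_liouvilleForm_leftAction {γ : Euc n → G} (hγ : ContMDiff (𝓡 n) 𝓘(ℝ, E) ∞ γ)
    {p : Euc n → CotangentBundle E G} (hp : IsPlot p) (u : Euc n) :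
    (liouvilleForm E G).d.toFun _ (isPlot_leftAction hγ hp) u =
      (liouvilleForm E G).d.toFun p hp u +
        extDeriv (momentumForm (fun u ↦ (p u).covector.comp (rightDeriv E (p u).1 1)) γ) u :=
  extDeriv_of_eq_add ((liouvilleForm E G).smooth _ _) ((liouvilleForm E G).smooth _ _)
    (liouvilleForm_leftAction hγ hp) u

theorem d_liouvilleForm_rightAction {k : Euc n → G} (hk : ContMDiff (𝓡 n) 𝓘(ℝ, E) ∞ k)
    {p : Euc n → CotangentBundle E G} (hp : IsPlot p) (u : Euc n) :
    (liouvilleForm E G).d.toFun p hp u =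
      (liouvilleForm E G).d.toFun _ (isPlot_rightAction hk hp) u +
        extDeriv (momentumForm (fun u ↦ (p u).covector.comp (leftDeriv E (p u).1 1)) k) u :=
  extDeriv_of_eq_add ((liouvilleForm E G).smooth _ _) ((liouvilleForm E G).smooth _ _)
    (liouvilleForm_rightAction hk hp) u

end Liouville

/-! ### Maurer-Cartan forms under homomorphisms -/

section Homomorphism

variable {E : Type*} [NormedAddCommGroup E] [NormedSpace ℝ E] {G : Type*} [TopologicalSpace G]
  [ChartedSpace E G] [Group G] {E' : Type*} [NormedAddCommGroup E'] [NormedSpace ℝ E']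
  {H : Type*} [TopologicalSpace H] [ChartedSpace E' H] [Group H] [LieGroup 𝓘(ℝ, E') ∞ H] {n : ℕ}

theorem leftMC_hom {ι : H →* G} (hι : ContMDiff 𝓘(ℝ, E') 𝓘(ℝ, E) ∞ ι) {h : Euc n → H}
    (hh : ContMDiff (𝓡 n) 𝓘(ℝ, E') ∞ h) (u v : Euc n) :
    leftMC E (fun w ↦ ι (h w)) u v = modelDeriv E' E ι 1 (leftMC E' h u v) :=
  modelDeriv_comp (f := ι) (g := fun w ↦ (h u)⁻¹ * h w) (hι.mdifferentiable (by simp) 1)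
    ((contMDiff_const.mul hh).mdifferentiable (by simp) u) (by funext w; simp) (by simp) v

/-- Turns the correction for the right action of ι(h) into a pairing with (q⁻¹p)|_𝔥, which equals
Ψ(y) on the zero level. -/
theorem momentumForm_hom {ι : H →* G} (hι : ContMDiff 𝓘(ℝ, E') 𝓘(ℝ, E) ∞ ι) {h : Euc n → H}
    (hh : ContMDiff (𝓡 n) 𝓘(ℝ, E') ∞ h) (m : Euc n → E →L[ℝ] ℝ) :
    momentumForm m (fun w ↦ ι (h w)) =
      momentumForm (fun u ↦ (m u).comp (modelDeriv E' E ι 1)) h := by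
  funext u
  ext v
  exact congrArg (m u) (leftMC_hom hι hh u (v 0))

end Homomorphism

/-! ### Maps that lift plots as quotient maps -/

section Diffeology

variable {A B C : Type*} [DiffeologicalSpace A] [DiffeologicalSpace B] [DiffeologicalSpace C]

theorem isPlot_of_locally {n : ℕ} {p : Euc n → A}
    (h : ∀ x, ∃ q : Euc n → A, IsPlot q ∧ p =ᶠ[𝓝 x] q) : IsPlot p := by
  refine DiffeologicalSpace.locality fun x ↦ ?_
  obtain ⟨q, hq, hpq⟩ := h x
  obtain ⟨s, hs, hso, hxs⟩ := mem_nhds_iff.mp hpq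
  refine ⟨s, hso, hxs, fun {m f} hf hfc ↦ ?_⟩
  have : p ∘ f = q ∘ f := funext fun y ↦ hs (hf y)
  rw [this]
  exact isPlot_reparam hq hfc

theorem LiftsPlots.dSmooth {f : A → B} (hl : LiftsPlots f) {g : B → C} (hg : DSmooth (g ∘ f)) :
    DSmooth g := by
  refine fun n p hp ↦ isPlot_of_locally fun x ↦ ?_
  obtain ⟨q, hq, hpq⟩ := hl p hp x
  exact ⟨_, hg _ q hq, hpq.fun_comp g⟩

theorem LiftsPlots.surjective {f : A → B} (hl : LiftsPlots f) : Function.Surjective f := fun b ↦ by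
  obtain ⟨q, -, hq⟩ := hl (fun _ : Euc 0 ↦ b) isPlot_const 0
  exact ⟨q 0, hq.self_of_nhds.symm⟩

theorem LiftsPlots.comp {g : B → C} {f : A → B} (hg : LiftsPlots g) (hf : LiftsPlots f) :
    LiftsPlots (g ∘ f) := by
  intro n p hp x
  obtain ⟨q, hq, hpq⟩ := hg p hp x
  obtain ⟨r, hr, hqr⟩ := hf q hq x
  exact ⟨r, hr, hpq.trans (hqr.fun_comp g)⟩

end Diffeology

section ProductManifold

variable {E₁ K₁ M₁ E₂ K₂ M₂ : Type*} [NormedAddCommGroup E₁] [NormedSpace ℝ E₁]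
  [TopologicalSpace K₁] {I₁ : ModelWithCorners ℝ E₁ K₁} [TopologicalSpace M₁] [ChartedSpace K₁ M₁]
  [DiffeologicalSpace M₁] [NormedAddCommGroup E₂] [NormedSpace ℝ E₂]
  [TopologicalSpace K₂] {I₂ : ModelWithCorners ℝ E₂ K₂} [TopologicalSpace M₂] [ChartedSpace K₂ M₂]
  [DiffeologicalSpace M₂]

theorem isPlot_prod_iff_contMDiff
    (h₁ : ∀ {n : ℕ} (p : Euc n → M₁), IsPlot p ↔ ContMDiff (𝓡 n) I₁ ∞ p)
    (h₂ : ∀ {n : ℕ} (p : Euc n → M₂), IsPlot p ↔ ContMDiff (𝓡 n) I₂ ∞ p) {n : ℕ}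
    (p : Euc n → M₁ × M₂) : IsPlot p ↔ ContMDiff (𝓡 n) (I₁.prod I₂) ∞ p := by
  rw [isPlot_prod_iff, contMDiff_prod_iff, h₁, h₂]

end ProductManifold

/-! ### Existence of reduced forms -/

section Intertwiners

variable {E : Type*} [NormedAddCommGroup E] [NormedSpace ℝ E] [FiniteDimensional ℝ E]
  {G : Type*} [TopologicalSpace G] [T2Space G] [SecondCountableTopology G] [ChartedSpace E G]
  [Group G] [LieGroup 𝓘(ℝ, E) ∞ G]

/-- The intertwiner space of two Hamiltonian spaces carries exactly one reduced form. -/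
theorem existsUnique_intertwinerForm (A B : HamiltonianSpace E G) :
    ∃! β : DForm (Intertwiners A.act A.moment B.act B.moment) 2,
      Reduction.IsReducedForm _ _ (oppositeSumForm A.dForm B.dForm) β := by
  refine Reduction.existsUnique_isReducedForm _ _ _ fun n P Q hP hQ hPμ hQμ hPQ ↦ ?_
  refine DForm.toFun_eq_of_orbit (I := 𝓘(ℝ, A.model).prod 𝓘(ℝ, B.model)) (E := E)
    (ρ := diagonalAction A.act B.act) (N := {z | B.moment z.2 - A.moment z.1 = 0})
    (isPlot_prod_iff_contMDiff (fun _ ↦ Iff.rfl) (fun _ ↦ Iff.rfl)) ?_ ?_ hP hQ hPμ hQμ hPQ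
  · exact (A.contMDiff_act.comp (contMDiff_fst.prodMk (contMDiff_fst.comp contMDiff_snd))).prodMk
      (B.contMDiff_act.comp (contMDiff_fst.prodMk (contMDiff_snd.comp contMDiff_snd)))
  · intro m γ p hp hγp hγ hpN
    -- On the zero level the two corrections d⟨Φ, γ⁻¹dγ⟩ are equal, hence cancel in the difference
    -- of the forms.
    have hmom : (fun u ↦ A.momentFun (p u).1) = fun u ↦ B.momentFun (p u).2 :=
      funext fun u ↦ (sub_eq_zero.mp (hpN u)).symm
    funext u
    have h1 := A.dForm_act hγ (dSmooth_fst _ _ hp) u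
    have h2 := B.dForm_act hγ (dSmooth_snd _ _ hp) u
    simp only [Function.comp_apply, hmom] at h1 h2
    exact (congrArg₂ (· - ·) h2 h1).trans (add_sub_add_right_eq_sub _ _ _)

end Intertwiners

section Induced

variable {E : Type*} [NormedAddCommGroup E] [NormedSpace ℝ E] [FiniteDimensional ℝ E]
  {G : Type*} [TopologicalSpace G] [T2Space G] [ChartedSpace E G] [Group G]
  [LieGroup 𝓘(ℝ, E) ∞ G]
  {E' : Type*} [NormedAddCommGroup E'] [NormedSpace ℝ E'] [FiniteDimensional ℝ E']
  {H : Type*} [TopologicalSpace H] [T2Space H] [SecondCountableTopology H] [ChartedSpace E' H]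
  [Group H] [LieGroup 𝓘(ℝ, E') ∞ H]

/-- The induced space carries exactly one reduced form. -/
theorem existsUnique_inducedForm {ι : H →* G} (hι : ContMDiff 𝓘(ℝ, E') 𝓘(ℝ, E) ∞ ι)
    (Y : HamiltonianSpace E' H) : ∃! σ : DForm (Induced E ι Y) 2, IsInducedForm ι Y σ := by
  refine Reduction.existsUnique_isReducedForm _ _ _ fun n P Q hP hQ hPμ hQμ hPQ ↦ ?_
  refine DForm.toFun_eq_of_orbit (I := (𝓘(ℝ, E).prod 𝓘(ℝ, E →L[ℝ] ℝ)).prod 𝓘(ℝ, Y.model)) (E := E')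
    (ρ := inductionAction E ι Y) (N := {z | inductionMoment E ι Y z = 0})
    (isPlot_prod_iff_contMDiff (fun _ ↦ Iff.rfl) (fun _ ↦ Iff.rfl)) ?_ ?_ hP hQ hPμ hQμ hPQ
  · exact (contMDiff_rightAction (hι.comp contMDiff_fst) (contMDiff_fst.comp contMDiff_snd)).prodMk
      (Y.contMDiff_act.comp (contMDiff_fst.prodMk (contMDiff_snd.comp contMDiff_snd)))
  · intro m γ p hp hγp hγ hpN
    -- On the zero level dϖ loses exactly what ω_Y gains.
    have hmom : (fun u ↦ ((p u).1.covector.comp (leftDeriv E (p u).1.1 1)).comp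
        (modelDeriv E' E ι 1)) = fun u ↦ Y.momentFun (p u).2 :=
      funext fun u ↦ (sub_eq_zero.mp (hpN u)).symm
    funext u
    have h1 := d_liouvilleForm_rightAction (hι.comp hγ) (dSmooth_fst _ _ hp) u
    have h2 := Y.dForm_act hγ (dSmooth_snd _ _ hp) u
    simp only [Function.comp_def] at h1 h2
    rw [momentumForm_hom hι hγ, hmom] at h1
    refine (congrArg₂ (· + ·) rfl h2).trans (Eq.trans ?_ (congrArg₂ (· + ·) h1.symm rfl))
    exact (add_assoc _ _ _).symm.trans (add_right_comm _ _ _)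

end Induced

/-! ### The canonical 2-form on triples (x, p, y) -/

section FormIdentity

variable {E : Type*} [NormedAddCommGroup E] [NormedSpace ℝ E]
  {G : Type*} [TopologicalSpace G] [ChartedSpace E G] [Group G] [LieGroup 𝓘(ℝ, E) ∞ G] {n : ℕ}

theorem contMDiff_base_inv {p : Euc n → CotangentBundle E G} (hp : IsPlot p) :
    ContMDiff (𝓡 n) 𝓘(ℝ, E) ∞ (fun u ↦ (p u).1⁻¹) := (contMDiff_cotangent_proj hp).inv

theorem d_liouvilleForm_eq_zero_of_base_const {p : Euc n → CotangentBundle E G} (hp : IsPlot p)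
    {q : G} (h : ∀ u, (p u).1 = q) (u : Euc n) : (liouvilleForm E G).d.toFun p hp u = 0 := by
  have h1 : (fun w ↦ (p w).1) = fun _ ↦ q := funext h
  have h2 : (liouvilleForm E G).toFun p hp = fun _ ↦ 0 := by
    funext w
    ext v
    rw [liouvilleForm_apply, h1, modelDeriv_const]
    simp
  show extDeriv ((liouvilleForm E G).toFun p hp) u = 0
  rw [h2]
  ext v
  rw [extDeriv_apply (differentiableAt_const _)]
  simp

variable [FiniteDimensional ℝ E]

/-- On the zero level of `X⁻ × T^*G`, the symplectic form is the pullback of the one of `X⁻` along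
`(x, p) ↦ q⁻¹(x)`, for `p ∈ T_q^*G`. -/
theorem d_liouvilleForm_eq_sub (X : HamiltonianSpace E G) {x : Euc n → X.carrier} (hx : IsPlot x)
    {p : Euc n → CotangentBundle E G} (hp : IsPlot p)
    (h : ∀ u, leftMomentum (p u) - X.moment (x u) = 0) (u : Euc n) :
    (liouvilleForm E G).d.toFun p hp u = X.dForm.toFun x hx u -
      X.dForm.toFun _ (X.isPlot_act (contMDiff_base_inv hp) hx) u := by
  have hmom : (fun u ↦ (p u).covector.comp (rightDeriv E (p u).1 1)) = fun u ↦ X.momentFun (x u) :=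
    funext fun u ↦ sub_eq_zero.mp (h u)
  -- The family γ = q⁻¹ moves every covector into the fibre over 1, where dϖ vanishes. The
  -- corrections for x and p coincide because pq⁻¹ = Φ(x).
  have h1 := X.dForm_act (contMDiff_base_inv hp) hx u
  have h2 := d_liouvilleForm_leftAction (contMDiff_base_inv hp) hp u
  rw [d_liouvilleForm_eq_zero_of_base_const _ (q := 1) (fun w ↦ inv_mul_cancel (p w).1), hmom] at h2
  rw [h1, eq_neg_of_add_eq_zero_left h2.symm]
  abel

end FormIdentity

/-! ### The two momenta of a covector -/

section Momentum

variable {E : Type*} [NormedAddCommGroup E] [NormedSpace ℝ E]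
  {G : Type*} [TopologicalSpace G] [ChartedSpace E G] [Group G] [LieGroup 𝓘(ℝ, E) ∞ G]

theorem leftMomentum_adjointAction (p : CotangentBundle E G) (ξ : LieAlg E G) :
    leftMomentum p (adjointAction E p.1 ξ) = bodyMomentum p ξ :=
  congrArg p.covector (mfderiv_chain (E₁ := E) (E₂ := E) (E₃ := E) (f := fun b ↦ b * p.1) (g := fun b ↦ p.1 * b * p.1⁻¹)
    (k := fun b ↦ p.1 * b) (by funext b; simp) (by simp) (mdifferentiable_right p.1)
    (mdifferentiable_conj p.1) ξ)

theorem bodyMomentum_adjointAction_inv (p : CotangentBundle E G) (ξ : LieAlg E G) :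
    bodyMomentum p (adjointAction E p.1⁻¹ ξ) = leftMomentum p ξ :=
  congrArg p.covector (mfderiv_chain (E₁ := E) (E₂ := E) (E₃ := E) (f := fun b ↦ p.1 * b) (g := fun b ↦ p.1⁻¹ * b * p.1⁻¹⁻¹)
    (k := fun b ↦ b * p.1) (by funext b; simp [mul_assoc]) (by simp) (mdifferentiable_left p.1)
    (mdifferentiable_conj p.1⁻¹) ξ)

/-- The adjoint action of q relates pq⁻¹ to q⁻¹p and, by equivariance, Φ(x) to Φ(q⁻¹x). -/
theorem leftMomentum_eq_moment_iff (X : HamiltonianSpace E G) (p : CotangentBundle E G)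
    (x : X.carrier) :
    leftMomentum p = X.moment x ↔ bodyMomentum p = X.moment (X.act p.1⁻¹ x) := by
  constructor <;> intro h <;> refine ContinuousLinearMap.ext fun ξ ↦ ?_
  · rw [← leftMomentum_adjointAction, h, ← X.moment_act p.1 (X.act p.1⁻¹ x) ξ]
    simp
  · rw [← bodyMomentum_adjointAction_inv, h, X.moment_act]

omit [LieGroup 𝓘(ℝ, E) ∞ G] in
theorem leftMomentum_one (m : LieDual E G) :
    leftMomentum (⟨1, m⟩ : CotangentBundle E G) = m := by
  refine ContinuousLinearMap.ext fun ξ ↦ ?_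
  show m (rightDeriv E 1 1 ξ) = m ξ
  rw [rightDeriv_one]
  rfl

/-- A covector is determined by its base point and its momentum. -/
theorem CotangentBundle.ext_leftMomentum {p p' : CotangentBundle E G} (h : p.1 = p'.1)
    (h' : leftMomentum p = leftMomentum p') : p = p' := by
  have key : ∀ (r : CotangentBundle E G) (v : E),
      r.covector v = leftMomentum r (rightDeriv E r.1⁻¹ r.1 v) := by
    intro r v
    have e := rightDeriv_rightDeriv r.1 r.1⁻¹ r.1 v
    rw [mul_inv_cancel, inv_mul_cancel, rightDeriv_one] at e
    exact congrArg r.covector e.symm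
  refine CotangentBundle.ext' h fun v ↦ ?_
  rw [key, key, h, h']

end Momentum

/-! ### The common cover of the two intertwiner spaces -/

section Reciprocity

variable {E : Type*} [NormedAddCommGroup E] [NormedSpace ℝ E]
  {G : Type*} [TopologicalSpace G] [ChartedSpace E G] [Group G] [LieGroup 𝓘(ℝ, E) ∞ G]
  {E' : Type*} [NormedAddCommGroup E'] [NormedSpace ℝ E']
  {H : Type*} [TopologicalSpace H] [ChartedSpace E' H] [Group H] (ι : H →* G)
  (X : HamiltonianSpace E G) (Y : HamiltonianSpace E' H)

/-- The points `(x, p, y)` that represent points of `Hom_G(X, Ind_H^G Y)`. -/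
abbrev BiLevel : Type _ :=
  {w : X.carrier × (CotangentBundle E G × Y.carrier) //
    inductionMoment E ι Y w.2 = 0 ∧ leftMomentum w.2.1 - X.moment w.1 = 0}

namespace BiLevel

variable {ι X Y}

/-- The point `(x, [p, y])` of the zero level of `X⁻ × Ind_H^G Y`. -/
def toLevel (w : BiLevel ι X Y) :
    {z : X.carrier × Induced E ι Y // inducedMoment E ι Y z.2 - X.moment z.1 = 0} :=
  ⟨(w.1.1, Reduction.mk _ _ ⟨w.1.2, w.2.1⟩), w.2.2⟩

theorem dSmooth_toLevel : DSmooth (toLevel (ι := ι) (X := X) (Y := Y)) := fun n p hp ↦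
  isPlot_prod_iff.mpr ⟨(isPlot_prod_iff.mp hp).1,
    Reduction.dSmooth_mk _ _ n (fun u ↦ ⟨(p u).1.2, (p u).2.1⟩) (isPlot_prod_iff.mp hp).2⟩

/-- Only the component in Ind_H^G Y needs a lift. The cut-off `f` makes the lift valid at every
point, so both moment conditions hold everywhere and the result is a plot of `BiLevel`. -/
theorem liftsPlots_toLevel : LiftsPlots (toLevel (ι := ι) (X := X) (Y := Y)) := by
  intro n z hz u₀
  obtain ⟨hz1, hz2⟩ := isPlot_prod_iff.mp (show IsPlot (Subtype.val ∘ z) from hz)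
  obtain ⟨r, hr, hrz⟩ := Reduction.liftsPlots_mk _ _ _ hz2 u₀
  obtain ⟨s, hs, hso, hus⟩ := mem_nhds_iff.mp hrz
  obtain ⟨f, hfs, hf, hfu⟩ := exists_smooth_into hso hus
  have key : ∀ w, (z (f w)).1.2 = Reduction.mk _ _ (r (f w)) := fun w ↦ hs (hfs w)
  refine ⟨fun w ↦ ⟨((z (f w)).1.1, (r (f w)).1), (r (f w)).2, ?_⟩, ?_, ?_⟩
  · have h := (z (f w)).2
    rw [key] at h
    exact h
  · exact isPlot_prod_iff.mpr ⟨isPlot_reparam hz1 hf, isPlot_reparam (p := Subtype.val ∘ r) hr hf⟩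
  · filter_upwards [hfu] with w hw
    refine Subtype.ext (Prod.ext ?_ ?_)
    · simp [toLevel, hw]
    · have := key w
      simp only [hw, id_eq] at this
      simp [toLevel, hw, this]

variable [LieGroup 𝓘(ℝ, E') ∞ H] (hι : ContMDiff 𝓘(ℝ, E') 𝓘(ℝ, E) ∞ ι)

theorem moment_inv_act (w : BiLevel ι X Y) : Y.moment w.1.2.2 -
    (X.restrict ι hι).moment (X.act w.1.2.1.1⁻¹ w.1.1) = 0 := by
  have h1 : Y.moment w.1.2.2 = (bodyMomentum w.1.2.1).comp (lieDeriv E E' ι) :=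
    sub_eq_zero.mp w.2.1
  rw [(leftMomentum_eq_moment_iff X _ _).mp (sub_eq_zero.mp w.2.2)] at h1
  exact sub_eq_zero.mpr h1

/-- The point `(q⁻¹(x), y)` of the zero level of `(Res_H^G X)⁻ × Y`. -/
def untwist (w : BiLevel ι X Y) : {z : (X.restrict ι hι).carrier × Y.carrier //
    Y.moment z.2 - (X.restrict ι hι).moment z.1 = 0} :=
  ⟨(X.act w.1.2.1.1⁻¹ w.1.1, w.1.2.2), w.moment_inv_act hι⟩

theorem dSmooth_untwist : DSmooth (untwist (ι := ι) hι (X := X) (Y := Y)) := by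
  intro n p hp
  obtain ⟨h1, h2⟩ := isPlot_prod_iff.mp (show IsPlot (Subtype.val ∘ p) from hp)
  obtain ⟨h3, h4⟩ := isPlot_prod_iff.mp h2
  exact isPlot_prod_iff.mpr ⟨X.isPlot_act (contMDiff_base_inv h3) h1, h4⟩

/-- If gx = x' and gph⁻¹ = p', then q' = gqh⁻¹ and q'⁻¹x' = h(q⁻¹x). Conversely h forces g = q'hq⁻¹;
then gph⁻¹ has the base point q' and the momentum Φ(x'), as p' does, so the two agree. -/
theorem mk_toLevel_eq_iff (w w' : BiLevel ι X Y) :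
    (Reduction.mk _ _ w.toLevel : HomInduced ι X Y) = Reduction.mk _ _ w'.toLevel ↔
      (Reduction.mk _ _ (w.untwist hι) : HomRestricted ι hι X Y) =
        Reduction.mk _ _ (w'.untwist hι) := by
  obtain ⟨⟨x, p, y⟩, hp, hx⟩ := w
  obtain ⟨⟨x', p', y'⟩, hp', hx'⟩ := w'
  constructor
  · intro heq
    obtain ⟨g, hg⟩ := Quotient.exact heq
    obtain ⟨hgx, hgp⟩ := Prod.ext_iff.mp hg
    obtain ⟨h, hh⟩ := Quotient.exact hgp
    obtain ⟨hhp, hhy⟩ := Prod.ext_iff.mp hh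
    refine Quotient.sound ⟨h, Prod.ext ?_ hhy⟩
    have hq : g * p.1 * (ι h)⁻¹ = p'.1 := congrArg TotalSpace.proj hhp
    show X.act (ι h) (X.act p.1⁻¹ x) = X.act p'.1⁻¹ x'
    rw [← hq, ← show X.act g x = x' from hgx, ← Equiv.Perm.mul_apply, ← Equiv.Perm.mul_apply,
      ← map_mul, ← map_mul]
    congr 2
    group
  · intro heq
    obtain ⟨h, hh⟩ := Quotient.exact heq
    obtain ⟨hhx, hhy⟩ := Prod.ext_iff.mp hh
    have hhx' : X.act (ι h) (X.act p.1⁻¹ x) = X.act p'.1⁻¹ x' := hhx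
    have hgx : X.act (p'.1 * ι h * p.1⁻¹) x = x' := by
      rw [map_mul, map_mul, Equiv.Perm.mul_apply, Equiv.Perm.mul_apply, hhx']
      simp
    refine Quotient.sound ⟨p'.1 * ι h * p.1⁻¹, Prod.ext hgx ?_⟩
    refine Quotient.sound ⟨h, Prod.ext (CotangentBundle.ext_leftMomentum ?_ ?_) hhy⟩
    · show p'.1 * ι h * p.1⁻¹ * p.1 * (ι h)⁻¹ = p'.1
      simp
    · refine (leftMomentum_rightAction (ι h) _).trans (Eq.trans ?_ (sub_eq_zero.mp hx').symm)
      refine (leftMomentum_eq_moment_iff X _ _).mpr ((bodyMomentum_leftAction _ _).trans ?_)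
      rw [(leftMomentum_eq_moment_iff X _ _).mp (sub_eq_zero.mp hx), ← hgx]
      show _ = X.moment (X.act (p'.1 * ι h * p.1⁻¹ * p.1)⁻¹ _)
      rw [← Equiv.Perm.mul_apply, ← map_mul]
      congr 3
      group

variable [FiniteDimensional ℝ E]

/-- The lift is a section: x is paired with the covector Φ(x) at 1, where both momenta equal Φ(x).
-/
theorem liftsPlots_untwist : LiftsPlots (untwist (ι := ι) hι (X := X) (Y := Y)) := by
  intro n z hz u₀
  obtain ⟨hz1, hz2⟩ := isPlot_prod_iff.mp (show IsPlot (Subtype.val ∘ z) from hz)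
  have hm : ∀ u, bodyMomentum (⟨1, X.moment (z u).1.1⟩ : CotangentBundle E G) =
      X.moment (z u).1.1 := fun u ↦ by
    have h := (leftMomentum_eq_moment_iff X _ _).mp (leftMomentum_one (X.moment (z u).1.1))
    rwa [inv_one, map_one] at h
  refine ⟨fun u ↦ ⟨((z u).1.1, (⟨1, X.moment (z u).1.1⟩, (z u).1.2)), ?_, ?_⟩, ?_,
    Filter.Eventually.of_forall fun u ↦ ?_⟩
  · have h := (z u).2
    unfold inductionMoment
    rw [hm]
    exact h
  · exact sub_eq_zero.mpr (leftMomentum_one _)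
  · exact isPlot_prod_iff.mpr ⟨hz1, isPlot_prod_iff.mpr
      ⟨contMDiff_cotangent_fixed (X.contDiff_moment hz1).contMDiff 1, hz2⟩⟩
  · refine Subtype.ext (Prod.ext ?_ rfl)
    show _ = X.act 1⁻¹ _
    rw [inv_one, map_one]
    rfl

end BiLevel

end Reciprocity

/-- Two surjections with the same fibres have the same quotient. -/
theorem exists_equiv_of_fibers {W A B : Type*} {f : W → A} {g : W → B}
    (hf : Function.Surjective f) (hg : Function.Surjective g)
    (h : ∀ w w', f w = f w' ↔ g w = g w') : ∃ t : A ≃ B, ∀ w, t (f w) = g w := by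
  choose s hs using hf
  refine ⟨Equiv.ofBijective (fun a ↦ g (s a)) ⟨fun a a' haa ↦ ?_, fun b ↦ ?_⟩,
    fun w ↦ (h _ _).mp (hs _)⟩
  · rw [← hs a, ← hs a']
    exact (h _ _).mpr haa
  · obtain ⟨w, rfl⟩ := hg b
    exact ⟨f w, (h _ _).mp (hs _)⟩

/-! ### Comparison of the forms -/

section Forms

variable {E : Type*} [NormedAddCommGroup E] [NormedSpace ℝ E] [FiniteDimensional ℝ E]
  {G : Type*} [TopologicalSpace G] [ChartedSpace E G] [Group G] [LieGroup 𝓘(ℝ, E) ∞ G]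
  {E' : Type*} [NormedAddCommGroup E'] [NormedSpace ℝ E']
  {H : Type*} [TopologicalSpace H] [ChartedSpace E' H] [Group H] [LieGroup 𝓘(ℝ, E') ∞ H]
  {ι : H →* G} (hι : ContMDiff 𝓘(ℝ, E') 𝓘(ℝ, E) ∞ ι)
  {X : HamiltonianSpace E G} {Y : HamiltonianSpace E' H}

/-- The forms of `(Res_H^G X)⁻ × Y` and of `X⁻ × Ind_H^G Y` have the same pullback to the points
`(x, p, y)`. -/
theorem pullback_untwist_eq_pullback_toLevel {σ : DForm (Induced E ι Y) 2}
    (hσ : IsInducedForm ι Y σ) :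
    ((oppositeSumForm (X.restrict ι hι).dForm Y.dForm).pullback Subtype.val
      (dSmooth_subtype_val _)).pullback (BiLevel.untwist hι) (BiLevel.dSmooth_untwist hι) =
    ((oppositeSumForm X.dForm σ).pullback Subtype.val (dSmooth_subtype_val _)).pullback
      BiLevel.toLevel BiLevel.dSmooth_toLevel := by
  apply DForm.ext
  funext n w hw u
  obtain ⟨hx, hpy⟩ := isPlot_prod_iff.mp (show IsPlot (Subtype.val ∘ w) from hw)
  obtain ⟨hp, hy⟩ := isPlot_prod_iff.mp hpy
  -- By this identity, dϖ + ω_Y − ω_X(x) becomes ω_Y − ω_X(q⁻¹x).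
  have h1 := d_liouvilleForm_eq_sub X hx hp (fun u ↦ (w u).2.2) u
  have h2 := congrArg (fun α : DForm _ 2 ↦ α.toFun (fun u ↦ ⟨(w u).1.2, (w u).2.1⟩) hpy u) hσ
  refine Eq.trans ?_ (congrArg₂ (· - ·) h2 rfl).symm
  refine Eq.trans ?_ (congrArg₂ (fun a b ↦ a + Y.dForm.toFun _ hy u - b) h1 rfl).symm
  show Y.dForm.toFun _ hy u - X.dForm.toFun _ (X.isPlot_act (contMDiff_base_inv hp) hx) u =
    X.dForm.toFun _ hx u - _ + _ - X.dForm.toFun _ hx u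
  abel

end Forms

end FrobRec
end

/-! ### Symplectic Frobenius reciprocity -/

theorem theorem4p1
    {EG : Type*} [NormedAddCommGroup EG] [NormedSpace ℝ EG] [FiniteDimensional ℝ EG]
    {G : Type*} [TopologicalSpace G] [T2Space G] [SecondCountableTopology G]
    [ChartedSpace EG G] [Group G] [LieGroup 𝓘(ℝ, EG) ∞ G]
    {EH : Type*} [NormedAddCommGroup EH] [NormedSpace ℝ EH] [FiniteDimensional ℝ EH]
    {H : Type*} [TopologicalSpace H] [T2Space H] [SecondCountableTopology H]
    [ChartedSpace EH H] [Group H] [LieGroup 𝓘(ℝ, EH) ∞ H]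
    (ι : H →* G) (hι : ContMDiff 𝓘(ℝ, EH) 𝓘(ℝ, EG) ∞ ι) (hinj : Function.Injective ι)
    (X : HamiltonianSpace EG G) (Y : HamiltonianSpace EH H) :
    ∃ t : HomInduced ι X Y ≃ HomRestricted ι hι X Y,
      (∀ (x : X.carrier) (p : CotangentBundle EG G) (y : Y.carrier)
        (hp : inductionMoment EG ι Y (p, y) = 0)
        (hx : inducedMoment EG ι Y (Reduction.mk _ _ ⟨(p, y), hp⟩) - X.moment x = 0),
        ∃ hz : Y.moment y - (X.restrict ι hι).moment (X.act p.1⁻¹ x) = 0,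
          t (Reduction.mk _ _ ⟨(x, Reduction.mk _ _ ⟨(p, y), hp⟩), hx⟩) =
            Reduction.mk _ _ ⟨(X.act p.1⁻¹ x, y), hz⟩) ∧
      ∃ ht : DSmooth t, DSmooth t.symm ∧
        (∃! σ : DForm (Induced EG ι Y) 2, IsInducedForm ι Y σ) ∧
        (∃! β : DForm (HomRestricted ι hι X Y) 2, IsHomRestrictedForm ι hι X Y β) ∧
        ∀ σ : DForm (Induced EG ι Y) 2, IsInducedForm ι Y σ →
          (∃! α : DForm (HomInduced ι X Y) 2, IsHomInducedForm ι X Y σ α) ∧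
          ∀ (α : DForm (HomInduced ι X Y) 2) (β : DForm (HomRestricted ι hι X Y) 2),
            IsHomInducedForm ι X Y σ α → IsHomRestrictedForm ι hι X Y β →
              β.pullback t ht = α := by
  have hl₁ : LiftsPlots (fun w : BiLevel ι X Y ↦ (Reduction.mk _ _ w.toLevel : HomInduced ι X Y)) :=
    (Reduction.liftsPlots_mk _ _).comp BiLevel.liftsPlots_toLevel
  have hl₂ : LiftsPlots (fun w : BiLevel ι X Y ↦
      (Reduction.mk _ _ (w.untwist hι) : HomRestricted ι hι X Y)) :=
    (Reduction.liftsPlots_mk _ _).comp (BiLevel.liftsPlots_untwist hι)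
  have hs₁ : DSmooth (fun w : BiLevel ι X Y ↦ (Reduction.mk _ _ w.toLevel : HomInduced ι X Y)) :=
    (Reduction.dSmooth_mk _ _).comp BiLevel.dSmooth_toLevel
  have hs₂ : DSmooth (fun w : BiLevel ι X Y ↦
      (Reduction.mk _ _ (w.untwist hι) : HomRestricted ι hι X Y)) :=
    (Reduction.dSmooth_mk _ _).comp (BiLevel.dSmooth_untwist hι)
  obtain ⟨t, ht⟩ := exists_equiv_of_fibers hl₁.surjective hl₂.surjective
    (BiLevel.mk_toLevel_eq_iff hι)
  have hst : DSmooth t := hl₁.dSmooth ((congrArg DSmooth (funext ht)).mpr hs₂)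
  have hst' : DSmooth t.symm := hl₂.dSmooth
    ((congrArg DSmooth (funext fun w ↦ t.symm_apply_eq.mpr (ht w).symm)).mpr hs₁)
  -- The defining identity lives on the zero level of X⁻ × Ind_H^G Y. It can be tested on `BiLevel`,
  -- since `BiLevel.toLevel` lifts plots; there it is the comparison of forms just proved.
  have hform : ∀ (σ : DForm (Induced EG ι Y) 2) (β : DForm (HomRestricted ι hι X Y) 2),
      IsInducedForm ι Y σ → IsHomRestrictedForm ι hι X Y β →
        IsHomInducedForm ι X Y σ (β.pullback t hst) := by
    intro σ β hσ hβ
    refine BiLevel.liftsPlots_toLevel.pullback_injective BiLevel.dSmooth_toLevel ?_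
    rw [← pullback_untwist_eq_pullback_toLevel hι hσ, ← show Reduction.IsReducedForm _ _ _ _ from hβ]
    apply DForm.ext
    funext n w hw u
    exact β.toFun_eq _ (funext fun v ↦ ht (w v)) u
  have hβ := existsUnique_intertwinerForm (X.restrict ι hι) Y
  refine ⟨t, fun x p y hp hx ↦ ⟨BiLevel.moment_inv_act hι ⟨(x, (p, y)), hp, hx⟩,
    ht ⟨(x, (p, y)), hp, hx⟩⟩, hst, hst', existsUnique_inducedForm hι Y, hβ, fun σ hσ ↦ ?_⟩
  have huniq : ∀ α α' : DForm (HomInduced ι X Y) 2, IsHomInducedForm ι X Y σ α →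
      IsHomInducedForm ι X Y σ α' → α = α' := fun α α' h h' ↦
    (Reduction.liftsPlots_mk _ _).pullback_injective (Reduction.dSmooth_mk _ _) (h.trans h'.symm)
  obtain ⟨β, hβ, -⟩ := hβ
  exact ⟨⟨_, hform σ β hσ hβ, fun α h ↦ huniq _ _ h (hform σ β hσ hβ)⟩,
    fun α β hα hβ ↦ huniq _ _ (hform σ β hσ hβ) hα⟩
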